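/- **Setting.** Let $T>0$, $I=[0,T]$, $\rho_E,\rho_{NS},\nu_{NS},g>0$, $\sigma\ge 0$; write $x^\perp=(-x_2,x_1)$. Let $z\in C^4(I\times\mathbb R;\mathbb R^2)$ be such that for every $t\in I$ the map $z(t,\cdot)$ is injective with $\partial_\alpha z\neq 0$, and let $\Gamma_t=z(t,\mathbb R)$. For each $t\in I$ let the plane be partitioned as $\mathbb R^2=\Omega_E(t)\cup\Gamma_t\cup\Omega_{NS}(t)$ with $\Omega_E(t),\Omega_{NS}(t)$ open and connected, and let $\mathbf n=-(\partial_\alpha z)^\perp$. The configuration is $2\pi$-periodic in the direction $\mathbf e_1$, and $\mathbf n$ points into $\Omega_E(t)$; that is, either $z(t,\alpha+2\pi)=z(t,\alpha)+2\pi\mathbf e_1$ and $\Omega_E(t)$, $\Omega_{NS}(t)$ contain $\{x_2<-M\}$, $\{x_2>M\}$ respectively for some $M=M(t)$, or $z(t,\alpha+2\pi)=z(t,\alpha)-2\pi\mathbf e_1$ and they contain $\{x_2>M\}$, $\{x_2<-M\}$ respectively (the same alternative for all $t$). Let $u,p$ be $C^1$ on $\{(t,x):t\in I,\,x\in\overline{\Omega_E(t)}\}$,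 and let $v$ be $C^2$ and $q$ be $C^1$ on $\{(t,x):t\in I,\,x\in\overline{\Omega_{NS}(t)}\}$, all $2\pi$-periodic in $x_1$, and for each $t\in I$ let $u(t,x)\to0$ and $v(t,x)\to 0$ as $|x_2|\to\infty$, uniformly in $x_1$, in the respective domains. Write $\operatorname{curl} f=\partial_1f_2-\partial_2f_1$, $\widetilde u(t,\alpha)=u(t,z(t,\alpha))$, $\widetilde v(t,\alpha)=v(t,z(t,\alpha))$, and suppose that for each $t\in I$ the function $\operatorname{curl} v(t,\cdot)$ is integrable on $\Omega_{NS}(t)\cap([0,2\pi)\times\mathbb R)$. Suppose that $(u,v,z,p,q)$ solves, for all $t\in I$, $$\rho_E(\partial_tu+(u\cdot\nabla)u)=-\nabla p-g\rho_E\mathbf e_2,\quad \operatorname{div}u=\operatorname{curl}u=0\quad\text{in }\Omega_E(t),$$ $$\rho_{NS}(\partial_tv+(v\cdot\nabla)v)=\nu_{NS}\Delta v-\nabla q-g\rho_{NS}\mathbf e_2,\quad \operatorname{div}v=0\quad\text{in }\Omega_{NS}(t),$$ and, for all $\alpha\in\mathbb R$, with $D(v)=\nabla v+(\nabla v)^\top$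 and $K=\dfrac{\partial_\alpha z_1\,\partial_\alpha^2z_2-\partial_\alpha z_2\,\partial_\alpha^2z_1}{|\partial_\alpha z|^3}$, $$(\partial_tz-\widetilde u)\cdot\mathbf n=0,\qquad \partial_tz-\widetilde v=0,\qquad p(t,z)\,\mathbf n+\big(q(t,z)\,1_{2\times2}-2\nu_{NS}D(v)|_{(t,z)}\big)\mathbf n=-\sigma K\,\mathbf n .$$ **Vorticities and integrals.** Let $\omega_\Gamma(t,\alpha)=(\widetilde u-\widetilde v)\cdot\partial_\alpha z$, let $\omega_v(t,\cdot)=\operatorname{curl}v(t,\cdot)$ on $\Omega_{NS}(t)$ and $0$ elsewhere, and $$B_\Gamma(z,\omega_\Gamma;t,\alpha)=\lim_{\substack{\delta\downarrow0\\ R\to\infty}}\frac1{2\pi}\int_{\delta<|\beta-\alpha|<R}\frac{(z(t,\alpha)-z(t,\beta))^\perp}{|z(t,\alpha)-z(t,\beta)|^2}\,\omega_\Gamma(t,\beta)\,d\beta,$$ $$B_{NS}(z,\omega_v;t,\alpha)=\lim_{R\to\infty}\frac1{2\pi}\int_{\Omega_{NS}(t)\cap\{|y_1-z_1(t,\alpha)|<R\}}\frac{(z(t,\alpha)-y)^\perp}{|z(t,\alpha)-y|^2}\,\omega_v(t,y)\,dy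 .$$ **Proposition 2.1.** For all $t\in I$ and $\alpha\in\mathbb R$ the truncated integrals converge absolutely, both limits exist, and $$\widetilde u(t,\alpha)=\frac{\omega_\Gamma\,\partial_\alpha z}{2|\partial_\alpha z|^2}\bigg|_{(t,\alpha)}+B_\Gamma(z,\omega_\Gamma;t,\alpha)+B_{NS}(z,\omega_v;t,\alpha).$$ -/

import Mathlib

open Set Filter Topology MeasureTheory

noncomputable section

namespace TwoFluid

/-- The plane with its Euclidean norm. The coordinates `x₁, x₂` are `x 0, x 1`. -/
abbrev Plane : Type := EuclideanSpace ℝ (Fin 2)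

/-- The unit vector `𝐞₁`. -/
def e₁ : Plane := EuclideanSpace.single 0 1

/-- The unit vector `𝐞₂`. -/
def e₂ : Plane := EuclideanSpace.single 1 1

/-- `x^⊥ = (-x₂, x₁)`. -/
def perp (x : Plane) : Plane := !₂[-(x 1), x 0]

/-! ### Differential operators in the plane -/

/-- The divergence `∂₁f₁ + ∂₂f₂`. -/
def divergence (f : Plane → Plane) (x : Plane) : ℝ :=
  (fderiv ℝ f x e₁) 0 + (fderiv ℝ f x e₂) 1

/-- The scalar vorticity `∂₁f₂ - ∂₂f₁`. -/
def curl (f : Plane → Plane) (x : Plane) : ℝ :=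
  (fderiv ℝ f x e₁) 1 - (fderiv ℝ f x e₂) 0

/-- The matrix `D(f) = ∇f + (∇f)ᵀ` of a field `f` that is differentiable on a set `S` up to its
boundary, as a linear map. -/
def symGrad (S : Set Plane) (f : Plane → Plane) (x : Plane) : Plane →L[ℝ] Plane :=
  fderivWithin ℝ f S x + ContinuousLinearMap.adjoint (fderivWithin ℝ f S x)

/-- The curvature of a parametrized plane curve. -/
def curvature (ζ : ℝ → Plane) (α : ℝ) : ℝ :=
  ((deriv ζ α) 0 * (iteratedDeriv 2 ζ α) 1 - (deriv ζ α) 1 * (iteratedDeriv 2 ζ α) 0)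
    / ‖deriv ζ α‖ ^ 3

/-- The vector `𝐧 = -(∂_α ζ)^⊥`, normal to a parametrized plane curve `ζ`. -/
def normal (ζ : ℝ → Plane) (α : ℝ) : Plane := -perp (deriv ζ α)

/-- The closed space-time domain `{(t, x) : t ∈ [0, T], x ∈ closure Ω(t)}`. -/
def spaceTime (T : ℝ) (Ω : ℝ → Set Plane) : Set (ℝ × Plane) :=
  {q | q.1 ∈ Icc 0 T ∧ q.2 ∈ closure (Ω q.1)}

/-! ### The two-fluid system -/

/-- The geometric setting on `[0, T]`: `z` is a periodic `C⁴` family of simple regular curves `Γ_t`,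
and the plane is partitioned into the region `ΩE t`, the curve `Γ_t`, and the region `ΩNS t`.

The number `s` is `1` or `-1`: for `s = 1` the curve runs from left to right and `ΩE t` is the region
below it, for `s = -1` it runs from right to left and `ΩE t` is the region above it. In both cases
`ΩE t` is to the right of the curve, that is, the normal `𝐧 = -(∂_α z)^⊥` points into `ΩE t`. -/
structure IsInterface (T s : ℝ) (z : ℝ → ℝ → Plane) (ΩE ΩNS : ℝ → Set Plane) : Prop where
  orientation : s = 1 ∨ s = -1
  smooth : ContDiffOn ℝ 4 (fun q : ℝ × ℝ => z q.1 q.2) (Icc 0 T ×ˢ univ)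
  periodic : ∀ t ∈ Icc 0 T, ∀ α, z t (α + 2 * Real.pi) = z t α + (s * (2 * Real.pi)) • e₁
  injective : ∀ t ∈ Icc 0 T, Function.Injective (z t)
  regular : ∀ t ∈ Icc 0 T, ∀ α, deriv (z t) α ≠ 0
  isOpen_E : ∀ t ∈ Icc 0 T, IsOpen (ΩE t)
  isOpen_NS : ∀ t ∈ Icc 0 T, IsOpen (ΩNS t)
  isConnected_E : ∀ t ∈ Icc 0 T, IsConnected (ΩE t)
  isConnected_NS : ∀ t ∈ Icc 0 T, IsConnected (ΩNS t)
  cover : ∀ t ∈ Icc 0 T, ΩE t ∪ range (z t) ∪ ΩNS t = univ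
  disjoint_E_NS : ∀ t ∈ Icc 0 T, Disjoint (ΩE t) (ΩNS t)
  disjoint_E_curve : ∀ t ∈ Icc 0 T, Disjoint (ΩE t) (range (z t))
  disjoint_NS_curve : ∀ t ∈ Icc 0 T, Disjoint (ΩNS t) (range (z t))
  side_E : ∀ t ∈ Icc 0 T, ∃ M : ℝ, ∀ x : Plane, s * x 1 < -M → x ∈ ΩE t
  side_NS : ∀ t ∈ Icc 0 T, ∃ M : ℝ, ∀ x : Plane, M < s * x 1 → x ∈ ΩNS t

/-- The function spaces: classical regularity up to the boundary, periodicity in the direction `𝐞₁`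
with period `2π`, velocities that vanish as `|x₂| → ∞`, and a bulk vorticity that is
integrable over a period. -/
structure InFunctionSpaces (T : ℝ) (ΩE ΩNS : ℝ → Set Plane)
    (u v : ℝ → Plane → Plane) (p q : ℝ → Plane → ℝ) : Prop where
  smooth_u : ContDiffOn ℝ 1 (fun w : ℝ × Plane => u w.1 w.2) (spaceTime T ΩE)
  smooth_p : ContDiffOn ℝ 1 (fun w : ℝ × Plane => p w.1 w.2) (spaceTime T ΩE)
  smooth_v : ContDiffOn ℝ 2 (fun w : ℝ × Plane => v w.1 w.2) (spaceTime T ΩNS)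
  smooth_q : ContDiffOn ℝ 1 (fun w : ℝ × Plane => q w.1 w.2) (spaceTime T ΩNS)
  periodic_u : ∀ t ∈ Icc 0 T, ∀ x ∈ closure (ΩE t), u t (x + (2 * Real.pi) • e₁) = u t x
  periodic_p : ∀ t ∈ Icc 0 T, ∀ x ∈ closure (ΩE t), p t (x + (2 * Real.pi) • e₁) = p t x
  periodic_v : ∀ t ∈ Icc 0 T, ∀ x ∈ closure (ΩNS t), v t (x + (2 * Real.pi) • e₁) = v t x
  periodic_q : ∀ t ∈ Icc 0 T, ∀ x ∈ closure (ΩNS t), q t (x + (2 * Real.pi) • e₁) = q t x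
  decay_u : ∀ t ∈ Icc 0 T, ∀ ε > 0, ∃ M : ℝ, ∀ x ∈ ΩE t, M < |x 1| → ‖u t x‖ < ε
  decay_v : ∀ t ∈ Icc 0 T, ∀ ε > 0, ∃ M : ℝ, ∀ x ∈ ΩNS t, M < |x 1| → ‖v t x‖ < ε
  integrable_curl : ∀ t ∈ Icc 0 T,
    IntegrableOn (curl (v t)) (ΩNS t ∩ {x | 0 ≤ x 0 ∧ x 0 < 2 * Real.pi})

/-- The coupled free-boundary system: the Euler equations for `(u, p)` in `ΩE t`, with `u`
irrotational, the Navier-Stokes equations for `(v, q)` in `ΩNS t`, incompressibility of both, and the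
kinematic and stress conditions on the interface. -/
structure SolvesSystem (ρE ρNS ν g σ T : ℝ) (z : ℝ → ℝ → Plane) (ΩE ΩNS : ℝ → Set Plane)
    (u v : ℝ → Plane → Plane) (p q : ℝ → Plane → ℝ) : Prop where
  euler : ∀ t ∈ Icc 0 T, ∀ x ∈ ΩE t,
    ρE • (derivWithin (fun τ => u τ x) (Icc 0 T) t + fderiv ℝ (u t) x (u t x))
      = -gradient (p t) x - (g * ρE) • e₂
  navierStokes : ∀ t ∈ Icc 0 T, ∀ x ∈ ΩNS t,
    ρNS • (derivWithin (fun τ => v τ x) (Icc 0 T) t + fderiv ℝ (v t) x (v t x))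
      = ν • Laplacian.laplacian (v t) x - gradient (q t) x - (g * ρNS) • e₂
  div_u : ∀ t ∈ Icc 0 T, ∀ x ∈ ΩE t, divergence (u t) x = 0
  div_v : ∀ t ∈ Icc 0 T, ∀ x ∈ ΩNS t, divergence (v t) x = 0
  curl_u : ∀ t ∈ Icc 0 T, ∀ x ∈ ΩE t, curl (u t) x = 0
  kinematic_u : ∀ t ∈ Icc 0 T, ∀ α,
    inner ℝ (derivWithin (fun τ => z τ α) (Icc 0 T) t - u t (z t α)) (normal (z t) α) = 0
  kinematic_v : ∀ t ∈ Icc 0 T, ∀ α,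
    derivWithin (fun τ => z τ α) (Icc 0 T) t - v t (z t α) = 0
  stress : ∀ t ∈ Icc 0 T, ∀ α,
    p t (z t α) • normal (z t) α
        + (q t (z t α) • normal (z t) α
          - (2 * ν) • symGrad (closure (ΩNS t)) (v t) (z t α) (normal (z t) α))
      = -((σ * curvature (z t) α) • normal (z t) α)

/-! ### Vorticities and the associated singular integrals -/

/-- The interface vorticity `ω_Γ = (ũ - ṽ) · ∂_α z`. -/
def interfaceVorticity (z : ℝ → ℝ → Plane) (u v : ℝ → Plane → Plane) (t α : ℝ) : ℝ :=
  inner ℝ (u t (z t α) - v t (z t α)) (deriv (z t) α)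

/-- The bulk vorticity `ω_v`: the vorticity of `v t` in `Ω t`, zero elsewhere. -/
def bulkVorticity (Ω : ℝ → Set Plane) (v : ℝ → Plane → Plane) (t : ℝ) : Plane → ℝ :=
  (Ω t).indicator (curl (v t))

/-- The kernel `x^⊥ / |x|²`. -/
def kernel (x : Plane) : Plane := (‖x‖ ^ 2)⁻¹ • perp x

/-- The integrand of the Birkhoff-Rott integral. -/
def brIntegrand (ζ : ℝ → Plane) (ω : ℝ → ℝ) (α β : ℝ) : Plane := ω β • kernel (ζ α - ζ β)

/-- The truncated Birkhoff-Rott integral, over `{β : r.1 < |β - α| < r.2}`. -/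
def brTruncated (ζ : ℝ → Plane) (ω : ℝ → ℝ) (α : ℝ) (r : ℝ × ℝ) : Plane :=
  (2 * Real.pi)⁻¹ • ∫ β in {β : ℝ | r.1 < |β - α| ∧ |β - α| < r.2}, brIntegrand ζ ω α β

/-- The Birkhoff-Rott integral `B_Γ`, a principal value at `β = α` and at infinity. -/
def birkhoffRott (ζ : ℝ → Plane) (ω : ℝ → ℝ) (α : ℝ) : Plane :=
  limUnder (𝓝[>] (0 : ℝ) ×ˢ (atTop : Filter ℝ)) (brTruncated ζ ω α)

/-- The principal value that defines `B_Γ` exists: the truncated integrals converge absolutely and have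
a limit. -/
def BirkhoffRottExists (ζ : ℝ → Plane) (ω : ℝ → ℝ) (α : ℝ) : Prop :=
  (∀ δ > 0, ∀ R : ℝ, IntegrableOn (brIntegrand ζ ω α) {β : ℝ | δ < |β - α| ∧ |β - α| < R}) ∧
  ∃ b, Tendsto (brTruncated ζ ω α) (𝓝[>] (0 : ℝ) ×ˢ (atTop : Filter ℝ)) (𝓝 b)

/-- The integrand of the bulk Biot-Savart integral. -/
def bulkIntegrand (ω : Plane → ℝ) (x y : Plane) : Plane := ω y • kernel (x - y)

/-- The bulk Biot-Savart integral, truncated to `{y ∈ Ω : |y₁ - x₁| < R}`. -/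
def bulkTruncated (Ω : Set Plane) (ω : Plane → ℝ) (x : Plane) (R : ℝ) : Plane :=
  (2 * Real.pi)⁻¹ • ∫ y in Ω ∩ {y | |y 0 - x 0| < R}, bulkIntegrand ω x y

/-- The bulk Biot-Savart integral `B_NS`. Since `ω` is periodic in `y₁` and the kernel is of size
`1/|y₁|`, it is a principal value at infinity in the direction `𝐞₁`. -/
def bulkBiotSavart (Ω : Set Plane) (ω : Plane → ℝ) (x : Plane) : Plane :=
  limUnder (atTop : Filter ℝ) (bulkTruncated Ω ω x)

/-- The principal value that defines `B_NS` exists: the truncated integrals converge absolutely and have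
a limit. -/
def BulkBiotSavartExists (Ω : Set Plane) (ω : Plane → ℝ) (x : Plane) : Prop :=
  (∀ R : ℝ, IntegrableOn (bulkIntegrand ω x) (Ω ∩ {y | |y 0 - x 0| < R})) ∧
  ∃ b, Tendsto (bulkTruncated Ω ω x) (atTop : Filter ℝ) (𝓝 b)

end TwoFluid

end

/-! Identify the plane with ℂ and pass to the conjugate velocities f_E = u₁ − i u₂ and f_N = v₁ − i
v₂. With ∂̄ = ∂₁ + i∂₂ one has ∂̄f = div − i curl (`dbar_field`), so f_E is holomorphic and ∂̄f_N =
−iω_v, while the conjugate of x^⊥/|x|² is −i/x (`conjC_kernel`). The kinematic conditions make the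
normal components of u and v agree on the curve, so (f_E − f_N) ∂_αz is real and equals ω_Γ
(`field_sub_mul_deriv`). The claim thus becomes a Plemelj relation. Let L be the principal value of
∫ (f_E − f_N) dζ / (z(α) − ζ) and J that of ∫ ∂̄f_N / (z(α) − y) dy; then L + iJ = iπ(f_E + f_N) at
z(α) (`IsSeparated.tendsto_cauchy`). The two integrals yield the mean (f_E + f_N)/2, the tangential
term yields half the jump, (f_E − f_N)/2, and the sum is f_E.

The relation is obtained over one period. Summing 1/(x − y) symmetrically over the translates by 2πk
gives the kernel cot((x − y)/2)/2. Its regularisation `regKernel` is C¹, and ∂̄ of it is twice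
`regDensity`, a nonnegative density that concentrates at the pole with limiting mass π. Green's
theorem on one side of the curve (`IsLeftSide.integral_curve_eq`), localised to a period by a
partition of unity (`IsLeftSide.integral_period_eq`), turns the regularised line integral into area
integrals (`IsLeftSide.integral_regKernel_eq`). A point of a smooth boundary sees half of the mass
(`IsLeftSide.tendsto_integral_regDensity`). The decay of the velocities removes the contribution of
large heights, where the kernel itself tends to nonzero constants. The result is used for Ω_NS,
which is to the left of the curve, and for Ω_E, which is to the left of the reversed curve; the two
half residues add up.

That the regions lie on these sides has to be proved (`IsSeparated.exists_isLeftSide`):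
connectedness leaves one wrong configuration, and Green's theorem with a suitable test function
excludes it. Two passages to the limit remain. The smooth cutoff is exchanged for the sharp one,
their difference being odd at leading order (`tendsto_integral_cutoff_sub`). The periodic kernel is
unfolded into the truncated integrals (`IsPeriodicCurve.tendsto_integral_truncated`,
`IsPeriodicDensity.tendsto_setIntegral_abs_lt`): complete periods produce the partial sums of the
cotangent series, and the incomplete ones at the ends contribute nothing in the limit. -/

noncomputable section

namespace TwoFluid

open Complex (I)
open scoped ComplexConjugate Real

section

/-! ### Periodic curves in the complex plane and their tubular neighbourhoods -/

/-- A simple regular `C²` curve that advances by `2π s`, `s = ±1`, over a period. -/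
structure IsPeriodicCurve (s : ℝ) (ζ : ℝ → ℂ) : Prop where
  orientation : s = 1 ∨ s = -1
  smooth : ContDiff ℝ 2 ζ
  periodic : ∀ a, ζ (a + 2 * π) = ζ a + ((s * (2 * π) : ℝ) : ℂ)
  injective : Function.Injective ζ
  regular : ∀ a, deriv ζ a ≠ 0

/-- Coordinates along and normal to a curve; positive imaginary parts are to the left. -/
def tube (ζ : ℝ → ℂ) (w : ℂ) : ℂ := ζ w.re + w.im * (I * deriv ζ w.re)

/-- The derivative of `tube ζ` in the direction of the curve. -/
def tubeTangent (ζ : ℝ → ℂ) (w : ℂ) : ℂ :=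
  deriv ζ w.re + w.im * (I * deriv (deriv ζ) w.re)

/-- The Jacobian determinant of `tube ζ`. -/
def tubeJac (ζ : ℝ → ℂ) (w : ℂ) : ℝ :=
  (tubeTangent ζ w).re * (I * deriv ζ w.re).im - (tubeTangent ζ w).im * (I * deriv ζ w.re).re

/-- The derivative of `tube ζ`. -/
def tubeDeriv (ζ : ℝ → ℂ) (w : ℂ) : ℂ →L[ℝ] ℂ :=
  Complex.reCLM.smulRight (tubeTangent ζ w) + Complex.imCLM.smulRight (I * deriv ζ w.re)

theorem tubeDeriv_apply (ζ : ℝ → ℂ) (w h : ℂ) :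
    tubeDeriv ζ w h = h.re * tubeTangent ζ w + h.im * (I * deriv ζ w.re) := by
  simp [tubeDeriv]

theorem det_tubeDeriv (ζ : ℝ → ℂ) (w : ℂ) : (tubeDeriv ζ w).det = tubeJac ζ w := by
  rw [ContinuousLinearMap.det, ← LinearMap.det_toMatrix Complex.basisOneI, Matrix.det_fin_two]
  simp only [LinearMap.toMatrix_apply, ContinuousLinearMap.coe_coe, tubeDeriv_apply,
    Complex.coe_basisOneI, Complex.coe_basisOneI_repr, tubeJac]
  simp
  ring

namespace IsPeriodicCurve

variable {s : ℝ} {ζ : ℝ → ℂ}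

theorem sq_orientation (h : IsPeriodicCurve s ζ) : s * s = 1 := by
  rcases h.orientation with rfl | rfl <;> norm_num

theorem abs_orientation (h : IsPeriodicCurve s ζ) : |s| = 1 := by
  rcases h.orientation with rfl | rfl <;> norm_num

theorem continuous (h : IsPeriodicCurve s ζ) : Continuous ζ := h.smooth.continuous

theorem differentiable (h : IsPeriodicCurve s ζ) : Differentiable ℝ ζ :=
  h.smooth.differentiable (by norm_num)

theorem hasDerivAt (h : IsPeriodicCurve s ζ) (a : ℝ) : HasDerivAt ζ (deriv ζ a) a :=
  (h.differentiable a).hasDerivAt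

theorem contDiff_deriv (h : IsPeriodicCurve s ζ) : ContDiff ℝ 1 (deriv ζ) := by
  have : ContDiff ℝ (1 + 1) ζ := h.smooth
  exact (contDiff_succ_iff_deriv.1 this).2.2

theorem continuous_deriv (h : IsPeriodicCurve s ζ) : Continuous (deriv ζ) :=
  h.contDiff_deriv.continuous

theorem continuous_deriv_deriv (h : IsPeriodicCurve s ζ) : Continuous (deriv (deriv ζ)) :=
  h.contDiff_deriv.continuous_deriv le_rfl

theorem deriv_periodic (h : IsPeriodicCurve s ζ) : Function.Periodic (deriv ζ) (2 * π) := by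
  intro a
  have : (fun a => ζ (a + 2 * π)) = fun a => ζ a + ((s * (2 * π) : ℝ) : ℂ) := funext h.periodic
  rw [← deriv_comp_add_const, this, deriv_add_const]

theorem deriv_deriv_periodic (h : IsPeriodicCurve s ζ) :
    Function.Periodic (deriv (deriv ζ)) (2 * π) := by
  intro a
  rw [← deriv_comp_add_const, funext h.deriv_periodic]

theorem sub_linear_periodic (h : IsPeriodicCurve s ζ) :
    Function.Periodic (fun a => ζ a - ((s * a : ℝ) : ℂ)) (2 * π) := by
  intro a
  show ζ (a + 2 * π) - ((s * (a + 2 * π) : ℝ) : ℂ) = ζ a - ((s * a : ℝ) : ℂ)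
  rw [h.periodic]
  push_cast
  ring

theorem add_int_mul (h : IsPeriodicCurve s ζ) (a : ℝ) (n : ℤ) :
    ζ (a + n * (2 * π)) = ζ a + ((s * (n * (2 * π)) : ℝ) : ℂ) := by
  have : ζ (a + n * (2 * π)) - ((s * (a + n * (2 * π)) : ℝ) : ℂ) = ζ a - ((s * a : ℝ) : ℂ) :=
    (h.sub_linear_periodic.int_mul n) a
  rw [sub_eq_iff_eq_add] at this
  rw [this]
  push_cast
  ring

theorem exists_norm_sub_linear_le (h : IsPeriodicCurve s ζ) :
    ∃ C, ∀ a, ‖ζ a - ((s * a : ℝ) : ℂ)‖ ≤ C := by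
  have hc : Continuous (fun a => ζ a - ((s * a : ℝ) : ℂ)) :=
    h.continuous.sub (Complex.continuous_ofReal.comp (continuous_const.mul continuous_id))
  obtain ⟨C, hC⟩ := (h.sub_linear_periodic.isBounded_of_continuous
    Real.two_pi_pos.ne' hc).exists_norm_le
  exact ⟨C, fun a => hC _ ⟨a, rfl⟩⟩

theorem exists_norm_deriv_le (h : IsPeriodicCurve s ζ) : ∃ C, ∀ a, ‖deriv ζ a‖ ≤ C := by
  obtain ⟨C, hC⟩ := (h.deriv_periodic.isBounded_of_continuous
    Real.two_pi_pos.ne' h.continuous_deriv).exists_norm_le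
  exact ⟨C, fun a => hC _ ⟨a, rfl⟩⟩

theorem tube_ofReal (a : ℝ) : tube ζ a = ζ a := by simp [tube]

theorem contDiff_tube (h : IsPeriodicCurve s ζ) : ContDiff ℝ 1 (tube ζ) := by
  unfold tube
  have h1 : ContDiff ℝ 1 (fun w : ℂ => ζ w.re) :=
    (h.smooth.of_le (by norm_num)).comp Complex.reCLM.contDiff
  have h2 : ContDiff ℝ 1 (fun w : ℂ => deriv ζ w.re) :=
    h.contDiff_deriv.comp Complex.reCLM.contDiff
  have h3 : ContDiff ℝ 1 (fun w : ℂ => (w.im : ℂ)) :=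
    Complex.ofRealCLM.contDiff.comp Complex.imCLM.contDiff
  exact h1.add (h3.mul (contDiff_const.mul h2))

theorem continuous_tube (h : IsPeriodicCurve s ζ) : Continuous (tube ζ) :=
  h.contDiff_tube.continuous

theorem continuous_tubeTangent (h : IsPeriodicCurve s ζ) : Continuous (tubeTangent ζ) := by
  unfold tubeTangent
  have h1 := h.continuous_deriv.comp Complex.continuous_re
  have h2 := h.continuous_deriv_deriv.comp Complex.continuous_re
  have h3 := Complex.continuous_ofReal.comp Complex.continuous_im
  exact h1.add (h3.mul (continuous_const.mul h2))

theorem continuous_tubeJac (h : IsPeriodicCurve s ζ) : Continuous (tubeJac ζ) := by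
  have h1 := h.continuous_tubeTangent
  have h2 : Continuous fun w : ℂ => I * deriv ζ w.re :=
    continuous_const.mul (h.continuous_deriv.comp Complex.continuous_re)
  exact ((Complex.continuous_re.comp h1).mul (Complex.continuous_im.comp h2)).sub
    ((Complex.continuous_im.comp h1).mul (Complex.continuous_re.comp h2))

theorem hasFDerivAt_tube (h : IsPeriodicCurve s ζ) (w : ℂ) :
    HasFDerivAt (tube ζ) (tubeDeriv ζ w) w := by
  have h1 : HasFDerivAt (fun w : ℂ => ζ w.re) (Complex.reCLM.smulRight (deriv ζ w.re)) w := by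
    refine (((h.hasDerivAt w.re).hasFDerivAt).comp w Complex.reCLM.hasFDerivAt).congr_fderiv ?_
    ext; simp
  have h2 : HasFDerivAt (fun w : ℂ => deriv ζ w.re)
      (Complex.reCLM.smulRight (deriv (deriv ζ) w.re)) w := by
    refine ((((h.contDiff_deriv.differentiable (by norm_num) w.re).hasDerivAt).hasFDerivAt).comp w
      Complex.reCLM.hasFDerivAt).congr_fderiv ?_
    ext; simp
  have h3 : HasFDerivAt (fun w : ℂ => (w.im : ℂ)) (Complex.ofRealCLM.comp Complex.imCLM) w :=
    (Complex.ofRealCLM.comp Complex.imCLM).hasFDerivAt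
  have := h1.add (h3.mul (h2.const_mul I))
  refine this.congr_fderiv ?_
  ext1 v
  simp [tubeDeriv_apply, tubeTangent]
  ring

theorem tube_add_int_mul (h : IsPeriodicCurve s ζ) (w : ℂ) (n : ℤ) :
    tube ζ (w + ((n * (2 * π) : ℝ) : ℂ)) = tube ζ w + ((s * (n * (2 * π)) : ℝ) : ℂ) := by
  have h1 := h.add_int_mul w.re n
  have h2 := (h.deriv_periodic.int_mul n) w.re
  simp only [tube, Complex.add_re, Complex.ofReal_re, Complex.add_im, Complex.ofReal_im, add_zero]
  rw [h1, h2]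
  ring

theorem tubeJac_add_int_mul (h : IsPeriodicCurve s ζ) (w : ℂ) (n : ℤ) :
    tubeJac ζ (w + ((n * (2 * π) : ℝ) : ℂ)) = tubeJac ζ w := by
  have h2 := (h.deriv_periodic.int_mul n) w.re
  have h3 := (h.deriv_deriv_periodic.int_mul n) w.re
  simp only [tubeJac, tubeTangent, Complex.add_re, Complex.ofReal_re, Complex.add_im,
    Complex.ofReal_im, add_zero]
  rw [h2, h3]

/-- In a tube the position along the curve is controlled by the real part. -/
theorem exists_abs_re_tube_sub_le (h : IsPeriodicCurve s ζ) :
    ∃ C, ∀ w : ℂ, |w.im| ≤ 1 → ‖tube ζ w - ((s * w.re : ℝ) : ℂ)‖ ≤ C := by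
  obtain ⟨C, hC⟩ := h.exists_norm_sub_linear_le
  obtain ⟨D, hD⟩ := h.exists_norm_deriv_le
  refine ⟨C + D, fun w hw => ?_⟩
  have : tube ζ w - ((s * w.re : ℝ) : ℂ)
      = (ζ w.re - ((s * w.re : ℝ) : ℂ)) + w.im * (I * deriv ζ w.re) := by
    simp only [tube]; ring
  rw [this]
  refine (norm_add_le _ _).trans (add_le_add (hC _) ?_)
  simp only [norm_mul, Complex.norm_real, Complex.norm_I, one_mul, Real.norm_eq_abs]
  calc |w.im| * ‖deriv ζ w.re‖ ≤ 1 * D :=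
        mul_le_mul hw (hD _) (norm_nonneg _) zero_le_one
    _ = D := one_mul D

/-- On the curve itself the columns of the derivative are ζ' and iζ', with determinant |ζ'|². -/
theorem tubeJac_ofReal_pos (h : IsPeriodicCurve s ζ) (a : ℝ) : 0 < tubeJac ζ a := by
  have := Complex.normSq_pos.2 (h.regular a)
  simpa [tubeJac, tubeTangent, Complex.normSq_apply] using this

theorem hasStrictFDerivAt_tube (h : IsPeriodicCurve s ζ) (w : ℂ) :
    HasStrictFDerivAt (tube ζ) (tubeDeriv ζ w) w :=
  h.contDiff_tube.contDiffAt.hasStrictFDerivAt' (h.hasFDerivAt_tube w) (by norm_num)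

theorem exists_injOn_nhds (h : IsPeriodicCurve s ζ) {w : ℂ} (hw : 0 < tubeJac ζ w) :
    ∃ U ∈ 𝓝 w, InjOn (tube ζ) U := by
  have hd : (tubeDeriv ζ w).det ≠ 0 := by rw [det_tubeDeriv]; exact hw.ne'
  have hs : HasStrictFDerivAt (tube ζ)
      (((tubeDeriv ζ w).toContinuousLinearEquivOfDetNeZero hd : ℂ ≃L[ℝ] ℂ) : ℂ →L[ℝ] ℂ) w := by
    simpa using h.hasStrictFDerivAt_tube w
  exact ⟨_, hs.toOpenPartialHomeomorph.open_source.mem_nhds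
    hs.mem_toOpenPartialHomeomorph_source, hs.toOpenPartialHomeomorph.injOn⟩

end IsPeriodicCurve

/-- The number `d` is the width of a tubular neighbourhood of the curve `ζ`. -/
structure IsTubeWidth (ζ : ℝ → ℂ) (d : ℝ) : Prop where
  pos : 0 < d
  le_one : d ≤ 1
  injOn : InjOn (tube ζ) {w | |w.im| < d}
  jac_pos : ∀ w : ℂ, |w.im| < d → 0 < tubeJac ζ w

theorem IsTubeWidth.mono {ζ : ℝ → ℂ} {d d' : ℝ} (h : IsTubeWidth ζ d) (h0 : 0 < d') (hd : d' ≤ d) :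
    IsTubeWidth ζ d' :=
  ⟨h0, hd.trans h.le_one, h.injOn.mono fun _ hw => lt_of_lt_of_le hw hd,
    fun w hw => h.jac_pos w (hw.trans_le hd)⟩

theorem exists_re_add_int_mul_mem (w : ℂ) :
    ∃ n : ℤ, (w + ((n * (2 * π) : ℝ) : ℂ)).re ∈ Icc 0 (2 * π) := by
  refine ⟨-⌊w.re / (2 * π)⌋, ?_⟩
  have h0 := Real.two_pi_pos
  have h1 := Int.floor_le (w.re / (2 * π))
  have h2 := (Int.lt_floor_add_one (w.re / (2 * π))).le
  rw [le_div_iff₀ h0] at h1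
  rw [div_le_iff₀ h0] at h2
  simp only [Complex.add_re, Complex.ofReal_re, mem_Icc]
  push_cast
  constructor <;> nlinarith

/-- Compactness by contradiction. Violations at heights tending to 0, translated into a fixed
period, accumulate at points of the curve; injectivity of ζ merges the two limits, and there the
Jacobian is positive and the inverse function theorem gives local injectivity. -/
theorem IsPeriodicCurve.exists_isTubeWidth {s : ℝ} {ζ : ℝ → ℂ} (h : IsPeriodicCurve s ζ) :
    ∃ d, IsTubeWidth ζ d := by
  by_contra hcon
  -- Both ways to fail are coded in one pair: a double point has w ≠ w', a degenerate point is
  -- stored with w' = w.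
  have key : ∀ n : ℕ, ∃ w w' : ℂ, w.re ∈ Icc 0 (2 * π) ∧ |w.im| ≤ 1 / ((n : ℝ) + 1) ∧
      |w'.im| ≤ 1 / ((n : ℝ) + 1) ∧ tube ζ w = tube ζ w' ∧ (w ≠ w' ∨ tubeJac ζ w ≤ 0) := by
    intro n
    by_contra hn
    push Not at hn
    have hpos : (0 : ℝ) < 1 / ((n : ℝ) + 1) := by positivity
    have hle : 1 / ((n : ℝ) + 1) ≤ 1 := by
      rw [div_le_one (by positivity)]; linarith [n.cast_nonneg (α := ℝ)]
    refine hcon ⟨1 / ((n : ℝ) + 1), hpos, hle, ?_, ?_⟩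
    · intro w hw w' hw' he
      obtain ⟨k, hk⟩ := exists_re_add_int_mul_mem w
      have := (hn (w + ((k * (2 * π) : ℝ) : ℂ)) (w' + ((k * (2 * π) : ℝ) : ℂ)) hk
        (by simpa using le_of_lt (mem_ofPred.1 hw)) (by simpa using le_of_lt (mem_ofPred.1 hw'))
        (by rw [h.tube_add_int_mul, h.tube_add_int_mul, he])).1
      simpa using this
    · intro w hw
      obtain ⟨k, hk⟩ := exists_re_add_int_mul_mem w
      have := (hn (w + ((k * (2 * π) : ℝ) : ℂ)) _ hk (by simpa using hw.le)
        (by simpa using hw.le) rfl).2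
      rwa [h.tubeJac_add_int_mul] at this
  choose w w' hre him him' heq hne using key
  obtain ⟨C, hC⟩ := h.exists_abs_re_tube_sub_le
  have hle : ∀ n : ℕ, 1 / ((n : ℝ) + 1) ≤ 1 := fun n => by
    rw [div_le_one (by positivity)]; linarith [n.cast_nonneg (α := ℝ)]
  have hbd : ∀ n, (w n, w' n) ∈ Metric.closedBall (0 : ℂ × ℂ) (2 * π + 2 * C + 1) := by
    intro n
    have h1 := hC (w n) ((him n).trans (hle n))
    have h2 := hC (w' n) ((him' n).trans (hle n))
    have hC0 : 0 ≤ C := (norm_nonneg _).trans h1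
    have h3 : |(w n).re| ≤ 2 * π := abs_le.2 ⟨by linarith [(hre n).1, Real.pi_pos], (hre n).2⟩
    -- Only w has been moved into the period; w' is bounded because equal images force real parts
    -- within 2C of each other.
    have h4 : |(w' n).re| ≤ 2 * π + 2 * C := by
      have e : ‖((s * (w' n).re : ℝ) : ℂ) - ((s * (w n).re : ℝ) : ℂ)‖ ≤ C + C := by
        have : ((s * (w' n).re : ℝ) : ℂ) - ((s * (w n).re : ℝ) : ℂ)
          = (tube ζ (w n) - ((s * (w n).re : ℝ) : ℂ))
            - (tube ζ (w' n) - ((s * (w' n).re : ℝ) : ℂ)) := by rw [heq]; ring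
        rw [this]
        exact (norm_sub_le _ _).trans (add_le_add h1 h2)
      rw [← Complex.ofReal_sub, Complex.norm_real, Real.norm_eq_abs, ← mul_sub, abs_mul,
        h.abs_orientation, one_mul] at e
      have := abs_sub_abs_le_abs_sub (w' n).re (w n).re
      linarith
    have h5 := (Complex.norm_le_abs_re_add_abs_im (w n))
    have h6 := (Complex.norm_le_abs_re_add_abs_im (w' n))
    have h7 := (him n).trans (hle n)
    have h8 := (him' n).trans (hle n)
    rw [mem_closedBall_zero_iff, Prod.norm_def]
    exact max_le (by dsimp only; linarith) (by dsimp only; linarith)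
  obtain ⟨p, -, φ, hφ, hlim⟩ := tendsto_subseq_of_bounded Metric.isBounded_closedBall hbd
  have l1 : Tendsto (fun n => w (φ n)) atTop (𝓝 p.1) := (continuous_fst.tendsto p).comp hlim
  have l2 : Tendsto (fun n => w' (φ n)) atTop (𝓝 p.2) := (continuous_snd.tendsto p).comp hlim
  have hz : Tendsto (fun n => 1 / ((φ n : ℝ) + 1)) atTop (𝓝 0) :=
    tendsto_one_div_add_atTop_nhds_zero_nat.comp hφ.tendsto_atTop
  have i1 : p.1.im = 0 := by
    have := (Complex.continuous_im.tendsto _).comp l1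
    exact tendsto_nhds_unique this (squeeze_zero_norm (fun n => him (φ n)) hz)
  have i2 : p.2.im = 0 := by
    have := (Complex.continuous_im.tendsto _).comp l2
    exact tendsto_nhds_unique this (squeeze_zero_norm (fun n => him' (φ n)) hz)
  have e1 : p.1 = ((p.1.re : ℝ) : ℂ) := Complex.ext rfl (by simp [i1])
  have e2 : p.2 = ((p.2.re : ℝ) : ℂ) := Complex.ext rfl (by simp [i2])
  have he : tube ζ p.1 = tube ζ p.2 := by
    have a1 := (h.continuous_tube.tendsto _).comp l1
    have a2 := (h.continuous_tube.tendsto _).comp l2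
    refine tendsto_nhds_unique a1 (a2.congr fun n => ?_)
    exact (heq _).symm
  have hp : p.2 = p.1 := by
    rw [e1, e2, tube_ofReal, tube_ofReal] at he
    rw [e1, e2, h.injective he]
  have hj : 0 < tubeJac ζ p.1 := by rw [e1]; exact h.tubeJac_ofReal_pos _
  obtain ⟨U, hU, hinj⟩ := h.exists_injOn_nhds hj
  rw [hp] at l2
  obtain ⟨n, hn1, hn2, hn3⟩ := ((l1.eventually hU).and ((l2.eventually hU).and
    (((h.continuous_tubeJac.tendsto _).comp l1).eventually (lt_mem_nhds hj)))).exists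
  rcases hne (φ n) with hh | hh
  · exact hh (hinj hn1 hn2 (heq _))
  · exact absurd hn3 (not_lt.2 hh)

end

/-! ### The Cauchy-Riemann operator -/

/-- The Cauchy-Riemann operator `∂₁ + i ∂₂`. -/
def dbar (F : ℂ → ℂ) (y : ℂ) : ℂ := fderiv ℝ F y 1 + I * fderiv ℝ F y I

/-- The derivative `∂₁ + i ∂₂` of a real function. -/
def dbarReal (g : ℂ → ℝ) (y : ℂ) : ℂ := (fderiv ℝ g y 1 : ℂ) + I * (fderiv ℝ g y I : ℂ)

theorem dbar_mul {F G : ℂ → ℂ} {y : ℂ} (hF : DifferentiableAt ℝ F y)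
    (hG : DifferentiableAt ℝ G y) :
    dbar (fun y => F y * G y) y = dbar F y * G y + F y * dbar G y := by
  simp only [dbar]
  rw [fderiv_fun_mul hF hG]
  simp
  ring

theorem dbar_smul {g : ℂ → ℝ} {F : ℂ → ℂ} {y : ℂ} (hg : DifferentiableAt ℝ g y)
    (hF : DifferentiableAt ℝ F y) :
    dbar (fun y => g y • F y) y = dbarReal g y * F y + g y * dbar F y := by
  simp only [dbar, dbarReal]
  rw [fderiv_fun_smul hg hF]
  simp
  ring

theorem dbarReal_mul {f g : ℂ → ℝ} {y : ℂ} (hf : DifferentiableAt ℝ f y)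
    (hg : DifferentiableAt ℝ g y) :
    dbarReal (fun y => f y * g y) y = dbarReal f y * g y + f y * dbarReal g y := by
  simp only [dbarReal]
  rw [fderiv_fun_mul hf hg]
  simp
  ring

theorem norm_dbar_le (F : ℂ → ℂ) (y : ℂ) : ‖dbar F y‖ ≤ 2 * ‖fderiv ℝ F y‖ := by
  have h1 := (fderiv ℝ F y).le_opNorm 1
  have h2 := (fderiv ℝ F y).le_opNorm I
  rw [norm_one, mul_one] at h1
  rw [Complex.norm_I, mul_one] at h2
  refine (norm_add_le _ _).trans ?_
  rw [norm_mul, Complex.norm_I, one_mul]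
  linarith

theorem dbar_congr {F G : ℂ → ℂ} {y : ℂ} (h : F =ᶠ[𝓝 y] G) : dbar F y = dbar G y := by
  simp only [dbar, h.fderiv_eq]

theorem dbarReal_congr {f g : ℂ → ℝ} {y : ℂ} (h : f =ᶠ[𝓝 y] g) : dbarReal f y = dbarReal g y := by
  simp only [dbarReal, h.fderiv_eq]

theorem measurable_dbar (F : ℂ → ℂ) : Measurable (dbar F) :=
  (measurable_fderiv_apply_const ℝ F 1).add ((measurable_fderiv_apply_const ℝ F I).const_mul I)

theorem dbar_of_hasDerivAt {F : ℂ → ℂ} {F' y : ℂ} (h : HasDerivAt F F' y) : dbar F y = 0 := by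
  have := h.complexToReal_fderiv
  rw [dbar, this.fderiv]
  simp
  linear_combination F' * Complex.I_mul_I

/-- The derivative of a function that is `C¹` up to the boundary is locally bounded up to the
boundary. -/
theorem exists_fderiv_le_of_contDiffOn_closure {F : ℂ → ℂ} {Ω : Set ℂ} (ho : IsOpen Ω)
    (hF : ContDiffOn ℝ 1 F (closure Ω)) {x : ℂ} (hx : x ∈ closure Ω) :
    ∃ C, ∀ᶠ y in 𝓝[Ω] x, ‖fderiv ℝ F y‖ ≤ C := by
  have h1 : ContDiffWithinAt ℝ (0 + 1) F (closure Ω) x := by simpa using hF x hx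
  obtain ⟨u, hu, hus, -, f', hf', hc⟩ :=
    (contDiffWithinAt_succ_iff_hasFDerivWithinAt' (by simp)).1 h1
  rw [insert_eq_of_mem hx] at hu hus
  have hcont : ContinuousWithinAt f' (closure Ω) x := hc.continuousWithinAt
  refine ⟨‖f' x‖ + 1, ?_⟩
  have e1 : ∀ᶠ y in 𝓝[closure Ω] x, ‖f' y‖ < ‖f' x‖ + 1 :=
    hcont.norm.eventually (gt_mem_nhds (lt_add_one _))
  have e2 : ∀ᶠ y in 𝓝[closure Ω] x, y ∈ u := hu
  have hle : 𝓝[Ω] x ≤ 𝓝[closure Ω] x := nhdsWithin_mono _ subset_closure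
  filter_upwards [hle e1, hle e2, self_mem_nhdsWithin] with y h1 h2 h3
  have : HasFDerivAt F (f' y) y :=
    (hf' y h2).hasFDerivAt (mem_of_superset (ho.mem_nhds h3) subset_closure)
  rw [this.fderiv]
  exact h1.le

/-- The derivative is bounded near every point of the closure and points off the closure do not
matter, so compactness of K turns local integrability into integrability. -/
theorem integrableOn_dbar_of_contDiffOn_closure {F : ℂ → ℂ} {Ω K : Set ℂ} (ho : IsOpen Ω)
    (hF : ContDiffOn ℝ 1 F (closure Ω)) (hK : IsCompact K) :
    IntegrableOn (dbar F) (Ω ∩ K) := by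
  refine hK.induction_on (p := fun s => IntegrableOn (dbar F) (Ω ∩ s)) ?_ ?_ ?_ ?_
  · simp
  · intro s t hst ht
    exact ht.mono_set (inter_subset_inter_right _ hst)
  · intro s t hs ht
    rw [inter_union_distrib_left]
    exact hs.union ht
  · intro x _
    by_cases hx : x ∈ closure Ω
    · obtain ⟨C, hC⟩ := exists_fderiv_le_of_contDiffOn_closure ho hF hx
      rw [eventually_nhdsWithin_iff, Metric.eventually_nhds_iff_ball] at hC
      obtain ⟨r, hr, hC⟩ := hC
      refine ⟨Metric.ball x r, mem_nhdsWithin_of_mem_nhds (Metric.ball_mem_nhds x hr), ?_⟩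
      refine Measure.integrableOn_of_bounded (M := 2 * C) ?_
        (measurable_dbar F).aestronglyMeasurable ?_
      · exact ((measure_mono inter_subset_right).trans_lt measure_ball_lt_top).ne
      · refine (ae_restrict_iff' (ho.inter Metric.isOpen_ball).measurableSet).2 (ae_of_all _ ?_)
        intro y hy
        exact (norm_dbar_le F y).trans (by linarith [hC y hy.2 hy.1])
    · refine ⟨(closure Ω)ᶜ, mem_nhdsWithin_of_mem_nhds
        (isClosed_closure.isOpen_compl.mem_nhds hx), ?_⟩
      have : Ω ∩ (closure Ω)ᶜ = ∅ := by
        ext y; simp only [mem_inter_iff, mem_compl_iff, mem_empty_iff_false, iff_false, not_and,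
          not_not]; exact fun h => subset_closure h
      rw [this]; simp

/-- Integration by parts against the constant function 1. -/
theorem integral_dbar_eq_zero {G : ℂ → ℂ} (hG : ContDiff ℝ 1 G) (hs : HasCompactSupport G) :
    ∫ y, dbar G y = 0 := by
  have hint : ∀ v : ℂ, Integrable (fun y => fderiv ℝ G y v) := fun v =>
    ((hG.continuous_fderiv_apply one_ne_zero).comp
      (continuous_id.prodMk continuous_const)).integrable_of_hasCompactSupport
      (hs.fderiv_apply ℝ v)
  have h0 : ∀ v : ℂ, ∫ y, fderiv ℝ G y v = 0 := by
    intro v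
    have := integral_mul_fderiv_eq_neg_fderiv_mul_of_integrable (μ := volume)
      (f := fun _ : ℂ => (1 : ℂ)) (g := G) (v := v) (by simp) (by simpa using hint v)
      (by simpa using hG.continuous.integrable_of_hasCompactSupport hs)
      (fun _ _ => differentiableAt_const _) (fun y _ => hG.differentiable one_ne_zero y)
    simpa using this
  simp only [dbar]
  rw [integral_add (hint 1) ((hint I).const_mul I), integral_const_mul, h0, h0]
  simp

/-! ### The smooth step -/

/-- The derivative of the smooth step `Real.smoothTransition`. -/
def stepDeriv (r : ℝ) : ℝ := deriv Real.smoothTransition r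

theorem hasDerivAt_step (r : ℝ) : HasDerivAt Real.smoothTransition (stepDeriv r) r :=
  ((Real.smoothTransition.contDiff (n := 1)).differentiable (by norm_num) r).hasDerivAt

theorem continuous_stepDeriv : Continuous stepDeriv :=
  (Real.smoothTransition.contDiff (n := 1)).continuous_deriv (by norm_num)

theorem stepDeriv_nonneg (r : ℝ) : 0 ≤ stepDeriv r := Real.smoothTransition.monotone.deriv_nonneg

/-- The step is locally constant on the open half-line; the endpoint is reached by continuity. -/
theorem stepDeriv_of_nonpos {r : ℝ} (h : r ≤ 0) : stepDeriv r = 0 := by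
  have h1 : ∀ r < (0 : ℝ), stepDeriv r = 0 := fun r hr => by
    have : Real.smoothTransition =ᶠ[𝓝 r] fun _ => 0 := by
      filter_upwards [gt_mem_nhds hr] with t ht using Real.smoothTransition.zero_of_nonpos ht.le
    rw [stepDeriv, this.deriv_eq, deriv_const]
  have hcl : IsClosed {r | stepDeriv r = 0} := isClosed_eq continuous_stepDeriv continuous_const
  have : Iic (0 : ℝ) ⊆ {r | stepDeriv r = 0} := by
    rw [← closure_Iio]
    exact hcl.closure_subset_iff.2 h1
  exact this h

theorem stepDeriv_of_one_le {r : ℝ} (h : 1 ≤ r) : stepDeriv r = 0 := by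
  have h1 : ∀ r > (1 : ℝ), stepDeriv r = 0 := fun r hr => by
    have : Real.smoothTransition =ᶠ[𝓝 r] fun _ => 1 := by
      filter_upwards [lt_mem_nhds hr] with t ht using Real.smoothTransition.one_of_one_le ht.le
    rw [stepDeriv, this.deriv_eq, deriv_const]
  have hcl : IsClosed {r | stepDeriv r = 0} := isClosed_eq continuous_stepDeriv continuous_const
  have : Ici (1 : ℝ) ⊆ {r | stepDeriv r = 0} := by
    rw [← closure_Ioi]
    exact hcl.closure_subset_iff.2 h1
  exact this h

theorem hasCompactSupport_stepDeriv : HasCompactSupport stepDeriv := by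
  refine HasCompactSupport.intro (isCompact_Icc (a := (0 : ℝ)) (b := 1)) fun r hr => ?_
  rcases le_or_gt r 0 with h | h
  · exact stepDeriv_of_nonpos h
  · exact stepDeriv_of_one_le (le_of_lt (not_le.1 fun h1 => hr ⟨h.le, h1⟩))

theorem exists_stepDeriv_le : ∃ C, 0 ≤ C ∧ ∀ r, stepDeriv r ≤ C := by
  obtain ⟨C, hC⟩ := continuous_stepDeriv.bounded_above_of_compact_support
    hasCompactSupport_stepDeriv
  exact ⟨C, (norm_nonneg _).trans (hC 0), fun r => (Real.le_norm_self _).trans (hC r)⟩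

theorem intervalIntegral_stepDeriv (a b : ℝ) :
    ∫ r in a..b, stepDeriv r = Real.smoothTransition b - Real.smoothTransition a :=
  intervalIntegral.integral_eq_sub_of_hasDerivAt (fun r _ => hasDerivAt_step r)
    (continuous_stepDeriv.intervalIntegrable _ _)

theorem integral_stepDeriv : ∫ r, stepDeriv r = 1 := by
  have : ∫ r in (0 : ℝ)..1, stepDeriv r = ∫ r, stepDeriv r := by
    refine intervalIntegral.integral_eq_integral_of_support_subset fun r hr => ?_
    constructor
    · by_contra h; exact hr (stepDeriv_of_nonpos (not_lt.1 h))
    · by_contra h; exact hr (stepDeriv_of_one_le (not_le.1 h).le)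
  rw [← this, intervalIntegral_stepDeriv]
  simp

section

/-! ### Green's theorem on one side of a curve -/

/-- The open set `Ω` has its boundary on the curve `ζ` and lies locally to the left of `ζ`. -/
structure IsLeftSide (ζ : ℝ → ℂ) (d : ℝ) (Ω : Set ℂ) : Prop where
  isOpen : IsOpen Ω
  frontier_subset : frontier Ω ⊆ range ζ
  left : ∀ w : ℂ, 0 < w.im → w.im < d → tube ζ w ∈ Ω
  right : ∀ w : ℂ, -d < w.im → w.im ≤ 0 → tube ζ w ∉ Ω

/-- The height of a point of a tubular neighbourhood over the curve. -/
def height (ζ : ℝ → ℂ) (d : ℝ) (y : ℂ) : ℝ :=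
  (Function.invFunOn (tube ζ) {w | |w.im| < d} y).im

open Classical in
/-- A smooth function that is `1` in `Ω` away from the curve and `0` near the curve. -/
def sideCutoff (ζ : ℝ → ℂ) (d : ℝ) (Ω : Set ℂ) (ε : ℝ) (y : ℂ) : ℝ :=
  if y ∈ Ω then
    if y ∈ tube ζ '' {w | |w.im| < d} then Real.smoothTransition (2 * height ζ d y / ε - 1) else 1
  else 0

variable {s d : ℝ} {ζ : ℝ → ℂ} {Ω : Set ℂ}

theorem IsTubeWidth.height_tube (hd : IsTubeWidth ζ d) {w : ℂ} (hw : |w.im| < d) :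
    height ζ d (tube ζ w) = w.im := by
  rw [height, hd.injOn.leftInvOn_invFunOn hw]

theorem IsTubeWidth.image_mem_nhds (hd : IsTubeWidth ζ d) (h : IsPeriodicCurve s ζ) {w : ℂ}
    (hw : |w.im| < d) : tube ζ '' {w | |w.im| < d} ∈ 𝓝 (tube ζ w) := by
  have hdet : (tubeDeriv ζ w).det ≠ 0 := by rw [det_tubeDeriv]; exact (hd.jac_pos w hw).ne'
  have hs : HasStrictFDerivAt (tube ζ)
      (((tubeDeriv ζ w).toContinuousLinearEquivOfDetNeZero hdet : ℂ ≃L[ℝ] ℂ) : ℂ →L[ℝ] ℂ) w := by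
    simpa using h.hasStrictFDerivAt_tube w
  rw [← hs.map_nhds_eq_of_equiv]
  refine image_mem_map ?_
  have : IsOpen {w : ℂ | |w.im| < d} :=
    isOpen_lt (continuous_abs.comp Complex.continuous_im) continuous_const
  exact this.mem_nhds hw

/-- The inverse chosen by `Function.invFunOn` has no regularity by construction. Near a point of the
tube, injectivity forces its height to agree with that of the C¹ local inverse. -/
theorem IsTubeWidth.contDiffAt_height (hd : IsTubeWidth ζ d) (h : IsPeriodicCurve s ζ) {w : ℂ}
    (hw : |w.im| < d) : ContDiffAt ℝ 1 (height ζ d) (tube ζ w) := by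
  have hdet : (tubeDeriv ζ w).det ≠ 0 := by rw [det_tubeDeriv]; exact (hd.jac_pos w hw).ne'
  have hf' : HasFDerivAt (tube ζ)
      (((tubeDeriv ζ w).toContinuousLinearEquivOfDetNeZero hdet : ℂ ≃L[ℝ] ℂ) : ℂ →L[ℝ] ℂ) w := by
    simpa using h.hasFDerivAt_tube w
  have hf : ContDiffAt ℝ 1 (tube ζ) w := h.contDiff_tube.contDiffAt
  have hs := hf.hasStrictFDerivAt' hf' one_ne_zero
  have hg := hf.to_localInverse hf' one_ne_zero
  have hgw : hf.localInverse hf' one_ne_zero (tube ζ w) = w :=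
    hf.localInverse_apply_image hf' one_ne_zero
  have e1 : ∀ᶠ y in 𝓝 (tube ζ w), tube ζ (hf.localInverse hf' one_ne_zero y) = y :=
    hs.eventually_right_inverse
  have e2 : ∀ᶠ y in 𝓝 (tube ζ w), |(hf.localInverse hf' one_ne_zero y).im| < d := by
    have hc := (Complex.continuous_im.abs.continuousAt.comp hg.continuousAt)
    refine hc.eventually (gt_mem_nhds ?_)
    simpa [hgw] using hw
  refine (Complex.imCLM.contDiff.contDiffAt.comp _ hg).congr_of_eventuallyEq ?_
  filter_upwards [e1, e2] with y h1 h2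
  conv_lhs => rw [← h1]
  rw [hd.height_tube h2]
  rfl

/-- Closed tubes are closed. -/
theorem IsPeriodicCurve.isClosed_image_tube (h : IsPeriodicCurve s ζ) {ε : ℝ} (hε : ε ≤ 1) :
    IsClosed (tube ζ '' {w | |w.im| ≤ ε}) := by
  obtain ⟨C, hC⟩ := h.exists_abs_re_tube_sub_le
  refine IsSeqClosed.isClosed fun y p hy hp => ?_
  choose w hw hwy using hy
  obtain ⟨B, hB⟩ := (Metric.isBounded_range_of_tendsto y hp).exists_norm_le
  have hbd : ∀ n, w n ∈ Metric.closedBall (0 : ℂ) (B + C + 1) := by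
    intro n
    have h1 : |(w n).im| ≤ 1 := le_trans (hw n) hε
    have h2 := hC (w n) h1
    have h3 := hB _ ⟨n, rfl⟩
    have h4 : |(w n).re| ≤ B + C := by
      have e : ((s * (w n).re : ℝ) : ℂ) = y n - (tube ζ (w n) - ((s * (w n).re : ℝ) : ℂ)) := by
        rw [hwy]; ring
      have e2 : ‖((s * (w n).re : ℝ) : ℂ)‖ ≤ B + C := by
        rw [e]; exact (norm_sub_le _ _).trans (add_le_add h3 h2)
      rwa [Complex.norm_real, Real.norm_eq_abs, abs_mul, h.abs_orientation, one_mul] at e2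
    have h5 := Complex.norm_le_abs_re_add_abs_im (w n)
    rw [mem_closedBall_zero_iff]
    linarith
  obtain ⟨q, -, φ, hφ, hlim⟩ := tendsto_subseq_of_bounded Metric.isBounded_closedBall hbd
  have hcl : IsClosed {w : ℂ | |w.im| ≤ ε} :=
    isClosed_le (continuous_abs.comp Complex.continuous_im) continuous_const
  refine ⟨q, hcl.mem_of_tendsto hlim (Eventually.of_forall fun n => hw _), ?_⟩
  have h1 := (h.continuous_tube.tendsto q).comp hlim
  have h2 := hp.comp hφ.tendsto_atTop
  refine tendsto_nhds_unique h1 (h2.congr fun n => (hwy _).symm)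

namespace IsLeftSide

theorem im_pos (hΩ : IsLeftSide ζ d Ω) {w : ℂ} (hw : |w.im| < d) (hm : tube ζ w ∈ Ω) :
    0 < w.im := by
  by_contra hn
  exact hΩ.right w (abs_lt.1 hw).1 (not_lt.1 hn) hm

theorem tube_mem_closure (hΩ : IsLeftSide ζ d Ω) (h : IsPeriodicCurve s ζ) {w : ℂ}
    (h0 : 0 ≤ w.im) (h1 : w.im < d) : tube ζ w ∈ closure Ω := by
  rcases h0.eq_or_lt with h2 | h2
  · have hc : Tendsto (fun t : ℝ => tube ζ (w + t * I)) (𝓝[>] 0) (𝓝 (tube ζ w)) := by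
      have : Continuous fun t : ℝ => tube ζ (w + t * I) :=
        h.continuous_tube.comp (by fun_prop)
      simpa using (this.tendsto 0).mono_left nhdsWithin_le_nhds
    refine mem_closure_of_tendsto hc ?_
    filter_upwards [Ioo_mem_nhdsGT (h2 ▸ h1 : (0 : ℝ) < d)] with t ht
    refine hΩ.left _ ?_ ?_
    · simpa [← h2] using ht.1
    · simpa [← h2] using ht.2
  · exact subset_closure (hΩ.left w h2 h1)

theorem curve_mem_closure (hΩ : IsLeftSide ζ d Ω) (hd : IsTubeWidth ζ d)
    (h : IsPeriodicCurve s ζ) (a : ℝ) : ζ a ∈ closure Ω := by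
  have := hΩ.tube_mem_closure h (w := a) (by simp) (by simpa using hd.pos)
  rwa [IsPeriodicCurve.tube_ofReal] at this

/-- The argument 2h/ε − 1 reaches 1 at h = ε and the closed tube of height ε is closed, so the
cutoff is constant beyond it, even across the outer edge of the tube where its definition changes
branch. -/
theorem sideCutoff_eventuallyEq_one (hΩ : IsLeftSide ζ d Ω) (h : IsPeriodicCurve s ζ)
    (hd : IsTubeWidth ζ d) {ε : ℝ} (h0 : 0 < ε) (hε : ε < d) {y : ℂ} (hy : y ∈ Ω)
    (hyt : y ∉ tube ζ '' {w | |w.im| ≤ ε}) : sideCutoff ζ d Ω ε =ᶠ[𝓝 y] fun _ => 1 := by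
  have hcl := h.isClosed_image_tube (hε.le.trans hd.le_one)
  filter_upwards [hΩ.isOpen.mem_nhds hy, hcl.isOpen_compl.mem_nhds hyt] with y' h1 h2
  rw [sideCutoff, if_pos h1]
  split_ifs with h3
  · obtain ⟨w, hw, rfl⟩ := h3
    have hpos := hΩ.im_pos hw h1
    rw [hd.height_tube hw]
    have : ε < w.im := by
      by_contra hn
      exact h2 ⟨w, by rw [mem_ofPred, abs_of_pos hpos]; exact not_lt.1 hn, rfl⟩
    refine Real.smoothTransition.one_of_one_le ?_
    rw [le_sub_iff_add_le, le_div_iff₀ h0]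
    linarith
  · rfl

theorem sideCutoff_eventuallyEq_step (hΩ : IsLeftSide ζ d Ω) (h : IsPeriodicCurve s ζ)
    (hd : IsTubeWidth ζ d) (ε : ℝ) {w : ℂ} (hw : |w.im| < d) (hy : tube ζ w ∈ Ω) :
    sideCutoff ζ d Ω ε =ᶠ[𝓝 (tube ζ w)]
      fun y => Real.smoothTransition (2 * height ζ d y / ε - 1) := by
  filter_upwards [hΩ.isOpen.mem_nhds hy, hd.image_mem_nhds h hw] with y' h1 h2
  rw [sideCutoff, if_pos h1, if_pos h2]

/-- The cutoff vanishes up to height ε/2. Frontier points lie on the curve, so it vanishes on a full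
neighbourhood of them, not only outside Ω. -/
theorem sideCutoff_eventuallyEq_zero (hΩ : IsLeftSide ζ d Ω) (h : IsPeriodicCurve s ζ)
    (hd : IsTubeWidth ζ d) {ε : ℝ} (h0 : 0 < ε) {y : ℂ} (hy : y ∉ Ω) :
    sideCutoff ζ d Ω ε =ᶠ[𝓝 y] fun _ => 0 := by
  by_cases hc : y ∈ closure Ω
  · have hf : y ∈ frontier Ω := ⟨hc, by rwa [hΩ.isOpen.interior_eq]⟩
    obtain ⟨a, rfl⟩ := hΩ.frontier_subset hf
    have hw : |((a : ℂ)).im| < d := by simpa using hd.pos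
    rw [← IsPeriodicCurve.tube_ofReal (ζ := ζ) a]
    have e1 : ∀ᶠ y in 𝓝 (tube ζ a), height ζ d y < ε / 2 := by
      refine (hd.contDiffAt_height h hw).continuousAt.eventually (gt_mem_nhds ?_)
      rw [hd.height_tube hw]
      simpa using h0
    filter_upwards [e1, hd.image_mem_nhds h hw] with y' h1 h2
    rw [sideCutoff]
    split_ifs
    · refine Real.smoothTransition.zero_of_nonpos ?_
      rw [sub_nonpos, div_le_one h0]
      linarith
    · rfl
  · filter_upwards [isClosed_closure.isOpen_compl.mem_nhds hc] with y' h1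
    rw [sideCutoff, if_neg fun h2 => h1 (subset_closure h2)]

theorem contDiffAt_sideCutoff (hΩ : IsLeftSide ζ d Ω) (h : IsPeriodicCurve s ζ)
    (hd : IsTubeWidth ζ d) {ε : ℝ} (h0 : 0 < ε) (hε : ε < d) (y : ℂ) :
    ContDiffAt ℝ 1 (sideCutoff ζ d Ω ε) y := by
  by_cases hy : y ∈ Ω
  · by_cases ht : y ∈ tube ζ '' {w | |w.im| ≤ ε}
    · obtain ⟨w, hw, rfl⟩ := ht
      have hw' : |w.im| < d := lt_of_le_of_lt hw hε
      refine ContDiffAt.congr_of_eventuallyEq ?_ (hΩ.sideCutoff_eventuallyEq_step h hd ε hw' hy)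
      have h1 := hd.contDiffAt_height h hw'
      exact Real.smoothTransition.contDiffAt.comp _
        (((contDiffAt_const.mul h1).div_const ε).sub contDiffAt_const)
    · exact contDiffAt_const.congr_of_eventuallyEq
        (hΩ.sideCutoff_eventuallyEq_one h hd h0 hε hy ht)
  · exact contDiffAt_const.congr_of_eventuallyEq (hΩ.sideCutoff_eventuallyEq_zero h hd h0 hy)

theorem norm_sideCutoff_le (ε : ℝ) (y : ℂ) : ‖sideCutoff ζ d Ω ε y‖ ≤ 1 := by
  rw [sideCutoff]
  split_ifs
  · rw [Real.norm_eq_abs, abs_of_nonneg (Real.smoothTransition.nonneg _)]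
    exact Real.smoothTransition.le_one _
  · simp
  · simp

theorem tendsto_sideCutoff (hΩ : IsLeftSide ζ d Ω) (hd : IsTubeWidth ζ d) {y : ℂ} (hy : y ∈ Ω) :
    Tendsto (fun ε => sideCutoff ζ d Ω ε y) (𝓝[>] 0) (𝓝 1) := by
  refine tendsto_const_nhds.congr' ?_
  by_cases ht : y ∈ tube ζ '' {w | |w.im| < d}
  · obtain ⟨w, hw, rfl⟩ := ht
    have hpos := hΩ.im_pos hw hy
    filter_upwards [Ioo_mem_nhdsGT hpos] with ε hε
    rw [sideCutoff, if_pos hy, if_pos ⟨w, hw, rfl⟩, hd.height_tube hw]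
    refine (Real.smoothTransition.one_of_one_le ?_).symm
    rw [le_sub_iff_add_le, le_div_iff₀ hε.1]
    linarith [hε.2]
  · exact Eventually.of_forall fun ε => by simp only [sideCutoff, if_pos hy, if_neg ht]

/-- The derivative of the cutoff in tubular coordinates. -/
theorem tubeJac_mul_dbarReal_sideCutoff (hΩ : IsLeftSide ζ d Ω) (h : IsPeriodicCurve s ζ)
    (hd : IsTubeWidth ζ d) {ε : ℝ} (h0 : 0 < ε) (hε : ε < d) {w : ℂ} (hw0 : 0 < w.im)
    (hw : w.im < d) :
    (tubeJac ζ w : ℂ) * dbarReal (sideCutoff ζ d Ω ε) (tube ζ w)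
      = I * ((2 / ε * stepDeriv (2 * w.im / ε - 1) : ℝ) : ℂ) * tubeTangent ζ w := by
  have hw' : |w.im| < d := by rwa [abs_of_pos hw0]
  set ℓ := fderiv ℝ (sideCutoff ζ d Ω ε) (tube ζ w) with hℓ
  set κ := 2 / ε * stepDeriv (2 * w.im / ε - 1) with hκ
  have hdiff : HasFDerivAt (sideCutoff ζ d Ω ε) ℓ (tube ζ w) :=
    ((hΩ.contDiffAt_sideCutoff h hd h0 hε _).differentiableAt one_ne_zero).hasFDerivAt
  have h1 : HasFDerivAt (fun w => sideCutoff ζ d Ω ε (tube ζ w)) (ℓ.comp (tubeDeriv ζ w)) w :=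
    hdiff.comp w (h.hasFDerivAt_tube w)
  have h2 : HasFDerivAt (fun w : ℂ => Real.smoothTransition (2 * w.im / ε - 1))
      (κ • Complex.imCLM) w := by
    have e : HasFDerivAt (fun w : ℂ => 2 * w.im / ε - 1) ((2 / ε) • Complex.imCLM) w := by
      have := ((Complex.imCLM.hasFDerivAt (x := w)).const_mul (2 / ε)).sub_const 1
      refine this.congr_of_eventuallyEq (Eventually.of_forall fun z => ?_)
      simp only [Complex.imCLM_apply]
      ring
    have := (hasDerivAt_step (2 * w.im / ε - 1)).comp_hasFDerivAt w e
    refine this.congr_fderiv ?_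
    rw [hκ, smul_smul, mul_comm]
  have h3 : (fun w => sideCutoff ζ d Ω ε (tube ζ w)) =ᶠ[𝓝 w]
      fun w : ℂ => Real.smoothTransition (2 * w.im / ε - 1) := by
    have ho : IsOpen {w : ℂ | 0 < w.im ∧ w.im < d} :=
      (isOpen_lt continuous_const Complex.continuous_im).inter
        (isOpen_lt Complex.continuous_im continuous_const)
    filter_upwards [ho.mem_nhds ⟨hw0, hw⟩] with z hz
    have hz' : |z.im| < d := by rw [abs_of_pos hz.1]; exact hz.2
    rw [sideCutoff, if_pos (hΩ.left z hz.1 hz.2), if_pos ⟨z, hz', rfl⟩, hd.height_tube hz']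
  have h4 : ℓ.comp (tubeDeriv ζ w) = κ • Complex.imCLM :=
    h1.unique (h2.congr_of_eventuallyEq h3)
  have hlin : ∀ c : ℂ, ℓ c = c.re * ℓ 1 + c.im * ℓ I := by
    intro c
    have : c = c.re • (1 : ℂ) + c.im • I := by
      apply Complex.ext <;> simp
    conv_lhs => rw [this]
    rw [map_add, map_smul, map_smul, smul_eq_mul, smul_eq_mul]
  -- The chain rule gives the values of the differential on the two columns of the derivative of the
  -- tube: 0 along it and κ across it. Cramer's rule then recovers both partial derivatives, times
  -- the Jacobian.
  have hA : ℓ (tubeTangent ζ w) = 0 := by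
    have := DFunLike.congr_fun h4 1
    simpa [tubeDeriv_apply] using this
  have hB : ℓ (I * deriv ζ w.re) = κ := by
    have := DFunLike.congr_fun h4 I
    simpa [tubeDeriv_apply] using this
  rw [hlin] at hA hB
  rw [dbarReal, ← hℓ, tubeJac]
  set A := tubeTangent ζ w
  set B := I * deriv ζ w.re
  apply Complex.ext
  · simp
    linear_combination B.im * hA - A.im * hB
  · simp
    linear_combination -B.re * hA + A.re * hB

end IsLeftSide

end

/-! ### Slicing by horizontal lines, approximate identities, and the proof of Green's theorem -/

section

/-- Integrals over the plane as iterated integrals over horizontal lines. -/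
theorem integral_complex_eq_iterated {f : ℂ → ℂ} (hf : Integrable f) :
    ∫ w, f w = ∫ t : ℝ, ∫ a : ℝ, f (a + t * I) := by
  have e := Complex.volume_preserving_equiv_real_prod.symm
  have h1 : Integrable (fun p : ℝ × ℝ => f (p.1 + p.2 * I)) := by
    have := (e.integrable_comp_emb (g := f) (MeasurableEquiv.measurableEmbedding _)).2 hf
    refine this.congr (ae_of_all _ fun p => ?_)
    simp only [Function.comp, Complex.measurableEquivRealProd_symm_apply, Complex.mk_eq_add_mul_I]
  rw [← e.integral_comp (MeasurableEquiv.measurableEmbedding _)]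
  simp only [Complex.measurableEquivRealProd_symm_apply, Complex.mk_eq_add_mul_I]
  exact integral_prod_symm _ h1

theorem integrable_iterated {f : ℂ → ℂ} (hf : Integrable f) :
    Integrable fun t : ℝ => ∫ a : ℝ, f (a + t * I) := by
  have e := Complex.volume_preserving_equiv_real_prod.symm
  have h1 : Integrable (fun p : ℝ × ℝ => f (p.1 + p.2 * I)) := by
    have := (e.integrable_comp_emb (g := f) (MeasurableEquiv.measurableEmbedding _)).2 hf
    refine this.congr (ae_of_all _ fun p => ?_)
    simp only [Function.comp, Complex.measurableEquivRealProd_symm_apply, Complex.mk_eq_add_mul_I]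
  exact h1.integral_prod_right

/-- The functions `2 / ε * stepDeriv (2 t / ε - 1)` are an approximate identity at `0+`. -/
theorem tendsto_integral_step_mul {d : ℝ} (hd : 0 < d) {H : ℝ → ℂ} {L : ℂ}
    (hH : Tendsto H (𝓝[>] 0) (𝓝 L))
    (hi : ∀ ε, 0 < ε → ε < d →
      IntegrableOn (fun t => ((2 / ε * stepDeriv (2 * t / ε - 1) : ℝ) : ℂ) * H t) (Ioo 0 d)) :
    Tendsto (fun ε => ∫ t in Ioo 0 d, ((2 / ε * stepDeriv (2 * t / ε - 1) : ℝ) : ℂ) * H t)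
      (𝓝[>] 0) (𝓝 L) := by
  rw [Metric.tendsto_nhds]
  intro η hη
  have h1 : ∀ᶠ t in 𝓝[>] (0 : ℝ), dist (H t) L < η / 2 :=
    (Metric.tendsto_nhds.1 hH) _ (half_pos hη)
  rw [eventually_nhdsWithin_iff, Metric.eventually_nhds_iff_ball] at h1
  obtain ⟨r, hr, h1⟩ := h1
  filter_upwards [Ioo_mem_nhdsGT (lt_min hr hd)] with ε hε
  have hεr : ε < r := hε.2.trans_le (min_le_left _ _)
  have hεd : ε < d := hε.2.trans_le (min_le_right _ _)
  have h0 := hε.1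
  set κ : ℝ → ℝ := fun t => 2 / ε * stepDeriv (2 * t / ε - 1) with hκ
  have hκc : Continuous κ := continuous_const.mul (continuous_stepDeriv.comp (by fun_prop))
  have hκ0 : ∀ t, 0 ≤ κ t := fun t => mul_nonneg (by positivity) (stepDeriv_nonneg _)
  have hκs : ∀ t, ε ≤ t → κ t = 0 := fun t ht => by
    have : stepDeriv (2 * t / ε - 1) = 0 := stepDeriv_of_one_le (by
      rw [le_sub_iff_add_le, le_div_iff₀ h0]; linarith)
    simp [hκ, this]
  have hκ1 : ∫ t in Ioo 0 d, κ t = 1 := by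
    rw [← integral_Ioc_eq_integral_Ioo, ← intervalIntegral.integral_of_le hd.le]
    have hder : ∀ t ∈ uIcc 0 d,
        HasDerivAt (fun t => Real.smoothTransition (2 * t / ε - 1)) (κ t) t := by
      intro t _
      have e : HasDerivAt (fun t => 2 * t / ε - 1) (2 / ε) t := by
        simpa using (((hasDerivAt_id t).const_mul 2).div_const ε).sub_const 1
      have := (hasDerivAt_step (2 * t / ε - 1)).comp t e
      rwa [mul_comm] at this
    rw [intervalIntegral.integral_eq_sub_of_hasDerivAt hder (hκc.intervalIntegrable _ _),
      Real.smoothTransition.one_of_one_le, Real.smoothTransition.zero_of_nonpos]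
    · norm_num
    · norm_num
    · rw [le_sub_iff_add_le, le_div_iff₀ h0]; linarith
  have hκi : IntegrableOn κ (Ioo 0 d) :=
    (hκc.integrableOn_Icc (a := 0) (b := d)).mono_set Ioo_subset_Icc_self
  -- Since κ has mass one, L moves under the integral, and only the values of H on (0, ε) are
  -- tested.
  have hsub : (∫ t in Ioo 0 d, (κ t : ℂ) * H t) - L = ∫ t in Ioo 0 d, (κ t : ℂ) * (H t - L) := by
    have hL : ∫ t in Ioo 0 d, (κ t : ℂ) * L = L := by
      rw [integral_mul_const, integral_complex_ofReal, hκ1]; simp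
    have hi' : IntegrableOn (fun t => (κ t : ℂ) * H t) (Ioo 0 d) := hi ε h0 hεd
    have hκL : IntegrableOn (fun t => (κ t : ℂ) * L) (Ioo 0 d) := hκi.ofReal.mul_const L
    simp only [mul_sub]
    rw [integral_sub hi' hκL, hL]
  rw [dist_eq_norm, hsub]
  calc ‖∫ t in Ioo 0 d, (κ t : ℂ) * (H t - L)‖ ≤ ∫ t in Ioo 0 d, κ t * (η / 2) := by
        refine norm_integral_le_of_norm_le (hκi.mul_const _) ?_
        refine (ae_restrict_iff' measurableSet_Ioo).2 (ae_of_all _ fun t ht => ?_)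
        rw [norm_mul, Complex.norm_real, Real.norm_of_nonneg (hκ0 t)]
        rcases le_or_gt ε t with h2 | h2
        · simp [hκs t h2]
        · refine mul_le_mul_of_nonneg_left ?_ (hκ0 t)
          rw [← dist_eq_norm]
          refine (h1 t ?_ ht.1).le
          rw [Metric.mem_ball, Real.dist_0_eq_abs, abs_of_pos ht.1]
          exact h2.trans hεr
    _ = η / 2 := by rw [integral_mul_const, hκ1, one_mul]
    _ < η := half_lt_self hη

variable {s d : ℝ} {ζ : ℝ → ℂ} {Ω : Set ℂ}

/-- In the tube a point stays within a fixed distance of s times its parameter, so large parameters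
leave every compact set. -/
theorem IsPeriodicCurve.exists_tube_eq_zero (h : IsPeriodicCurve s ζ) {F : ℂ → ℂ}
    (hs : HasCompactSupport F) :
    ∃ L, ∀ w : ℂ, |w.im| ≤ 1 → L < |w.re| → F (tube ζ w) = 0 := by
  obtain ⟨C, hC⟩ := h.exists_abs_re_tube_sub_le
  obtain ⟨B, hB⟩ := hs.isCompact.isBounded.exists_norm_le
  refine ⟨B + C, fun w hw hL => ?_⟩
  by_contra hne
  have h3 := hB _ (subset_tsupport F hne)
  have e : ((s * w.re : ℝ) : ℂ) = tube ζ w - (tube ζ w - ((s * w.re : ℝ) : ℂ)) := by ring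
  have e2 : ‖((s * w.re : ℝ) : ℂ)‖ ≤ B + C := by
    rw [e]; exact (norm_sub_le _ _).trans (add_le_add h3 (hC w hw))
  rw [Complex.norm_real, Real.norm_eq_abs, abs_mul, h.abs_orientation, one_mul] at e2
  linarith

namespace IsLeftSide

/-- The boundary integrals over the curves parallel to `ζ` converge to the one over `ζ`. -/
theorem tendsto_integral_tube (hΩ : IsLeftSide ζ d Ω) (h : IsPeriodicCurve s ζ)
    (hd : IsTubeWidth ζ d) {F : ℂ → ℂ} (hc : ContinuousOn F (closure Ω))
    (hs : HasCompactSupport F) :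
    Tendsto (fun t : ℝ => ∫ a : ℝ, tubeTangent ζ (a + t * I) * F (tube ζ (a + t * I))) (𝓝[>] 0)
      (𝓝 (∫ a, F (ζ a) * deriv ζ a)) := by
  obtain ⟨L, hL⟩ := h.exists_tube_eq_zero hs
  set T : ℂ → ℂ := fun w => tubeTangent ζ w * F (tube ζ w) with hT
  have hTc : ContinuousOn T {w | 0 ≤ w.im ∧ w.im < d} :=
    h.continuous_tubeTangent.continuousOn.mul
      (hc.comp h.continuous_tube.continuousOn fun w hw => hΩ.tube_mem_closure h hw.1 hw.2)
  have hd2 : 0 < d / 2 := half_pos hd.pos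
  have hK : IsCompact (Icc (-L) L ×ℂ Icc 0 (d / 2)) := isCompact_Icc.reProdIm isCompact_Icc
  have hsub : (Icc (-L) L ×ℂ Icc 0 (d / 2)) ⊆ {w | 0 ≤ w.im ∧ w.im < d} := fun w hw =>
    ⟨hw.2.1, lt_of_le_of_lt hw.2.2 (half_lt_self hd.pos)⟩
  obtain ⟨C, hC⟩ := hK.exists_bound_of_continuousOn (hTc.mono hsub)
  have hline : ∀ t : ℝ, 0 ≤ t → t < d → Continuous fun a : ℝ => T (a + t * I) := by
    intro t h0 h1
    rw [← continuousOn_univ]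
    refine hTc.comp (by fun_prop) fun a _ => ?_
    simpa using ⟨h0, h1⟩
  have hz : (∫ a, F (ζ a) * deriv ζ a) = ∫ a : ℝ, T a := by
    refine integral_congr_ae (ae_of_all _ fun a => ?_)
    simp only [hT, IsPeriodicCurve.tube_ofReal]
    simp [tubeTangent, mul_comm]
  rw [hz]
  refine tendsto_integral_filter_of_dominated_convergence
    ((Icc (-L) L).indicator fun _ => C) ?_ ?_ ?_ ?_
  · filter_upwards [Ioo_mem_nhdsGT hd.pos] with t ht
    exact (hline t ht.1.le ht.2).aestronglyMeasurable
  · filter_upwards [Ioo_mem_nhdsGT hd2] with t ht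
    refine ae_of_all _ fun a => ?_
    by_cases ha : a ∈ Icc (-L) L
    · rw [indicator_of_mem ha]
      refine hC _ ⟨?_, ?_⟩
      · simpa using ha
      · simpa using ⟨ht.1.le, ht.2.le⟩
    · rw [indicator_of_notMem ha]
      have : F (tube ζ (a + t * I)) = 0 := by
        refine hL _ ?_ ?_
        · have := ht.2
          have h1 := hd.le_one
          simp only [Complex.add_im, Complex.ofReal_im, Complex.mul_im, Complex.ofReal_re,
            Complex.I_im, Complex.I_re]
          rw [abs_le]; constructor <;> linarith [ht.1]
        · simp only [Complex.add_re, Complex.ofReal_re, Complex.mul_re, Complex.I_re,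
            Complex.ofReal_im, Complex.I_im]
          by_contra hn
          exact ha (abs_le.1 (by simpa using hn))
      simp [this]
  · exact (integrable_indicator_iff measurableSet_Icc).2
      (integrableOn_const (by simp) (by simp))
  · refine ae_of_all _ fun a => ?_
    have h1 : ContinuousWithinAt (fun t : ℝ => T (a + t * I)) (Ico 0 d) 0 := by
      have : ContinuousOn (fun t : ℝ => T (a + t * I)) (Ico 0 d) :=
        hTc.comp (by fun_prop) fun t ht => by simpa using ⟨ht.1, ht.2⟩
      exact this 0 ⟨le_rfl, hd.pos⟩
    have h2 := h1.tendsto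
    simp only [Complex.ofReal_zero, zero_mul, add_zero] at h2
    refine h2.mono_left ?_
    rw [← nhdsWithin_Ioo_eq_nhdsGT hd.pos]
    exact nhdsWithin_mono _ Ioo_subset_Ico_self

/-- **Green's theorem** on the left side of a curve. -/
theorem integral_curve_eq (hΩ : IsLeftSide ζ d Ω) (h : IsPeriodicCurve s ζ)
    (hd : IsTubeWidth ζ d) {F : ℂ → ℂ} (hF : ContDiffOn ℝ 1 F (closure Ω))
    (hs : HasCompactSupport F) :
    ∫ a, F (ζ a) * deriv ζ a = I * ∫ y in Ω, dbar F y := by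
  have hΩm := hΩ.isOpen.measurableSet
  have hFd : ∀ y ∈ Ω, ContDiffAt ℝ 1 F y := fun y hy =>
    hF.contDiffAt (mem_of_superset (hΩ.isOpen.mem_nhds hy) subset_closure)
  have hFi : IntegrableOn (dbar F) Ω := by
    have h1 := integrableOn_dbar_of_contDiffOn_closure hΩ.isOpen hF hs.isCompact
    refine h1.of_forall_sdiff_eq_zero hΩm fun y hy => ?_
    have : F =ᶠ[𝓝 y] fun _ => 0 :=
      notMem_tsupport_iff_eventuallyEq.1 fun hy2 => hy.2 ⟨hy.1, hy2⟩
    rw [dbar_congr this]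
    simp [dbar]
  set H : ℝ → ℂ := fun t => ∫ a : ℝ, tubeTangent ζ (a + t * I) * F (tube ζ (a + t * I)) with hH
  have hHlim := hΩ.tendsto_integral_tube h hd hF.continuousOn hs
  rw [← hH] at hHlim
  -- The product ψF is C¹ with compact support in the whole plane, so ∂̄(ψF) has integral zero. The
  -- part (∂̄ψ)F lives in a thin strip along the curve and becomes an average of boundary integrals
  -- over parallel curves.
  have key : ∀ ε, 0 < ε → ε < d →
      IntegrableOn (fun t => ((2 / ε * stepDeriv (2 * t / ε - 1) : ℝ) : ℂ) * H t) (Ioo 0 d) ∧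
      ∫ y in Ω, (sideCutoff ζ d Ω ε y : ℂ) * dbar F y
        = -(I * ∫ t in Ioo 0 d, ((2 / ε * stepDeriv (2 * t / ε - 1) : ℝ) : ℂ) * H t) := by
    intro ε h0 hε
    set ψ := sideCutoff ζ d Ω ε with hψ
    have hψd : ∀ y, ContDiffAt ℝ 1 ψ y := hΩ.contDiffAt_sideCutoff h hd h0 hε
    have hψz : ∀ y ∉ Ω, ψ =ᶠ[𝓝 y] fun _ => 0 := fun y hy =>
      hΩ.sideCutoff_eventuallyEq_zero h hd h0 hy
    have hGd : ContDiff ℝ 1 fun y => ψ y • F y := by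
      rw [contDiff_iff_contDiffAt]
      intro y
      by_cases hy : y ∈ Ω
      · exact (hψd y).smul (hFd y hy)
      · refine contDiffAt_const (c := (0 : ℂ)) |>.congr_of_eventuallyEq ?_
        filter_upwards [hψz y hy] with z hz
        simp [hz]
    have hGs : HasCompactSupport fun y => ψ y • F y := hs.smul_left (f := ψ)
    have hG0 := integral_dbar_eq_zero hGd hGs
    have hGz : ∀ y ∉ Ω, dbar (fun y => ψ y • F y) y = 0 := by
      intro y hy
      have : (fun y => ψ y • F y) =ᶠ[𝓝 y] fun _ => (0 : ℂ) := by
        filter_upwards [hψz y hy] with z hz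
        simp [hz]
      rw [dbar_congr this]
      simp [dbar]
    have hGi : Integrable (dbar fun y => ψ y • F y) := by
      refine Continuous.integrable_of_hasCompactSupport ?_ ?_
      · have hv : ∀ v : ℂ, Continuous fun y => fderiv ℝ (fun y => ψ y • F y) y v := fun v =>
          (hGd.continuous_fderiv_apply one_ne_zero).comp (continuous_id.prodMk continuous_const)
        exact (hv 1).add (continuous_const.mul (hv I))
      · refine HasCompactSupport.intro hGs.isCompact fun y hy => ?_
        rw [dbar_congr (notMem_tsupport_iff_eventuallyEq.1 hy)]
        simp [dbar]
    have hprod : ∀ y ∈ Ω, dbar (fun y => ψ y • F y) y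
        = dbarReal ψ y * F y + ψ y * dbar F y := fun y hy =>
      dbar_smul ((hψd y).differentiableAt one_ne_zero)
        ((hFd y hy).differentiableAt one_ne_zero)
    have hψi : IntegrableOn (fun y => (ψ y : ℂ) * dbar F y) Ω := by
      refine hFi.bdd_mul (c := 1) ?_ ?_
      · have : Continuous ψ := continuous_iff_continuousAt.2 fun y => (hψd y).continuousAt
        exact (Complex.continuous_ofReal.comp this).aestronglyMeasurable
      · refine ae_of_all _ fun y => ?_
        rw [Complex.norm_real]
        exact norm_sideCutoff_le ε y
    -- Integrability of this term is read off the product rule, as a difference of two integrable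
    -- functions.
    have hDi : IntegrableOn (fun y => dbarReal ψ y * F y) Ω := by
      refine (hGi.integrableOn.sub hψi).congr_fun (fun y hy => ?_) hΩm
      simp only [Pi.sub_apply, hprod y hy]
      ring
    have hsum : (∫ y in Ω, dbarReal ψ y * F y) + ∫ y in Ω, (ψ y : ℂ) * dbar F y = 0 := by
      rw [← integral_add hDi hψi, ← hG0, ← setIntegral_eq_integral_of_forall_compl_eq_zero hGz]
      exact setIntegral_congr_fun hΩm fun y hy => (hprod y hy).symm
    -- change of variables in the tube
    set N : Set ℂ := {w | 0 < w.im ∧ w.im < d} with hN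
    have hNo : IsOpen N := (isOpen_lt continuous_const Complex.continuous_im).inter
        (isOpen_lt Complex.continuous_im continuous_const)
    have hNsub : N ⊆ {w | |w.im| < d} := fun w hw => by
      rw [mem_ofPred, abs_of_pos hw.1]; exact hw.2
    have hinj : InjOn (tube ζ) N := hd.injOn.mono hNsub
    have hder : ∀ w ∈ N, HasFDerivWithinAt (tube ζ) (tubeDeriv ζ w) N w := fun w _ =>
      (h.hasFDerivAt_tube w).hasFDerivWithinAt
    have himg : tube ζ '' N ⊆ Ω := by
      rintro _ ⟨w, hw, rfl⟩; exact hΩ.left w hw.1 hw.2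
    have hout : ∀ y ∈ Ω \ tube ζ '' N, dbarReal ψ y * F y = 0 := by
      intro y hy
      have : y ∉ tube ζ '' {w | |w.im| ≤ ε} := by
        rintro ⟨w, hw, rfl⟩
        have hw' : |w.im| < d := lt_of_le_of_lt hw hε
        exact hy.2 ⟨w, ⟨hΩ.im_pos hw' hy.1, (le_abs_self _).trans_lt hw'⟩, rfl⟩
      rw [dbarReal_congr (hΩ.sideCutoff_eventuallyEq_one h hd h0 hε hy.1 this)]
      simp [dbarReal]
    have hcov := integral_image_eq_integral_abs_det_fderiv_smul volume hNo.measurableSet hder hinj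
      (fun y => dbarReal ψ y * F y)
    have hcovi := (integrableOn_image_iff_integrableOn_abs_det_fderiv_smul volume
      hNo.measurableSet hder hinj (fun y => dbarReal ψ y * F y)).1 (hDi.mono_set himg)
    -- The Jacobian of the change of variables is exactly the factor needed to express ∂̄ψ by the
    -- tangent; no inverse matrix remains.
    have hpt : ∀ w ∈ N, |(tubeDeriv ζ w).det| • (dbarReal ψ (tube ζ w) * F (tube ζ w))
        = I * (((2 / ε * stepDeriv (2 * w.im / ε - 1) : ℝ) : ℂ)
          * (tubeTangent ζ w * F (tube ζ w))) := by
      intro w hw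
      rw [det_tubeDeriv, abs_of_pos (hd.jac_pos w (hNsub hw)), Complex.real_smul, ← mul_assoc,
        hΩ.tubeJac_mul_dbarReal_sideCutoff h hd h0 hε hw.1 hw.2]
      ring
    set f : ℂ → ℂ := N.indicator fun w => ((2 / ε * stepDeriv (2 * w.im / ε - 1) : ℝ) : ℂ)
          * (tubeTangent ζ w * F (tube ζ w)) with hf
    have hfi : Integrable f := by
      rw [hf, integrable_indicator_iff hNo.measurableSet]
      have h1 := (hcovi.congr_fun hpt hNo.measurableSet).const_mul (-I)
      refine IntegrableOn.congr_fun h1 (fun w _ => ?_) hNo.measurableSet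
      linear_combination (-(((2 / ε * stepDeriv (2 * w.im / ε - 1) : ℝ) : ℂ)
          * (tubeTangent ζ w * F (tube ζ w)))) * Complex.I_mul_I
    -- The weight depends on the height t alone, so each slice is the weight times the integral H t
    -- over the parallel curve.
    have hiter : ∀ t : ℝ, (∫ a : ℝ, f (a + t * I)) = (Ioo 0 d).indicator
        (fun t => ((2 / ε * stepDeriv (2 * t / ε - 1) : ℝ) : ℂ) * H t) t := by
      intro t
      by_cases ht : t ∈ Ioo 0 d
      · rw [indicator_of_mem ht, hH, ← integral_const_mul]
        refine integral_congr_ae (ae_of_all _ fun a => ?_)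
        have : (a + t * I : ℂ) ∈ N := by simpa [hN] using ⟨ht.1, ht.2⟩
        simp only [hf, indicator_of_mem this]
        simp
      · rw [indicator_of_notMem ht]
        refine (integral_congr_ae (ae_of_all _ fun a => ?_)).trans (integral_zero _ _)
        have : (a + t * I : ℂ) ∉ N := by simpa [hN] using ht
        simp only [hf, indicator_of_notMem this]
    have hii := integrable_iterated hfi
    rw [funext hiter, integrable_indicator_iff measurableSet_Ioo] at hii
    refine ⟨hii, ?_⟩
    have e1 : ∫ y in Ω, dbarReal ψ y * F y
        = I * ∫ t in Ioo 0 d, ((2 / ε * stepDeriv (2 * t / ε - 1) : ℝ) : ℂ) * H t := by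
      rw [setIntegral_eq_of_subset_of_forall_sdiff_eq_zero hΩm himg hout, hcov,
        setIntegral_congr_fun hNo.measurableSet hpt, integral_const_mul,
        ← integral_indicator hNo.measurableSet, ← hf, integral_complex_eq_iterated hfi,
        funext hiter, integral_indicator measurableSet_Ioo]
    rw [← e1]
    linear_combination hsum
  -- As ε → 0 the area integral of ψ ∂̄F has two limits: one by the approximate identity, one by
  -- dominated convergence. Equating them is Green's formula.
  have l1 := (tendsto_integral_step_mul hd.pos hHlim fun ε h0 hε => (key ε h0 hε).1).const_mul I
  have l2 : Tendsto (fun ε => ∫ y in Ω, (sideCutoff ζ d Ω ε y : ℂ) * dbar F y) (𝓝[>] 0)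
      (𝓝 (∫ y in Ω, dbar F y)) := by
    refine tendsto_integral_filter_of_dominated_convergence (fun y => ‖dbar F y‖) ?_ ?_
      hFi.norm ?_
    · filter_upwards [Ioo_mem_nhdsGT hd.pos] with ε hε
      have : Continuous (sideCutoff ζ d Ω ε) := continuous_iff_continuousAt.2 fun y =>
        (hΩ.contDiffAt_sideCutoff h hd hε.1 hε.2 y).continuousAt
      exact (Complex.continuous_ofReal.comp this).aestronglyMeasurable.mul
        (measurable_dbar F).aestronglyMeasurable
    · refine Eventually.of_forall fun ε => ae_of_all _ fun y => ?_
      rw [norm_mul, Complex.norm_real]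
      exact mul_le_of_le_one_left (norm_nonneg _) (norm_sideCutoff_le ε y)
    · refine (ae_restrict_iff' hΩm).2 (ae_of_all _ fun y hy => ?_)
      have := ((Complex.continuous_ofReal.tendsto _).comp
        (hΩ.tendsto_sideCutoff hd hy)).mul_const (dbar F y)
      simpa using this
  have l3 : Tendsto (fun ε => ∫ y in Ω, (sideCutoff ζ d Ω ε y : ℂ) * dbar F y) (𝓝[>] 0)
      (𝓝 (-(I * ∫ a, F (ζ a) * deriv ζ a))) := by
    refine l1.neg.congr' ?_
    filter_upwards [Ioo_mem_nhdsGT hd.pos] with ε hε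
    exact (key ε hε.1 hε.2).2.symm
  rw [tendsto_nhds_unique l2 l3]
  linear_combination (∫ a, F (ζ a) * deriv ζ a) * Complex.I_mul_I

end IsLeftSide

end

section

/-! ### The sides of a periodic curve -/

theorem contDiff_stepDeriv : ContDiff ℝ 1 stepDeriv := by
  have h : ContDiff ℝ (1 + 1) Real.smoothTransition :=
    Real.smoothTransition.contDiff (n := (2 : ℕ∞))
  exact (contDiff_succ_iff_deriv.1 h).2.2

theorem dbar_ofReal {g : ℂ → ℝ} {y : ℂ} (hg : DifferentiableAt ℝ g y) :
    dbar (fun y => (g y : ℂ)) y = dbarReal g y := by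
  have h1 : HasFDerivAt (fun y => (g y : ℂ)) (Complex.ofRealCLM.comp (fderiv ℝ g y)) y :=
    Complex.ofRealCLM.hasFDerivAt.comp y hg.hasFDerivAt
  simp [dbar, dbarReal, h1.fderiv]

theorem dbarReal_comp_re {f : ℝ → ℝ} {f' : ℝ} {y : ℂ} (hf : HasDerivAt f f' y.re) :
    dbarReal (fun y => f y.re) y = f' := by
  have h1 : HasFDerivAt (fun y : ℂ => f y.re) (f' • Complex.reCLM) y :=
    hf.comp_hasFDerivAt y Complex.reCLM.hasFDerivAt
  simp [dbarReal, h1.fderiv]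

theorem dbarReal_comp_im {f : ℝ → ℝ} {f' : ℝ} {y : ℂ} (hf : HasDerivAt f f' y.im) :
    dbarReal (fun y => f y.im) y = I * f' := by
  have h1 : HasFDerivAt (fun y : ℂ => f y.im) (f' • Complex.imCLM) y :=
    hf.comp_hasFDerivAt y Complex.imCLM.hasFDerivAt
  simp [dbarReal, h1.fderiv]

theorem integral_re_mul_im (f g : ℝ → ℝ) :
    ∫ y : ℂ, f y.re * g y.im = (∫ t, f t) * ∫ t, g t := by
  rw [← integral_prod_mul,
    ← Complex.volume_preserving_equiv_real_prod.symm.integral_comp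
      (MeasurableEquiv.measurableEmbedding _)]
  rfl

/-- A smooth function that is `1` on `[-M, M]` and `0` outside `[-M-1, M+1]`. -/
def plateau (M t : ℝ) : ℝ :=
  Real.smoothTransition (M + 1 - t) * Real.smoothTransition (M + 1 + t)

/-- The derivative of `plateau M`. -/
def plateauDeriv (M t : ℝ) : ℝ :=
  -stepDeriv (M + 1 - t) * Real.smoothTransition (M + 1 + t)
    + Real.smoothTransition (M + 1 - t) * stepDeriv (M + 1 + t)

theorem hasDerivAt_plateau (M t : ℝ) : HasDerivAt (plateau M) (plateauDeriv M t) t := by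
  have h1 : HasDerivAt (fun t => Real.smoothTransition (M + 1 - t)) (-stepDeriv (M + 1 - t)) t := by
    exact ((hasDerivAt_step (M + 1 - t)).comp t
      ((hasDerivAt_id t).const_sub (M + 1))).congr_deriv (by simp)
  have h2 : HasDerivAt (fun t => Real.smoothTransition (M + 1 + t)) (stepDeriv (M + 1 + t)) t := by
    exact ((hasDerivAt_step (M + 1 + t)).comp t
      ((hasDerivAt_id t).const_add (M + 1))).congr_deriv (by simp)
  exact h1.mul h2

theorem contDiff_plateau (M : ℝ) : ContDiff ℝ 1 (plateau M) := by
  have h : ContDiff ℝ 1 Real.smoothTransition := Real.smoothTransition.contDiff (n := (1 : ℕ∞))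
  exact (h.comp (contDiff_const.sub contDiff_id)).mul (h.comp (contDiff_const.add contDiff_id))

theorem plateau_of_abs_le {M t : ℝ} (h : |t| ≤ M) : plateau M t = 1 := by
  have := abs_le.1 h
  rw [plateau, Real.smoothTransition.one_of_one_le, Real.smoothTransition.one_of_one_le, one_mul]
  all_goals linarith

theorem plateau_of_le_abs {M t : ℝ} (h : M + 1 ≤ |t|) : plateau M t = 0 := by
  rw [plateau]
  rcases le_abs.1 h with h1 | h1
  · rw [Real.smoothTransition.zero_of_nonpos (by linarith), zero_mul]
  · rw [mul_comm, Real.smoothTransition.zero_of_nonpos (by linarith), zero_mul]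

theorem plateauDeriv_of_abs_le {M t : ℝ} (h : |t| ≤ M) : plateauDeriv M t = 0 := by
  have := abs_le.1 h
  rw [plateauDeriv, stepDeriv_of_one_le, stepDeriv_of_one_le]
  · ring
  all_goals linarith

theorem abs_plateau_le (M t : ℝ) : |plateau M t| ≤ 1 := by
  rw [plateau, abs_mul, abs_of_nonneg (Real.smoothTransition.nonneg _),
    abs_of_nonneg (Real.smoothTransition.nonneg _)]
  exact mul_le_one₀ (Real.smoothTransition.le_one _) (Real.smoothTransition.nonneg _)
    (Real.smoothTransition.le_one _)

/-- On the half-plane s t ≤ M only one flank of the plateau is visible. This evaluates an area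
integral over a region that is bounded on one side only. -/
theorem plateauDeriv_of_mul_le {s M t : ℝ} (hs : s = 1 ∨ s = -1) (hM : 0 ≤ M) (h : s * t ≤ M) :
    plateauDeriv M t = s * stepDeriv (M + 1 + s * t) := by
  rcases le_or_gt (-M) (s * t) with h1 | h1
  · have : |t| ≤ M := by
      rcases hs with rfl | rfl <;> rw [abs_le] <;> constructor <;> linarith
    rw [plateauDeriv_of_abs_le this, stepDeriv_of_one_le (by linarith), mul_zero]
  · rw [plateauDeriv]
    rcases hs with rfl | rfl
    · rw [stepDeriv_of_one_le (by linarith), Real.smoothTransition.one_of_one_le (x := M + 1 - t)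
        (by linarith), one_mul]
      ring_nf
    · rw [stepDeriv_of_one_le (r := M + 1 + t) (by linarith),
        Real.smoothTransition.one_of_one_le (x := M + 1 + t) (by linarith)]
      ring_nf

theorem IsPeriodicCurve.exists_abs_im_le {s : ℝ} {ζ : ℝ → ℂ} (h : IsPeriodicCurve s ζ) :
    ∃ C, 0 ≤ C ∧ ∀ a, |(ζ a).im| ≤ C := by
  obtain ⟨C, hC⟩ := h.exists_norm_sub_linear_le
  refine ⟨C, (norm_nonneg _).trans (hC 0), fun a => ?_⟩
  have := (Complex.abs_im_le_norm _).trans (hC a)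
  simpa using this

theorem IsPeriodicCurve.exists_abs_re_sub_le {s : ℝ} {ζ : ℝ → ℂ} (h : IsPeriodicCurve s ζ) :
    ∃ C, 0 ≤ C ∧ ∀ a, |(ζ a).re - s * a| ≤ C := by
  obtain ⟨C, hC⟩ := h.exists_norm_sub_linear_le
  refine ⟨C, (norm_nonneg _).trans (hC 0), fun a => ?_⟩
  have := (Complex.abs_re_le_norm _).trans (hC a)
  simpa using this

/-- The integrand is the derivative of the step applied to Re ζ. The real part tends to +∞ as a →
s·∞, so the step rises from 0 to 1 for s = 1 and falls from 1 to 0 for s = −1: a signed count of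
crossings of the strip 0 < x₁ < 1. -/
theorem IsPeriodicCurve.integral_stepDeriv_re {s : ℝ} {ζ : ℝ → ℂ} (h : IsPeriodicCurve s ζ) :
    ∫ a, stepDeriv (ζ a).re * (deriv ζ a).re = s := by
  obtain ⟨C, hC0, hC⟩ := h.exists_abs_re_sub_le
  have hder : ∀ a, HasDerivAt (fun a => Real.smoothTransition (ζ a).re)
      (stepDeriv (ζ a).re * (deriv ζ a).re) a := by
    intro a
    have h1 : HasDerivAt (fun a => (ζ a).re) (deriv ζ a).re a := by
      exact Complex.reCLM.hasFDerivAt.comp_hasDerivAt a (h.hasDerivAt a)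
    exact (hasDerivAt_step _).comp a h1
  have hint : Integrable fun a => stepDeriv (ζ a).re * (deriv ζ a).re := by
    refine Continuous.integrable_of_hasCompactSupport ?_ ?_
    · exact (continuous_stepDeriv.comp (Complex.continuous_re.comp h.continuous)).mul
        (Complex.continuous_re.comp h.continuous_deriv)
    · refine HasCompactSupport.intro (isCompact_Icc (a := -(C + 1)) (b := C + 1)) fun a ha => ?_
      have h1 := abs_le.1 (hC a)
      have : stepDeriv (ζ a).re = 0 := by
        by_contra hne
        have h2 : 0 < (ζ a).re := by
          by_contra hn; exact hne (stepDeriv_of_nonpos (not_lt.1 hn))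
        have h3 : (ζ a).re < 1 := by
          by_contra hn; exact hne (stepDeriv_of_one_le (not_lt.1 hn))
        refine ha ?_
        rcases h.orientation with rfl | rfl <;> constructor <;> linarith
      rw [this, zero_mul]
  have hup : Tendsto (fun a => Real.smoothTransition (ζ a).re) (if 0 < s then atTop else atBot)
      (𝓝 1) := by
    refine tendsto_const_nhds.congr' ?_
    rcases h.orientation with rfl | rfl
    · norm_num
      filter_upwards [eventually_ge_atTop (C + 1)] with a ha
      exact (Real.smoothTransition.one_of_one_le (by linarith [(abs_le.1 (hC a)).1])).symm
    · norm_num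
      filter_upwards [eventually_le_atBot (-(C + 1))] with a ha
      exact (Real.smoothTransition.one_of_one_le (by linarith [(abs_le.1 (hC a)).1])).symm
  have hdown : Tendsto (fun a => Real.smoothTransition (ζ a).re) (if 0 < s then atBot else atTop)
      (𝓝 0) := by
    refine tendsto_const_nhds.congr' ?_
    rcases h.orientation with rfl | rfl
    · norm_num
      filter_upwards [eventually_le_atBot (-C)] with a ha
      exact (Real.smoothTransition.zero_of_nonpos (by linarith [(abs_le.1 (hC a)).2])).symm
    · norm_num
      filter_upwards [eventually_ge_atTop C] with a ha
      exact (Real.smoothTransition.zero_of_nonpos (by linarith [(abs_le.1 (hC a)).2])).symm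
  rcases h.orientation with rfl | rfl
  · norm_num at hup hdown
    rw [integral_of_hasDerivAt_of_tendsto hder hint hdown hup]
    norm_num
  · norm_num at hup hdown
    rw [integral_of_hasDerivAt_of_tendsto hder hint hup hdown]
    norm_num

/-- The left side of a curve from left to right is not the lower one. -/
theorem IsLeftSide.false_of_orientation {s d : ℝ} {ζ : ℝ → ℂ} {Ω : Set ℂ}
    (hΩ : IsLeftSide ζ d Ω) (h : IsPeriodicCurve s ζ) (hd : IsTubeWidth ζ d) {M : ℝ}
    (h1 : ∀ y : ℂ, s * y.im < -M → y ∈ Ω) (h2 : ∀ y ∈ Ω, s * y.im ≤ M) : False := by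
  obtain ⟨C, hC0, hC⟩ := h.exists_abs_im_le
  -- The test function is a bump of mass one in x₁ times a plateau in x₂; B is large enough that the
  -- plateau equals 1 on the curve and its flanks lie beyond height M.
  set B := max C M with hB
  have hB0 : 0 ≤ B := hC0.trans (le_max_left _ _)
  set g : ℂ → ℝ := fun y => stepDeriv y.re * plateau B y.im with hg
  have hgd : ContDiff ℝ 1 g := (contDiff_stepDeriv.comp Complex.reCLM.contDiff).mul
    ((contDiff_plateau B).comp Complex.imCLM.contDiff)
  have hFd : ContDiff ℝ 1 fun y => (g y : ℂ) := Complex.ofRealCLM.contDiff.comp hgd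
  have hFs : HasCompactSupport fun y => (g y : ℂ) := by
    refine HasCompactSupport.intro (K := Icc 0 1 ×ℂ Icc (-(B + 1)) (B + 1))
      (isCompact_Icc.reProdIm isCompact_Icc) fun y hy => ?_
    by_contra hne
    refine hy ⟨?_, ?_⟩
    · constructor
      · by_contra hn
        exact hne (by simp [hg, stepDeriv_of_nonpos (not_le.1 hn).le])
      · by_contra hn
        exact hne (by simp [hg, stepDeriv_of_one_le (not_le.1 hn).le])
    · by_contra hn
      refine hne ?_
      have : B + 1 ≤ |y.im| := by
        by_contra h3
        exact hn (abs_le.1 (not_le.1 h3).le)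
      simp [hg, plateau_of_le_abs this]
  have green := hΩ.integral_curve_eq h hd hFd.contDiffOn hFs
  -- On the curve the plateau is invisible, and the real part of the line integral is the signed
  -- crossing number.
  have hleft : (∫ a, (g (ζ a) : ℂ) * deriv ζ a).re = s := by
    have hi : Integrable fun a => (g (ζ a) : ℂ) * deriv ζ a := by
      obtain ⟨L, hL⟩ := h.exists_tube_eq_zero hFs
      refine Continuous.integrable_of_hasCompactSupport
        ((hFd.continuous.comp h.continuous).mul h.continuous_deriv) ?_
      refine HasCompactSupport.intro (isCompact_Icc (a := -L) (b := L)) fun a ha => ?_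
      have := hL a (by simp) (by
        by_contra hn
        exact ha (abs_le.1 (by simpa using hn)))
      rw [IsPeriodicCurve.tube_ofReal] at this
      rw [this, zero_mul]
    have := integral_re (𝕜 := ℂ) hi
    simp only [RCLike.re_to_complex] at this
    rw [← this, ← h.integral_stepDeriv_re]
    refine integral_congr_ae (ae_of_all _ fun a => ?_)
    have hp : plateau B (ζ a).im = 1 := plateau_of_abs_le ((hC a).trans (le_max_left C M))
    simp [hg, hp]
  have hdb : ∀ y, dbar (fun y => (g y : ℂ)) y = dbarReal (fun y => stepDeriv y.re) y
      * plateau B y.im + stepDeriv y.re * (I * plateauDeriv B y.im) := by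
    intro y
    rw [dbar_ofReal (hgd.differentiable one_ne_zero y), hg, dbarReal_mul,
      dbarReal_comp_im (hasDerivAt_plateau B y.im)]
    · exact (contDiff_stepDeriv.comp Complex.reCLM.contDiff).differentiable one_ne_zero y
    · exact ((contDiff_plateau B).comp Complex.imCLM.contDiff).differentiable one_ne_zero y
  have him : ∀ y, (dbar (fun y => (g y : ℂ)) y).im = stepDeriv y.re * plateauDeriv B y.im := by
    intro y
    rw [hdb, dbarReal_comp_re
      (contDiff_stepDeriv.differentiable one_ne_zero y.re).hasDerivAt]
    simp
  have hright : (I * ∫ y in Ω, dbar (fun y => (g y : ℂ)) y).re = -s := by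
    have hi : Integrable (dbar fun y => (g y : ℂ)) := by
      refine Continuous.integrable_of_hasCompactSupport ?_ ?_
      · have hv : ∀ v : ℂ, Continuous fun y => fderiv ℝ (fun y => (g y : ℂ)) y v := fun v =>
          (hFd.continuous_fderiv_apply one_ne_zero).comp (continuous_id.prodMk continuous_const)
        exact (hv 1).add (continuous_const.mul (hv I))
      · refine HasCompactSupport.intro hFs.isCompact fun y hy => ?_
        rw [dbar_congr (notMem_tsupport_iff_eventuallyEq.1 hy)]
        simp [dbar]
    have e := integral_im (𝕜 := ℂ) hi.integrableOn (f := dbar fun y => (g y : ℂ)) (μ := volume.restrict Ω)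
    simp only [RCLike.im_to_complex] at e
    have e2 : (I * ∫ y in Ω, dbar (fun y => (g y : ℂ)) y).re
        = -(∫ y in Ω, dbar (fun y => (g y : ℂ)) y).im := by simp
    rw [e2, ← e]
    simp only [him]
    -- Of the two flanks of the plateau, Ω contains one entirely and misses the other, so the area
    -- side has the opposite sign, and Green's formula would read s = −s.
    have e3 : ∫ y in Ω, stepDeriv y.re * plateauDeriv B y.im
        = ∫ y : ℂ, stepDeriv y.re * (s * stepDeriv (B + 1 + s * y.im)) := by
      rw [← setIntegral_eq_integral_of_forall_compl_eq_zero (s := Ω)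
        (f := fun y : ℂ => stepDeriv y.re * (s * stepDeriv (B + 1 + s * y.im)))]
      · refine setIntegral_congr_fun hΩ.isOpen.measurableSet fun y hy => ?_
        rw [plateauDeriv_of_mul_le h.orientation hB0 ((h2 y hy).trans (le_max_right _ _))]
      · intro y hy
        have : -M ≤ s * y.im := not_lt.1 fun hn => hy (h1 y hn)
        rw [stepDeriv_of_one_le (r := B + 1 + s * y.im) (by linarith [le_max_right C M])]
        ring
    rw [e3, integral_re_mul_im stepDeriv fun t => s * stepDeriv (B + 1 + s * t),
      integral_stepDeriv, integral_const_mul]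
    have e4 : ∫ t, stepDeriv (B + 1 + s * t) = 1 := by
      rcases h.orientation with rfl | rfl
      · simp only [one_mul]
        rw [integral_add_left_eq_self (fun t => stepDeriv t), integral_stepDeriv]
      · simp only [neg_mul, one_mul, ← sub_eq_add_neg]
        rw [integral_sub_left_eq_self (fun t => stepDeriv t), integral_stepDeriv]
    rw [e4]
    ring
  rw [green, hright] at hleft
  rcases h.orientation with rfl | rfl <;> norm_num at hleft

/-! ### Reversal of the curve and the two regions it separates -/

/-- The curve `ζ` traversed backwards. -/
def reverse (ζ : ℝ → ℂ) (a : ℝ) : ℂ := ζ (-a)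

theorem deriv_reverse (ζ : ℝ → ℂ) (a : ℝ) : deriv (reverse ζ) a = -deriv ζ (-a) :=
  deriv_comp_neg ζ a

/-- Reversal is a half turn of the parameter plane. It exchanges left and right, so that the region
to the right of ζ is covered by the results for left sides. -/
theorem tube_reverse (ζ : ℝ → ℂ) (w : ℂ) : tube (reverse ζ) w = tube ζ (-w) := by
  simp [tube, deriv_reverse, reverse]

theorem IsPeriodicCurve.reverse {s : ℝ} {ζ : ℝ → ℂ} (h : IsPeriodicCurve s ζ) :
    IsPeriodicCurve (-s) (reverse ζ) where
  orientation := by rcases h.orientation with rfl | rfl <;> norm_num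
  smooth := h.smooth.comp contDiff_neg
  periodic a := by
    have := h.add_int_mul (-a) (-1)
    simp only [TwoFluid.reverse]
    rw [show -(a + 2 * π) = -a + ((-1 : ℤ) : ℝ) * (2 * π) by push_cast; ring, this]
    push_cast
    ring
  injective a b hab := by simpa using h.injective hab
  regular a := by rw [deriv_reverse]; exact neg_ne_zero.2 (h.regular _)

/-- A periodic curve separates the plane into a region `E` to its right and a region `N` to its
left. -/
structure IsSeparated (s : ℝ) (ζ : ℝ → ℂ) (E N : Set ℂ) : Prop where
  isOpen_E : IsOpen E
  isOpen_N : IsOpen N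
  isConnected_E : IsConnected E
  isConnected_N : IsConnected N
  cover : E ∪ range ζ ∪ N = univ
  disjoint_E_N : Disjoint E N
  disjoint_E_curve : Disjoint E (range ζ)
  disjoint_N_curve : Disjoint N (range ζ)
  side_E : ∃ M : ℝ, ∀ y : ℂ, s * y.im < -M → y ∈ E
  side_N : ∃ M : ℝ, ∀ y : ℂ, M < s * y.im → y ∈ N

namespace IsSeparated

variable {s : ℝ} {ζ : ℝ → ℂ} {E N : Set ℂ}

theorem subset_or_subset (h : IsSeparated s ζ E N) {A : Set ℂ} (hA : IsPreconnected A)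
    (hd : ∀ y ∈ A, y ∉ range ζ) : A ⊆ E ∨ A ⊆ N := by
  refine hA.subset_or_subset h.isOpen_E h.isOpen_N h.disjoint_E_N fun y hy => ?_
  have : y ∈ E ∪ range ζ ∪ N := h.cover ▸ mem_univ y
  rcases this with (h1 | h1) | h1
  · exact Or.inl h1
  · exact absurd h1 (hd y hy)
  · exact Or.inr h1

theorem frontier_N_subset (h : IsSeparated s ζ E N) : frontier N ⊆ range ζ := by
  intro y hy
  rw [h.isOpen_N.frontier_eq] at hy
  have : y ∈ E ∪ range ζ ∪ N := h.cover ▸ mem_univ y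
  rcases this with (h1 | h1) | h1
  · exact absurd hy.1 ((h.disjoint_E_N.closure_right h.isOpen_E).notMem_of_mem_left h1)
  · exact h1
  · exact absurd h1 hy.2

theorem frontier_E_subset (h : IsSeparated s ζ E N) : frontier E ⊆ range ζ := by
  intro y hy
  rw [h.isOpen_E.frontier_eq] at hy
  have : y ∈ E ∪ range ζ ∪ N := h.cover ▸ mem_univ y
  rcases this with (h1 | h1) | h1
  · exact absurd h1 hy.2
  · exact h1
  · exact absurd hy.1 ((h.disjoint_E_N.symm.closure_right h.isOpen_N).notMem_of_mem_left h1)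

/-- Excludes a curve with the same region A on both sides: A together with the curve would be open,
and its complement B would be a proper nonempty clopen subset of the connected plane. -/
theorem false_of_nhds {ζ : ℝ → ℂ} {A B : Set ℂ} (hA : IsOpen A) (hB : IsOpen B)
    (hAn : A.Nonempty) (hBn : B.Nonempty) (hc : A ∪ range ζ ∪ B = univ) (hAB : Disjoint A B)
    (hB2 : Disjoint B (range ζ)) (hn : ∀ a, A ∪ range ζ ∈ 𝓝 (ζ a)) : False := by
  have ho : IsOpen (A ∪ range ζ) := by
    rw [isOpen_iff_mem_nhds]
    rintro y (hy | ⟨a, rfl⟩)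
    · exact mem_of_superset (hA.mem_nhds hy) subset_union_left
    · exact hn a
  have hcompl : A ∪ range ζ = Bᶜ := by
    ext y
    constructor
    · rintro (hy | hy) hyB
      · exact hAB.notMem_of_mem_left hy hyB
      · exact hB2.notMem_of_mem_left hyB hy
    · intro hy
      have : y ∈ A ∪ range ζ ∪ B := hc ▸ mem_univ y
      exact this.resolve_right hy
  have hclopen : IsClopen B := ⟨⟨hcompl ▸ ho⟩, hB⟩
  rcases isClopen_iff.1 hclopen with h1 | h1
  · exact hBn.ne_empty h1
  · obtain ⟨y, hy⟩ := hAn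
    exact hAB.notMem_of_mem_left hy (h1 ▸ mem_univ y)

/-- The region `N` is to the left of the curve and `E` is to the right. -/
theorem exists_isLeftSide (h : IsSeparated s ζ E N) (hζ : IsPeriodicCurve s ζ) :
    ∃ d, IsTubeWidth ζ d ∧ IsTubeWidth (reverse ζ) d ∧ IsLeftSide ζ d N ∧
      IsLeftSide (reverse ζ) d E := by
  obtain ⟨d₁, hd₁⟩ := hζ.exists_isTubeWidth
  obtain ⟨d₂, hd₂⟩ := hζ.reverse.exists_isTubeWidth
  set d := min d₁ d₂ with hdd
  have hpos : 0 < d := lt_min hd₁.pos hd₂.pos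
  have hd := hd₁.mono hpos (min_le_left _ _)
  have hd' := hd₂.mono hpos (min_le_right _ _)
  refine ⟨d, hd, hd', ?_⟩
  have hoff : ∀ w : ℂ, |w.im| < d → w.im ≠ 0 → tube ζ w ∉ range ζ := by
    rintro w hw hne ⟨a, ha⟩
    rw [← IsPeriodicCurve.tube_ofReal (ζ := ζ) a] at ha
    have := hd.injOn (by simpa using hpos : (a : ℂ) ∈ {w : ℂ | |w.im| < d}) hw ha
    exact hne (by rw [← this]; simp)
  have hcL : IsPreconnected (tube ζ '' {w | 0 < w.im ∧ w.im < d}) := by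
    have : Convex ℝ {w : ℂ | 0 < w.im ∧ w.im < d} :=
      (convex_halfSpace_im_gt 0).inter (convex_halfSpace_im_lt d)
    exact this.isPreconnected.image _ hζ.continuous_tube.continuousOn
  have hcR : IsPreconnected (tube ζ '' {w | -d < w.im ∧ w.im < 0}) := by
    have : Convex ℝ {w : ℂ | -d < w.im ∧ w.im < 0} :=
      (convex_halfSpace_im_gt (-d)).inter (convex_halfSpace_im_lt 0)
    exact this.isPreconnected.image _ hζ.continuous_tube.continuousOn
  have hL := h.subset_or_subset hcL (by
    rintro _ ⟨w, hw, rfl⟩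
    exact hoff w (abs_lt.2 ⟨by linarith [hw.1], hw.2⟩) hw.1.ne')
  have hR := h.subset_or_subset hcR (by
    rintro _ ⟨w, hw, rfl⟩
    exact hoff w (abs_lt.2 ⟨hw.1, by linarith [hw.2]⟩) hw.2.ne)
  have hcurve : ∀ w : ℂ, w.im = 0 → tube ζ w ∈ range ζ := fun w hw => ⟨w.re, by simp [tube, hw]⟩
  have hnhds : ∀ A : Set ℂ, tube ζ '' {w | 0 < w.im ∧ w.im < d} ⊆ A →
      tube ζ '' {w | -d < w.im ∧ w.im < 0} ⊆ A → ∀ a, A ∪ range ζ ∈ 𝓝 (ζ a) := by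
    intro A h1 h2 a
    have := hd.image_mem_nhds hζ (w := a) (by simpa using hpos)
    rw [IsPeriodicCurve.tube_ofReal] at this
    refine mem_of_superset this ?_
    rintro _ ⟨w, hw, rfl⟩
    have hw' := abs_lt.1 (show |w.im| < d from hw)
    rcases lt_trichotomy w.im 0 with h3 | h3 | h3
    · exact Or.inl (h2 ⟨w, ⟨hw'.1, h3⟩, rfl⟩)
    · exact Or.inr (hcurve w h3)
    · exact Or.inl (h1 ⟨w, ⟨h3, hw'.2⟩, rfl⟩)
  have hside : ∀ A B : Set ℂ, IsOpen A → frontier A ⊆ range ζ → Disjoint A B →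
      Disjoint A (range ζ) → tube ζ '' {w | 0 < w.im ∧ w.im < d} ⊆ A →
      tube ζ '' {w | -d < w.im ∧ w.im < 0} ⊆ B → IsLeftSide ζ d A := by
    intro A B hA hfr hAB hAc h1 h2
    refine ⟨hA, hfr, fun w h3 h4 => h1 ⟨w, ⟨h3, h4⟩, rfl⟩, fun w h3 h4 h5 => ?_⟩
    rcases h4.eq_or_lt with h6 | h6
    · exact hAc.notMem_of_mem_left h5 (hcurve w h6)
    · exact hAB.notMem_of_mem_left h5 (h2 ⟨w, ⟨h3, h6⟩, rfl⟩)
  -- Each side strip lies in one region. Equal regions on both sides contradict connectedness of the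
  -- plane; E on the left and N on the right contradicts the orientation; the third case is the
  -- assertion.
  rcases hL with hL | hL <;> rcases hR with hR | hR
  · exact (false_of_nhds h.isOpen_E h.isOpen_N h.isConnected_E.nonempty h.isConnected_N.nonempty
      h.cover h.disjoint_E_N h.disjoint_N_curve (hnhds E hL hR)).elim
  · have hE := hside E N h.isOpen_E h.frontier_E_subset h.disjoint_E_N h.disjoint_E_curve hL hR
    obtain ⟨M₁, hM₁⟩ := h.side_E
    obtain ⟨M₂, hM₂⟩ := h.side_N
    refine (hE.false_of_orientation hζ hd (M := max M₁ M₂)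
      (fun y hy => hM₁ y (by linarith [le_max_left M₁ M₂])) fun y hy => ?_).elim
    by_contra hn
    exact h.disjoint_E_N.notMem_of_mem_left hy (hM₂ y (by linarith [le_max_right M₁ M₂]))
  · refine ⟨hside N E h.isOpen_N h.frontier_N_subset h.disjoint_E_N.symm h.disjoint_N_curve hL hR,
      h.isOpen_E, ?_, fun w h3 h4 => ?_, fun w h3 h4 h5 => ?_⟩
    · intro y hy
      obtain ⟨a, rfl⟩ := h.frontier_E_subset hy
      exact ⟨-a, by simp [TwoFluid.reverse]⟩
    · rw [tube_reverse]
      exact hR ⟨-w, ⟨by simpa using h4, by simpa using h3⟩, rfl⟩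
    · rw [tube_reverse] at h5
      rcases h4.eq_or_lt with h6 | h6
      · exact h.disjoint_E_curve.notMem_of_mem_left h5 (hcurve _ (by simpa using h6))
      · refine h.disjoint_E_N.notMem_of_mem_left h5 (hL ⟨-w, ⟨?_, ?_⟩, rfl⟩)
        · simpa using h6
        · simp only [Complex.neg_im]; linarith
  · refine (false_of_nhds h.isOpen_N h.isOpen_E h.isConnected_N.nonempty h.isConnected_E.nonempty
      ?_ h.disjoint_E_N.symm h.disjoint_E_curve (hnhds N hL hR)).elim
    rw [← h.cover]
    ext y
    simp only [mem_union]
    tauto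

/-- The two regions are periodic. -/
theorem add_int_mul_mem (h : IsSeparated s ζ E N) (hζ : IsPeriodicCurve s ζ) (n : ℤ) :
    (∀ y ∈ E, y + ((n * (2 * π) : ℝ) : ℂ) ∈ E) ∧ ∀ y ∈ N, y + ((n * (2 * π) : ℝ) : ℂ) ∈ N := by
  set c : ℂ := ((n * (2 * π) : ℝ) : ℂ) with hc
  have him : c.im = 0 := Complex.ofReal_im _
  have hcurve : ∀ y, y + c ∈ range ζ → y ∈ range ζ := by
    rintro y ⟨a, ha⟩
    have hk : ∀ k : ℤ, ζ (a + k * (2 * π)) = y + c + ((s * (k * (2 * π)) : ℝ) : ℂ) := fun k => by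
      rw [hζ.add_int_mul, ha]
    rcases hζ.orientation with rfl | rfl
    · refine ⟨_, (hk (-n)).trans ?_⟩
      rw [hc]; push_cast; ring
    · refine ⟨_, (hk n).trans ?_⟩
      rw [hc]; push_cast; ring
  have himg : ∀ A : Set ℂ, IsConnected A → Disjoint A (range ζ) →
      (fun y => y + c) '' A ⊆ E ∨ (fun y => y + c) '' A ⊆ N := by
    intro A hA hd
    refine h.subset_or_subset (hA.isPreconnected.image _ (by fun_prop)) ?_
    rintro _ ⟨y, hy, rfl⟩ hr
    exact hd.notMem_of_mem_left hy (hcurve y hr)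
  obtain ⟨M₁, hM₁⟩ := h.side_E
  obtain ⟨M₂, hM₂⟩ := h.side_N
  constructor
  · rcases himg E h.isConnected_E h.disjoint_E_curve with h1 | h1
    · exact fun y hy => h1 ⟨y, hy, rfl⟩
    -- A translate of a region is connected and avoids the curve, so it lies in one region. A point
    -- far on the side of E decides which, because translation preserves its height.
    · set y : ℂ := ((s * (-M₁ - 1) : ℝ) : ℂ) * I with hy
      have hyi : s * y.im < -M₁ := by
        have := hζ.sq_orientation
        have e : s * y.im = -M₁ - 1 := by
          simp only [hy, Complex.mul_im, Complex.ofReal_re, Complex.I_im, Complex.ofReal_im,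
            Complex.I_re]
          linear_combination (-M₁ - 1) * this
        linarith
      have h2 : y + c ∈ N := h1 ⟨y, hM₁ y hyi, rfl⟩
      have h3 : y + c ∈ E := hM₁ _ (by rwa [Complex.add_im, him, add_zero])
      exact (h.disjoint_E_N.notMem_of_mem_left h3 h2).elim
  · rcases himg N h.isConnected_N h.disjoint_N_curve with h1 | h1
    · set y : ℂ := ((s * (M₂ + 1) : ℝ) : ℂ) * I with hy
      have hyi : M₂ < s * y.im := by
        have := hζ.sq_orientation
        have e : s * y.im = M₂ + 1 := by
          simp only [hy, Complex.mul_im, Complex.ofReal_re, Complex.I_im, Complex.ofReal_im,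
            Complex.I_re]
          linear_combination (M₂ + 1) * this
        linarith
      have h2 : y + c ∈ E := h1 ⟨y, hM₂ y hyi, rfl⟩
      have h3 : y + c ∈ N := hM₂ _ (by rwa [Complex.add_im, him, add_zero])
      exact (h.disjoint_E_N.notMem_of_mem_left h2 h3).elim
    · exact fun y hy => h1 ⟨y, hy, rfl⟩

end IsSeparated

end

/-! ### The periodic Cauchy kernel -/

/-- The `2π`-periodic Cauchy kernel `cot (z / 2) / 2`. -/
def periodicKernel (z : ℂ) : ℂ := Complex.cos (z / 2) / (2 * Complex.sin (z / 2))

/-- The terms `1 / (z - 2πk) + 1 / (z + 2πk)`, `k ≥ 1`, of the periodic kernel. -/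
def latticeTerm (k : ℕ) (z : ℂ) : ℂ :=
  1 / (z - ((2 * π * (k + 1) : ℝ) : ℂ)) + 1 / (z + ((2 * π * (k + 1) : ℝ) : ℂ))

/-- The sum of the `1 / (z + 2πk)` over `|k| ≤ n`. -/
def partialKernel (n : ℕ) (z : ℂ) : ℂ := 1 / z + ∑ k ∈ Finset.range n, latticeTerm k z

theorem periodicKernel_periodic : Function.Periodic periodicKernel (2 * π) := by
  intro z
  rw [periodicKernel, periodicKernel, show (z + 2 * π) / 2 = z / 2 + π by ring, Complex.cos_add_pi,
    Complex.sin_add_pi, mul_neg, neg_div_neg_eq]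

theorem periodicKernel_add_int_mul (z : ℂ) (n : ℤ) :
    periodicKernel (z + ((n * (2 * π) : ℝ) : ℂ)) = periodicKernel z := by
  have := (periodicKernel_periodic.int_mul n) z
  rw [← this]
  push_cast
  rfl

theorem periodicKernel_zero : periodicKernel 0 = 0 := by simp [periodicKernel]

theorem latticeTerm_zero (k : ℕ) : latticeTerm k 0 = 0 := by
  simp [latticeTerm]

theorem sin_half_eq_zero_iff {z : ℂ} :
    Complex.sin (z / 2) = 0 ↔ ∃ n : ℤ, z = ((n * (2 * π) : ℝ) : ℂ) := by
  rw [Complex.sin_eq_zero_iff]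
  refine exists_congr fun n => ?_
  rw [div_eq_iff two_ne_zero]
  push_cast
  constructor <;> intro h <;> rw [h] <;> ring

/-- The Mittag-Leffler series of the cotangent, rescaled by 2π. The point z = 0 is allowed: with 1/0
= 0 both sides vanish there, and this spares an exceptional point in the dominated convergence
below. -/
theorem tendsto_partialKernel {z : ℂ} (hz : ∀ n : ℤ, n ≠ 0 → z ≠ ((n * (2 * π) : ℝ) : ℂ)) :
    Tendsto (fun n => partialKernel n z) atTop (𝓝 (periodicKernel z)) := by
  rcases eq_or_ne z 0 with rfl | h0
  · simp [partialKernel, latticeTerm_zero, periodicKernel_zero]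
  have hpi : (π : ℂ) ≠ 0 := by exact_mod_cast Real.pi_ne_zero
  have hx : z / (2 * π) ∈ Complex.integerComplement := by
    rw [Complex.mem_integerComplement_iff]
    rintro ⟨n, hn⟩
    rcases eq_or_ne n 0 with rfl | hn0
    · refine h0 ?_
      rw [eq_div_iff (by simp [hpi])] at hn
      rw [← hn]; simp
    · refine hz n hn0 ?_
      rw [eq_div_iff (by simp [hpi])] at hn
      rw [← hn]; push_cast; ring
  have hs := (summable_cotTerm hx).hasSum
  have hser := cot_series_rep' hx
  have hterm : ∀ n, latticeTerm n z = 1 / (2 * π) * cotTerm (z / (2 * π)) n := by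
    intro n
    have e1 : z / (2 * π) - (n + 1) = (z - ((2 * π * (n + 1) : ℝ) : ℂ)) / (2 * π) := by
      push_cast; field_simp
    have e2 : z / (2 * π) + (n + 1) = (z + ((2 * π * (n + 1) : ℝ) : ℂ)) / (2 * π) := by
      push_cast; field_simp
    rw [cotTerm, e1, e2, latticeTerm, one_div_div, one_div_div]
    field_simp
  have hs2 := (hs.mul_left (1 / (2 * π : ℂ))).tendsto_sum_nat
  have hlim : 1 / (2 * π : ℂ) * ∑' n, cotTerm (z / (2 * π)) n = periodicKernel z - 1 / z := by
    have : ∑' n, cotTerm (z / (2 * π)) n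
        = π * Complex.cot (π * (z / (2 * π))) - 1 / (z / (2 * π)) := hser.symm
    rw [this, show (π : ℂ) * (z / (2 * π)) = z / 2 by field_simp, Complex.cot, periodicKernel]
    field_simp
  rw [hlim] at hs2
  have := hs2.const_add (1 / z)
  rw [add_sub_cancel] at this
  refine this.congr fun n => ?_
  simp only [partialKernel, hterm]

/-- Each term is at most c/(k + c) − c/(k + 1 + c), and the sum telescopes. The bound does not
depend on c, which will be 1 + |Im z|; this keeps the kernel estimates uniform in height. -/
theorem sum_div_add_sq_le {c : ℝ} (hc : 0 < c) (n : ℕ) :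
    ∑ k ∈ Finset.range n, c / ((k : ℝ) + 1 + c) ^ 2 ≤ 1 - c / (n + c) := by
  induction n with
  | zero => simp [hc.ne']
  | succ n ih =>
    rw [Finset.sum_range_succ]
    push_cast
    have h1 : (0 : ℝ) < n + c := by positivity
    have h2 : (0 : ℝ) < n + 1 + c := by positivity
    have : c / ((n : ℝ) + 1 + c) ^ 2 ≤ c / (n + c) - c / (n + 1 + c) := by
      rw [div_sub_div _ _ h1.ne' h2.ne', div_le_div_iff₀ (by positivity) (by positivity)]
      have : c * (n + 1 + c) - (n + c) * c = c := by ring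
      rw [this]
      refine mul_le_mul_of_nonneg_left ?_ hc.le
      rw [sq]
      exact mul_le_mul_of_nonneg_right (by linarith) h2.le
    linarith

/-- Pairing k with −k gives 2z/((z − r)(z + r)), r = 2π(k + 1). By `hk` both factors have real part
at least π(k + 1) in modulus, so each squared modulus is at least an eighth of (k + 2 + |Im z|)²,
while |z| ≤ (B + 1)(1 + |Im z|). -/
theorem norm_latticeTerm_le {B : ℝ} (hB : 0 ≤ B) {k : ℕ} {z : ℂ} (hz : |z.re| ≤ B)
    (hk : B ≤ π * (k + 1)) :
    ‖latticeTerm k z‖ ≤ 16 * (B + 1) * ((1 + |z.im|) / ((k : ℝ) + 1 + (1 + |z.im|)) ^ 2) := by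
  set b := |z.im| with hb
  have hb0 : 0 ≤ b := abs_nonneg _
  set r : ℝ := 2 * π * (k + 1) with hr
  have hk1 : (0 : ℝ) < k + 1 := by positivity
  have hpi := Real.pi_gt_three
  have hre := abs_le.1 hz
  have hr2 : r = π * (k + 1) + π * (k + 1) := by rw [hr]; ring
  have hlow : ∀ w : ℂ, w.im = z.im → π * (k + 1) ≤ |w.re| →
      ((k : ℝ) + 1 + (1 + b)) ^ 2 / 8 ≤ ‖w‖ ^ 2 := by
    intro w h1 h2
    rw [Complex.sq_norm, Complex.normSq_apply, h1]
    have h3 : (k + 1 : ℝ) * (k + 1) ≤ w.re * w.re := by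
      rw [← abs_mul_abs_self w.re]
      have : (k + 1 : ℝ) ≤ |w.re| := by nlinarith
      exact mul_self_le_mul_self hk1.le this
    have h4 : z.im * z.im = b * b := by rw [hb, abs_mul_abs_self]
    have h5 : (1 : ℝ) ≤ k + 1 := by linarith [k.cast_nonneg (α := ℝ)]
    rw [h4]
    nlinarith [sq_nonneg ((k : ℝ) + 1 - b), sq_nonneg ((k : ℝ) + 1 + b - 1)]
  set w₁ : ℂ := z - (r : ℂ) with hw₁
  set w₂ : ℂ := z + (r : ℂ) with hw₂
  have h1 := hlow w₁ (by simp [hw₁]) (by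
    have : w₁.re = z.re - r := by simp [hw₁]
    rw [this, le_abs]; right; linarith)
  have h2 := hlow w₂ (by simp [hw₂]) (by
    have : w₂.re = z.re + r := by simp [hw₂]
    rw [this, le_abs]; left; linarith)
  set D : ℝ := ((k : ℝ) + 1 + (1 + b)) ^ 2 with hD
  have hD0 : 0 < D := by positivity
  have n1 : 0 < ‖w₁‖ := by
    by_contra hn
    have : ‖w₁‖ = 0 := le_antisymm (not_lt.1 hn) (norm_nonneg _)
    rw [this] at h1; linarith
  have n2 : 0 < ‖w₂‖ := by
    by_contra hn
    have : ‖w₂‖ = 0 := le_antisymm (not_lt.1 hn) (norm_nonneg _)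
    rw [this] at h2; linarith
  have hmul : D / 8 ≤ ‖w₁‖ * ‖w₂‖ := by
    refine le_of_sq_le_sq ?_ (by positivity)
    rw [mul_pow, sq (D / 8)]
    exact mul_le_mul h1 h2 (by positivity) (by positivity)
  have heq : latticeTerm k z = 2 * z / (w₁ * w₂) := by
    rw [latticeTerm, ← hr, ← hw₁, ← hw₂, div_add_div _ _ (norm_pos_iff.1 n1) (norm_pos_iff.1 n2)]
    congr 1
    rw [hw₁, hw₂]; ring
  rw [heq, norm_div, norm_mul, norm_mul, Complex.norm_ofNat]
  have hzn : ‖z‖ ≤ (B + 1) * (1 + b) := by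
    have := Complex.norm_le_abs_re_add_abs_im z
    nlinarith
  calc 2 * ‖z‖ / (‖w₁‖ * ‖w₂‖) ≤ 2 * ((B + 1) * (1 + b)) / (D / 8) := by gcongr
    _ = 16 * (B + 1) * ((1 + b) / D) := by field_simp; norm_num

theorem norm_sum_latticeTerm_le {B : ℝ} (hB : 0 ≤ B) {k₀ : ℕ} (hk : B ≤ π * (k₀ + 1)) {z : ℂ}
    (hz : |z.re| ≤ B) (n : ℕ) :
    ‖∑ k ∈ Finset.Ico k₀ n, latticeTerm k z‖ ≤ 16 * (B + 1) := by
  have hc : 0 < 1 + |z.im| := by positivity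
  calc ‖∑ k ∈ Finset.Ico k₀ n, latticeTerm k z‖
      ≤ ∑ k ∈ Finset.Ico k₀ n, ‖latticeTerm k z‖ := norm_sum_le _ _
    _ ≤ ∑ k ∈ Finset.Ico k₀ n,
        16 * (B + 1) * ((1 + |z.im|) / ((k : ℝ) + 1 + (1 + |z.im|)) ^ 2) := by
        refine Finset.sum_le_sum fun k hk' => norm_latticeTerm_le hB hz (hk.trans ?_)
        have : (k₀ : ℝ) ≤ k := by exact_mod_cast (Finset.mem_Ico.1 hk').1
        have := Real.pi_pos
        gcongr
    _ ≤ ∑ k ∈ Finset.range n,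
        16 * (B + 1) * ((1 + |z.im|) / ((k : ℝ) + 1 + (1 + |z.im|)) ^ 2) := by
        refine Finset.sum_le_sum_of_subset_of_nonneg (fun k hk' => ?_) fun k _ _ => by positivity
        exact Finset.mem_range.2 (Finset.mem_Ico.1 hk').2
    _ ≤ 16 * (B + 1) * 1 := by
        rw [← Finset.mul_sum]
        refine mul_le_mul_of_nonneg_left ((sum_div_add_sq_le hc n).trans ?_) (by positivity)
        have : 0 ≤ (1 + |z.im|) / (n + (1 + |z.im|)) := by positivity
        linarith
    _ = 16 * (B + 1) := mul_one _

/-- The partial sums of the periodic kernel are uniformly close to `1 / z` in a period strip. -/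
theorem norm_partialKernel_sub_le {z : ℂ} (hz : |z.re| ≤ π) (n : ℕ) :
    ‖partialKernel n z - 1 / z‖ ≤ 16 * (π + 1) := by
  have := norm_sum_latticeTerm_le Real.pi_pos.le (k₀ := 0) (by simp) hz n
  simpa [partialKernel] using this

/-- Chords over half a period of the parameter may leave the strip |Re z| ≤ π, so a bound on general
compact sets is needed. Finitely many terms are bounded by continuity off the nonzero lattice
points, the tail by the uniform estimate. -/
theorem exists_norm_partialKernel_sub_le {A : Set ℂ} (hA : IsCompact A)
    (hz : ∀ z ∈ A, ∀ n : ℤ, n ≠ 0 → z ≠ ((n * (2 * π) : ℝ) : ℂ)) :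
    ∃ C, ∀ n, ∀ z ∈ A, ‖partialKernel n z - 1 / z‖ ≤ C := by
  obtain ⟨B, hB⟩ := hA.isBounded.exists_norm_le
  set B' := max B 0
  obtain ⟨k₀, hk₀⟩ := exists_nat_ge B'
  have hcont : ∀ k, ContinuousOn (latticeTerm k) A := by
    intro k z hzA
    refine ContinuousAt.continuousWithinAt ?_
    have h1 : z - ((2 * π * (k + 1) : ℝ) : ℂ) ≠ 0 := by
      have := hz z hzA (k + 1) (by omega)
      rw [sub_ne_zero]
      convert! this using 2
      push_cast; ring
    have h2 : z + ((2 * π * (k + 1) : ℝ) : ℂ) ≠ 0 := by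
      have := hz z hzA (-(k + 1)) (by omega)
      intro h
      refine this ?_
      rw [eq_neg_of_add_eq_zero_left h]
      push_cast; ring
    unfold latticeTerm
    exact (continuousAt_const.div (continuousAt_id.sub continuousAt_const) h1).add
      (continuousAt_const.div (continuousAt_id.add continuousAt_const) h2)
  have hbd : ∀ k, ∃ C, ∀ z ∈ A, ‖latticeTerm k z‖ ≤ C := fun k =>
    hA.exists_bound_of_continuousOn (hcont k)
  choose C hC using hbd
  refine ⟨∑ k ∈ Finset.range k₀, |C k| + 16 * (B' + 1), fun n z hzA => ?_⟩
  have e : partialKernel n z - 1 / z = ∑ k ∈ Finset.range n, latticeTerm k z := by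
    simp [partialKernel]
  rw [e]
  have h1 : ∀ m ≤ k₀, ‖∑ k ∈ Finset.range m, latticeTerm k z‖ ≤ ∑ k ∈ Finset.range k₀, |C k| := by
    intro m hm
    refine (norm_sum_le _ _).trans ((Finset.sum_le_sum fun k _ => (hC k z hzA).trans
      (le_abs_self _)).trans ?_)
    exact Finset.sum_le_sum_of_subset_of_nonneg (Finset.range_mono hm) fun k _ _ => abs_nonneg _
  have hB0 : 0 ≤ B' := le_max_right _ _
  rcases le_or_gt n k₀ with hn | hn
  · have := h1 n hn
    linarith
  · rw [← Finset.sum_range_add_sum_Ico _ hn.le]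
    refine (norm_add_le _ _).trans (add_le_add (h1 k₀ le_rfl) ?_)
    refine norm_sum_latticeTerm_le hB0 ?_ ?_ n
    · have := Real.pi_gt_three
      nlinarith
    · exact ((Complex.abs_re_le_norm z).trans (hB z hzA)).trans (le_max_left _ _)

/-- With σ = 2 sin(z/2) one has cos²(z/2) = 1 − σ²/4, hence |cos(z/2)|² ≤ 1 + |σ|²/4. -/
theorem norm_periodicKernel_sq_le (z : ℂ) :
    ‖periodicKernel z‖ ^ 2 ≤ 1 / ‖2 * Complex.sin (z / 2)‖ ^ 2 + 1 / 4 := by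
  set σ := 2 * Complex.sin (z / 2) with hσ
  rcases eq_or_ne σ 0 with h0 | h0
  · have : periodicKernel z = 0 := by rw [periodicKernel, ← hσ, h0, div_zero]
    rw [this, norm_zero, zero_pow two_ne_zero]; positivity
  have hn : 0 < ‖σ‖ := norm_pos_iff.2 h0
  have h1 : ‖Complex.cos (z / 2)‖ ^ 2 ≤ 1 + ‖σ‖ ^ 2 / 4 := by
    have e : Complex.cos (z / 2) ^ 2 = 1 - σ ^ 2 / 4 := by
      rw [hσ]; linear_combination Complex.sin_sq_add_cos_sq (z / 2)
    rw [← norm_pow, e]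
    refine (norm_sub_le _ _).trans ?_
    simp
  rw [periodicKernel, ← hσ, norm_div, div_pow, div_le_iff₀ (by positivity)]
  refine h1.trans (le_of_eq ?_)
  field_simp

/-- From |sin(a + ib)|² = sin²a + sinh²b, with Jordan's inequality for the sine and |sinh b| ≥ |b|.
-/
theorem norm_two_mul_sin_half_ge {z : ℂ} (hz : |z.re| ≤ π) :
    2 / π * ‖z‖ ≤ ‖2 * Complex.sin (z / 2)‖ := by
  have hpi := Real.pi_pos
  refine le_of_sq_le_sq ?_ (norm_nonneg _)
  set a := z.re / 2 with ha
  set b := z.im / 2 with hb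
  have hsin : Complex.sin (z / 2) = (Real.sin a * Real.cosh b : ℝ) + (Real.cos a * Real.sinh b : ℝ) * I := by
    have : z / 2 = (a : ℂ) + b * I := by
      apply Complex.ext <;> simp [ha, hb]
    rw [this, Complex.sin_add_mul_I]
    push_cast
    ring
  have h1 : ‖Complex.sin (z / 2)‖ ^ 2 = Real.sin a ^ 2 + Real.sinh b ^ 2 := by
    rw [hsin, Complex.sq_norm, Complex.normSq_add_mul_I]
    have := Real.sin_sq_add_cos_sq a
    have h2 := Real.cosh_sq b
    linear_combination Real.sin a ^ 2 * h2 + Real.sinh b ^ 2 * this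
  have h2 : (2 / π * |a|) ^ 2 ≤ Real.sin a ^ 2 := by
    rw [← sq_abs (Real.sin a)]
    refine pow_le_pow_left₀ (by positivity) (Real.mul_abs_le_abs_sin ?_) 2
    rw [ha, abs_div, abs_two]; linarith
  have h3 : b ^ 2 ≤ Real.sinh b ^ 2 := by
    rw [← sq_abs b, ← sq_abs (Real.sinh b), Real.abs_sinh]
    exact pow_le_pow_left₀ (abs_nonneg _) (Real.self_le_sinh_iff.2 (abs_nonneg _)) 2
  have h4 : ‖z‖ ^ 2 = 4 * (a ^ 2 + b ^ 2) := by
    rw [Complex.sq_norm, Complex.normSq_apply, ha, hb]; ring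
  rw [norm_mul, Complex.norm_ofNat, mul_pow, mul_pow, h4, h1]
  rw [mul_pow, sq_abs] at h2
  have h5 : (2 / π) ^ 2 ≤ 1 := by
    have : 2 / π ≤ 1 := by rw [div_le_one hpi]; linarith [Real.pi_gt_three]
    exact pow_le_one₀ (by positivity) this
  nlinarith [sq_nonneg b]

theorem norm_periodicKernel_le {z : ℂ} (hz : |z.re| ≤ π) :
    ‖periodicKernel z‖ ≤ π / 2 * ‖z‖⁻¹ + 1 / 2 := by
  have hpi := Real.pi_pos
  refine le_of_sq_le_sq ?_ (by positivity)
  refine (norm_periodicKernel_sq_le z).trans ?_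
  rcases eq_or_ne z 0 with rfl | h0
  · norm_num
  have hn : 0 < ‖z‖ := norm_pos_iff.2 h0
  have h1 := norm_two_mul_sin_half_ge hz
  have h2 : 1 / ‖2 * Complex.sin (z / 2)‖ ^ 2 ≤ (π / 2 * ‖z‖⁻¹) ^ 2 := by
    have : (π / 2 * ‖z‖⁻¹) ^ 2 = 1 / (2 / π * ‖z‖) ^ 2 := by field_simp
    rw [this]
    gcongr
  have h3 : 0 ≤ π / 2 * ‖z‖⁻¹ := by positivity
  nlinarith

/-! ### The regularised kernel -/

/-- The periodic kernel, cut off at distance `δ` from its poles. -/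
def regKernel (δ : ℝ) (z : ℂ) : ℂ :=
  Real.smoothTransition (Complex.normSq (2 * Complex.sin (z / 2)) / δ ^ 2 - 1) • periodicKernel z

/-- Measuring the distance to the poles by |2 sin(z/2)| instead of |z| makes the cutoff itself
periodic and smooth. -/
theorem regKernel_add_int_mul (δ : ℝ) (z : ℂ) (n : ℤ) :
    regKernel δ (z + ((n * (2 * π) : ℝ) : ℂ)) = regKernel δ z := by
  have hper : Function.Periodic (fun z => Complex.normSq (2 * Complex.sin (z / 2))) (2 * π) := by
    intro z
    simp only
    rw [show (z + 2 * π) / 2 = z / 2 + π by ring, Complex.sin_add_pi, mul_neg, Complex.normSq_neg]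
  have h1 : Complex.normSq (2 * Complex.sin ((z + ((n * (2 * π) : ℝ) : ℂ)) / 2))
      = Complex.normSq (2 * Complex.sin (z / 2)) := by
    have : Complex.normSq (2 * Complex.sin ((z + n * (2 * π)) / 2))
      = Complex.normSq (2 * Complex.sin (z / 2)) := (hper.int_mul n) z
    rw [← this]
    push_cast
    rfl
  rw [regKernel, regKernel, h1, periodicKernel_add_int_mul]

theorem hasDerivAt_two_mul_sin_half (z : ℂ) :
    HasDerivAt (fun z => 2 * Complex.sin (z / 2)) (Complex.cos (z / 2)) z := by
  have h1 : HasDerivAt (fun z : ℂ => z / 2) (1 / 2) z := (hasDerivAt_id z).div_const 2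
  have := ((Complex.hasDerivAt_sin (z / 2)).comp z h1).const_mul 2
  refine this.congr_deriv ?_
  ring

theorem hasFDerivAt_normSq_comp {σ : ℂ → ℂ} {σ' z : ℂ} (h : HasDerivAt σ σ' z) :
    HasFDerivAt (fun z => Complex.normSq (σ z))
      (2 • (Complex.reCLM.comp ((conj (σ z) * σ') • (1 : ℂ →L[ℝ] ℂ)))) z := by
  have h1 := h.complexToReal_fderiv
  have hre : HasFDerivAt (fun z => (σ z).re) (Complex.reCLM.comp (σ' • (1 : ℂ →L[ℝ] ℂ))) z :=
    Complex.reCLM.hasFDerivAt.comp z h1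
  have him : HasFDerivAt (fun z => (σ z).im) (Complex.imCLM.comp (σ' • (1 : ℂ →L[ℝ] ℂ))) z :=
    Complex.imCLM.hasFDerivAt.comp z h1
  have := (hre.mul hre).add (him.mul him)
  refine this.congr_fderiv ?_
  ext v
  simp
  ring

theorem contDiff_two_mul_sin_half : ContDiff ℝ 1 fun z : ℂ => 2 * Complex.sin (z / 2) := by
  have h : ContDiff ℂ 1 fun z : ℂ => 2 * Complex.sin (z / 2) :=
    contDiff_const.mul (Complex.contDiff_sin.comp (contDiff_id.div_const 2))
  exact h.restrict_scalars ℝ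

theorem contDiff_normSq : ContDiff ℝ 1 fun z : ℂ => Complex.normSq z := by
  have : (fun z : ℂ => Complex.normSq z) = fun z => z.re * z.re + z.im * z.im := by
    funext z; exact Complex.normSq_apply z
  rw [this]
  have h1 : ContDiff ℝ 1 fun z : ℂ => z.re := Complex.reCLM.contDiff
  have h2 : ContDiff ℝ 1 fun z : ℂ => z.im := Complex.imCLM.contDiff
  exact (h1.mul h1).add (h2.mul h2)

theorem contDiff_regCutoff (δ : ℝ) : ContDiff ℝ 1 fun z : ℂ =>
    Real.smoothTransition (Complex.normSq (2 * Complex.sin (z / 2)) / δ ^ 2 - 1) := by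
  have h : ContDiff ℝ 1 Real.smoothTransition := Real.smoothTransition.contDiff (n := (1 : ℕ∞))
  exact h.comp (((contDiff_normSq.comp contDiff_two_mul_sin_half).div_const _).sub contDiff_const)

theorem contDiffAt_periodicKernel {z : ℂ} (hz : Complex.sin (z / 2) ≠ 0) :
    ContDiffAt ℂ 1 periodicKernel z := by
  unfold periodicKernel
  have h1 : ContDiff ℂ 1 fun z : ℂ => Complex.cos (z / 2) :=
    Complex.contDiff_cos.comp (contDiff_id.div_const 2)
  have h2 : ContDiff ℂ 1 fun z : ℂ => 2 * Complex.sin (z / 2) :=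
    contDiff_const.mul (Complex.contDiff_sin.comp (contDiff_id.div_const 2))
  exact h1.contDiffAt.div h2.contDiffAt (mul_ne_zero two_ne_zero hz)

theorem regKernel_eventuallyEq_zero (δ : ℝ) {z : ℂ} (hz : Complex.sin (z / 2) = 0) :
    regKernel δ =ᶠ[𝓝 z] fun _ => 0 := by
  have hc : ContinuousAt (fun z : ℂ => Complex.normSq (2 * Complex.sin (z / 2)) / δ ^ 2 - 1) z :=
    ((((contDiff_normSq.comp contDiff_two_mul_sin_half).div_const _).sub
      contDiff_const).continuous).continuousAt
  have h0 : Complex.normSq (2 * Complex.sin (z / 2)) / δ ^ 2 - 1 < 0 := by simp [hz]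
  filter_upwards [hc.eventually (gt_mem_nhds h0)] with w hw
  rw [regKernel, Real.smoothTransition.zero_of_nonpos hw.le, zero_smul]

theorem contDiff_regKernel (δ : ℝ) : ContDiff ℝ 1 (regKernel δ) := by
  rw [contDiff_iff_contDiffAt]
  intro z
  by_cases hz : Complex.sin (z / 2) = 0
  · exact contDiffAt_const.congr_of_eventuallyEq (regKernel_eventuallyEq_zero δ hz)
  · exact (contDiff_regCutoff δ).contDiffAt.smul ((contDiffAt_periodicKernel hz).restrict_scalars ℝ)

/-- The density of `dbar (regKernel δ)`, an approximation of a multiple of Dirac masses. -/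
def regDensity (δ : ℝ) (z : ℂ) : ℝ :=
  stepDeriv (Complex.normSq (2 * Complex.sin (z / 2)) / δ ^ 2 - 1)
    * Complex.normSq (Complex.cos (z / 2)) / δ ^ 2

/-- The kernel is holomorphic off its poles, so ∂̄ falls on the cutoff only. For σ = 2 sin(z/2),
∂̄|σ|² = 2σ·conj(σ') with σ' = cos(z/2); the factor σ cancels the pole of cos(z/2)/σ and leaves
2|cos(z/2)|². -/
theorem dbar_regKernel {δ : ℝ} (hδ : 0 < δ) (z : ℂ) :
    dbar (regKernel δ) z = ((2 * regDensity δ z : ℝ) : ℂ) := by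
  by_cases hz : Complex.sin (z / 2) = 0
  · rw [dbar_congr (regKernel_eventuallyEq_zero δ hz), regDensity, hz,
      stepDeriv_of_nonpos (by simp)]
    simp [dbar]
  set σ := 2 * Complex.sin (z / 2) with hσ
  have hσ0 : σ ≠ 0 := mul_ne_zero two_ne_zero hz
  have hK := contDiffAt_periodicKernel hz
  have hKd : dbar periodicKernel z = 0 :=
    dbar_of_hasDerivAt (hK.differentiableAt one_ne_zero).hasDerivAt
  have h1 : dbar (regKernel δ) z = dbarReal (fun z : ℂ =>
      Real.smoothTransition (Complex.normSq (2 * Complex.sin (z / 2)) / δ ^ 2 - 1)) z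
      * periodicKernel z := by
    have := dbar_smul ((contDiff_regCutoff δ).differentiable one_ne_zero z)
      ((hK.restrict_scalars ℝ).differentiableAt one_ne_zero)
    rw [hKd, mul_zero, add_zero] at this
    exact this
  have h2 := hasFDerivAt_normSq_comp (hasDerivAt_two_mul_sin_half z)
  have h3 : HasFDerivAt (fun z : ℂ =>
      Real.smoothTransition (Complex.normSq (2 * Complex.sin (z / 2)) / δ ^ 2 - 1))
      (stepDeriv (Complex.normSq σ / δ ^ 2 - 1) • (δ ^ 2)⁻¹ •
        (2 • (Complex.reCLM.comp ((conj σ * Complex.cos (z / 2)) • (1 : ℂ →L[ℝ] ℂ))))) z := by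
    have h4 : HasFDerivAt (fun z : ℂ => Complex.normSq (2 * Complex.sin (z / 2)) / δ ^ 2 - 1)
        ((δ ^ 2)⁻¹ •
        (2 • (Complex.reCLM.comp ((conj σ * Complex.cos (z / 2)) • (1 : ℂ →L[ℝ] ℂ))))) z := by
      have := (h2.const_mul (δ ^ 2)⁻¹).sub_const 1
      refine this.congr_of_eventuallyEq (Eventually.of_forall fun w => ?_)
      simp only
      ring
    exact (hasDerivAt_step _).comp_hasFDerivAt z h4
  rw [h1, dbarReal, h3.fderiv, periodicKernel, ← hσ, regDensity, ← hσ]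
  set c := Complex.cos (z / 2)
  set m := stepDeriv (Complex.normSq σ / δ ^ 2 - 1)
  have hδ0 : (δ : ℂ) ≠ 0 := by exact_mod_cast hδ.ne'
  have key : ((conj σ * c).re : ℂ) + I * ((conj σ * c * I).re : ℂ) = σ * conj c := by
    apply Complex.ext <;> simp <;> ring
  have hcc : (Complex.normSq c : ℂ) = conj c * c := Complex.normSq_eq_conj_mul_self
  simp only [_root_.smul_apply, ContinuousLinearMap.comp_apply,
    one_apply_eq_self, Complex.reCLM_apply, smul_eq_mul, mul_one, nsmul_eq_mul]
  push_cast
  rw [hcc]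
  field_simp
  linear_combination (m * c) * key

theorem norm_regKernel_le_periodicKernel (δ : ℝ) (z : ℂ) :
    ‖regKernel δ z‖ ≤ ‖periodicKernel z‖ := by
  rw [regKernel, norm_smul, Real.norm_of_nonneg (Real.smoothTransition.nonneg _)]
  exact mul_le_of_le_one_left (norm_nonneg _) (Real.smoothTransition.le_one _)

/-- The cutoff vanishes unless |2 sin(z/2)| > δ. The bound also holds at large height, where the
kernel does not decay. -/
theorem norm_regKernel_le {δ : ℝ} (hδ : 0 < δ) (z : ℂ) : ‖regKernel δ z‖ ≤ δ⁻¹ + 1 / 2 := by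
  rcases le_or_gt (Complex.normSq (2 * Complex.sin (z / 2)) / δ ^ 2 - 1) 0 with h | h
  · rw [regKernel, Real.smoothTransition.zero_of_nonpos h, zero_smul, norm_zero]
    positivity
  · refine (norm_regKernel_le_periodicKernel δ z).trans (le_of_sq_le_sq ?_ (by positivity))
    refine (norm_periodicKernel_sq_le z).trans ?_
    rw [sub_pos, lt_div_iff₀ (by positivity), one_mul, ← Complex.sq_norm] at h
    have h1 : 1 / ‖2 * Complex.sin (z / 2)‖ ^ 2 ≤ 1 / δ ^ 2 := by gcongr
    have h2 : 1 / δ ^ 2 = (δ⁻¹) ^ 2 := by rw [inv_pow, one_div]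
    have h3 : 0 < δ⁻¹ := by positivity
    nlinarith

/-- For fixed z the cutoff is eventually 1; at the poles both kernels are 0 by the convention for
division. -/
theorem tendsto_regKernel (z : ℂ) :
    Tendsto (fun δ => regKernel δ z) (𝓝[>] 0) (𝓝 (periodicKernel z)) := by
  by_cases hz : Complex.sin (z / 2) = 0
  · have : periodicKernel z = 0 := by simp [periodicKernel, hz]
    simp [regKernel, this]
  · set N := Complex.normSq (2 * Complex.sin (z / 2)) with hN
    have hN0 : 0 < N := Complex.normSq_pos.2 (mul_ne_zero two_ne_zero hz)
    refine tendsto_const_nhds.congr' ?_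
    have h1 : ∀ᶠ δ : ℝ in 𝓝[>] 0, 2 * δ ^ 2 < N := by
      have : Tendsto (fun δ : ℝ => 2 * δ ^ 2) (𝓝[>] 0) (𝓝 (2 * 0 ^ 2)) :=
        ((continuous_const.mul (continuous_pow 2)).tendsto 0).mono_left nhdsWithin_le_nhds
      exact this.eventually (gt_mem_nhds (by simpa using hN0))
    filter_upwards [h1, self_mem_nhdsWithin] with δ h2 h3
    have h3' : 0 < δ := h3
    rw [regKernel, ← hN, Real.smoothTransition.one_of_one_le, one_smul]
    rw [le_sub_iff_add_le, le_div_iff₀ (by positivity)]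
    linarith

section

/-! ### Concentration of the regularised kernel at a boundary point -/

/-- The period cell centred at `x`. -/
def cell (x : ℂ) : Set ℂ := {y | x.re - π ≤ y.re ∧ y.re < x.re + π}

theorem measurableSet_cell (x : ℂ) : MeasurableSet (cell x) :=
  (measurableSet_le measurable_const Complex.measurable_re).inter
    (measurableSet_lt Complex.measurable_re measurable_const)

theorem cell_mem_nhds (x : ℂ) : cell x ∈ 𝓝 x := by
  have ho : IsOpen {y : ℂ | x.re - π < y.re ∧ y.re < x.re + π} :=
    (isOpen_lt continuous_const Complex.continuous_re).inter
      (isOpen_lt Complex.continuous_re continuous_const)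
  refine mem_of_superset (ho.mem_nhds ⟨?_, ?_⟩) fun y hy => ⟨hy.1.le, hy.2⟩ <;>
  linarith [Real.pi_pos]

theorem abs_re_sub_le_of_mem_cell {x y : ℂ} (hy : y ∈ cell x) : |(x - y).re| ≤ π := by
  rw [Complex.sub_re, abs_le]
  constructor <;> linarith [hy.1, hy.2]

/-- In polar coordinates this is 2π∫ r S'(r² − 1) dr for the step S, with primitive S(r² − 1)/2. -/
theorem integral_stepDeriv_norm_sq : ∫ w : ℂ, stepDeriv (‖w‖ ^ 2 - 1) = π := by
  have h1 := integral_fun_norm_addHaar (volume : Measure ℂ) fun r => stepDeriv (r ^ 2 - 1)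
  have hder : ∀ r ∈ Ici (0 : ℝ), HasDerivAt (fun r : ℝ => Real.smoothTransition (r ^ 2 - 1) / 2)
      (r * stepDeriv (r ^ 2 - 1)) r := by
    intro r _
    have h2 : HasDerivAt (fun r : ℝ => r ^ 2 - 1) (2 * r) r := by
      simpa using (hasDerivAt_pow 2 r).sub_const 1
    refine (((hasDerivAt_step _).comp r h2).div_const 2).congr_deriv ?_
    ring
  have hlim : Tendsto (fun r : ℝ => Real.smoothTransition (r ^ 2 - 1) / 2) atTop (𝓝 (1 / 2)) := by
    refine tendsto_const_nhds.congr' ?_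
    filter_upwards [eventually_ge_atTop 2] with r hr
    rw [Real.smoothTransition.one_of_one_le (by nlinarith)]
  have h3 := integral_Ioi_of_hasDerivAt_of_nonneg' hder
    (fun r hr => mul_nonneg (le_of_lt hr) (stepDeriv_nonneg _)) hlim
  have hv : (volume : Measure ℂ).real (Metric.ball 0 1) = π := by
    rw [Measure.real, Complex.volume_ball]
    simp
  rw [h1, hv, Complex.finrank_real_complex]
  simp only [Nat.add_one_sub_one, pow_one, smul_eq_mul, nsmul_eq_mul]
  rw [h3, Real.smoothTransition.zero_of_nonpos (by norm_num)]
  push_cast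
  ring

theorem integrable_stepDeriv_norm_sq : Integrable fun w : ℂ => stepDeriv (‖w‖ ^ 2 - 1) := by
  refine Continuous.integrable_of_hasCompactSupport
    (continuous_stepDeriv.comp (by fun_prop)) ?_
  refine HasCompactSupport.intro (isCompact_closedBall (0 : ℂ) 2) fun w hw => ?_
  refine stepDeriv_of_one_le ?_
  rw [mem_closedBall_zero_iff, not_le] at hw
  nlinarith

/-- Half planes carry half of the mass of an even density. -/
theorem integral_halfPlane_stepDeriv {ℓ : ℂ →L[ℝ] ℝ} (hℓ : ℓ ≠ 0) :
    ∫ w in {w : ℂ | 0 < ℓ w}, stepDeriv (‖w‖ ^ 2 - 1) = π / 2 := by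
  set g : ℂ → ℝ := fun w => stepDeriv (‖w‖ ^ 2 - 1) with hg
  have hpos : MeasurableSet {w : ℂ | 0 < ℓ w} :=
    (isOpen_lt continuous_const ℓ.continuous).measurableSet
  have hneg : MeasurableSet {w : ℂ | ℓ w < 0} :=
    (isOpen_lt ℓ.continuous continuous_const).measurableSet
  have hsym : ∫ w in {w : ℂ | ℓ w < 0}, g w = ∫ w in {w : ℂ | 0 < ℓ w}, g w := by
    have := (Measure.measurePreserving_neg (volume : Measure ℂ)).setIntegral_preimage_emb
      (MeasurableEquiv.neg ℂ).measurableEmbedding g {w : ℂ | 0 < ℓ w}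
    rw [← this]
    have e : (Neg.neg ⁻¹' {w : ℂ | 0 < ℓ w}) = {w : ℂ | ℓ w < 0} := by
      ext w; simp
    rw [e]
    refine setIntegral_congr_fun hneg fun w _ => ?_
    simp [hg]
  have hnull : volume {w : ℂ | ℓ w = 0} = 0 := by
    have := Measure.addHaar_submodule (volume : Measure ℂ) (LinearMap.ker (ℓ : ℂ →ₗ[ℝ] ℝ)) (by
      intro htop
      refine hℓ (ContinuousLinearMap.ext fun w => ?_)
      have : w ∈ LinearMap.ker (ℓ : ℂ →ₗ[ℝ] ℝ) := htop ▸ Submodule.mem_top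
      simpa using this)
    exact this
  have hsplit : ∫ w, g w = (∫ w in {w : ℂ | 0 < ℓ w}, g w) + ∫ w in {w : ℂ | ℓ w < 0}, g w := by
    rw [← integral_add_compl hpos integrable_stepDeriv_norm_sq]
    congr 1
    refine setIntegral_congr_set ?_
    have : ({w : ℂ | 0 < ℓ w}ᶜ : Set ℂ) =ᵐ[volume] {w : ℂ | ℓ w < 0} := by
      have h0 : ∀ᵐ w : ℂ, ℓ w ≠ 0 := by
        rw [ae_iff]; simpa using hnull
      filter_upwards [h0] with w hw
      refine propext ⟨fun h => lt_of_le_of_ne (not_lt.1 h) hw, fun h => not_lt.2 h.le⟩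
    exact this
  rw [hg, integral_stepDeriv_norm_sq, ← hg, hsym] at hsplit
  linarith

variable {s d : ℝ} {ζ : ℝ → ℂ} {Ω : Set ℂ}

namespace IsLeftSide

theorem hasFDerivAt_height (hd : IsTubeWidth ζ d) (h : IsPeriodicCurve s ζ) (α : ℝ) :
    HasFDerivAt (height ζ d) (fderiv ℝ (height ζ d) (ζ α)) (ζ α) := by
  have := hd.contDiffAt_height h (w := α) (by simpa using hd.pos)
  rw [IsPeriodicCurve.tube_ofReal] at this
  exact (this.differentiableAt one_ne_zero).hasFDerivAt

theorem fderiv_height_ne_zero (hd : IsTubeWidth ζ d) (h : IsPeriodicCurve s ζ) (α : ℝ) :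
    fderiv ℝ (height ζ d) (ζ α) ≠ 0 := by
  intro h0
  have h1 := hasFDerivAt_height hd h α
  rw [h0, ← IsPeriodicCurve.tube_ofReal (ζ := ζ) α] at h1
  have h2 := h1.comp (α : ℂ) (h.hasFDerivAt_tube α)
  have h3 : (height ζ d ∘ tube ζ) =ᶠ[𝓝 (α : ℂ)] fun w => w.im := by
    have ho : IsOpen {w : ℂ | |w.im| < d} :=
      isOpen_lt (continuous_abs.comp Complex.continuous_im) continuous_const
    filter_upwards [ho.mem_nhds (by simpa using hd.pos : |(α : ℂ).im| < d)] with w hw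
    exact hd.height_tube hw
  have h4 := h2.unique ((Complex.imCLM.hasFDerivAt).congr_of_eventuallyEq h3)
  have := DFunLike.congr_fun h4 I
  simp at this

theorem eventually_height_ray (hd : IsTubeWidth ζ d) (h : IsPeriodicCurve s ζ)
    (α : ℝ) (w : ℂ) :
    Tendsto (fun δ : ℝ => δ⁻¹ * height ζ d (ζ α + δ * w)) (𝓝[>] 0)
      (𝓝 (fderiv ℝ (height ζ d) (ζ α) w)) := by
  have h0 : height ζ d (ζ α) = 0 := by
    have := hd.height_tube (w := α) (by simpa using hd.pos)
    rwa [IsPeriodicCurve.tube_ofReal, Complex.ofReal_im] at this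
  have h1 : HasDerivAt (fun δ : ℝ => ζ α + δ * w) w 0 := by
    have := ((Complex.ofRealCLM.hasDerivAt (x := (0 : ℝ))).mul_const w).const_add (ζ α)
    simpa using this
  have h2 : HasDerivAt (fun δ : ℝ => height ζ d (ζ α + δ * w))
      (fderiv ℝ (height ζ d) (ζ α) w) 0 := by
    have h3 : HasFDerivAt (height ζ d) (fderiv ℝ (height ζ d) (ζ α)) (ζ α + (0 : ℝ) * w) := by
      simpa using hasFDerivAt_height hd h α
    exact HasFDerivAt.comp_hasDerivAt (l := height ζ d) (f := fun δ : ℝ => ζ α + δ * w) (0 : ℝ) h3 h1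
  simpa [h0] using h2.tendsto_slope_zero_right

theorem eventually_ray_mem_tube (hd : IsTubeWidth ζ d) (h : IsPeriodicCurve s ζ) (α : ℝ) (w : ℂ) :
    ∀ᶠ δ : ℝ in 𝓝[>] 0, ζ α + δ * w ∈ tube ζ '' {w | |w.im| < d} := by
  have := hd.image_mem_nhds h (w := α) (by simpa using hd.pos)
  rw [IsPeriodicCurve.tube_ofReal] at this
  have hc : Tendsto (fun δ : ℝ => ζ α + δ * w) (𝓝[>] 0) (𝓝 (ζ α)) := by
    have : Continuous fun δ : ℝ => ζ α + δ * w := by fun_prop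
    simpa using (this.tendsto 0).mono_left nhdsWithin_le_nhds
  exact hc.eventually this

/-- Seen from a curve point, Ω blows up to the half-plane where the differential of the height is
positive: along a ray the height is δ times that differential to first order. The next lemma treats
the opposite half-plane. -/
theorem eventually_ray_mem (hΩ : IsLeftSide ζ d Ω) (hd : IsTubeWidth ζ d)
    (h : IsPeriodicCurve s ζ) {α : ℝ} {w : ℂ} (hw : 0 < fderiv ℝ (height ζ d) (ζ α) w) :
    ∀ᶠ δ : ℝ in 𝓝[>] 0, ζ α + δ * w ∈ Ω := by
  filter_upwards [(eventually_height_ray hd h α w).eventually (lt_mem_nhds hw),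
    eventually_ray_mem_tube hd h α w, self_mem_nhdsWithin] with δ h1 ⟨q, hq, hqe⟩ h3
  have h3' : (0 : ℝ) < δ := h3
  rw [← hqe, hd.height_tube hq] at h1
  rw [← hqe]
  exact hΩ.left q (pos_of_mul_pos_right h1 (by positivity)) (abs_lt.1 hq).2

theorem eventually_ray_notMem (hΩ : IsLeftSide ζ d Ω) (hd : IsTubeWidth ζ d)
    (h : IsPeriodicCurve s ζ) {α : ℝ} {w : ℂ} (hw : fderiv ℝ (height ζ d) (ζ α) w < 0) :
    ∀ᶠ δ : ℝ in 𝓝[>] 0, ζ α + δ * w ∉ Ω := by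
  filter_upwards [(eventually_height_ray hd h α w).eventually (gt_mem_nhds hw),
    eventually_ray_mem_tube hd h α w, self_mem_nhdsWithin] with δ h1 ⟨q, hq, hqe⟩ h3
  have h3' : (0 : ℝ) < δ := h3
  rw [← hqe, hd.height_tube hq] at h1
  rw [← hqe]
  refine hΩ.right q (abs_lt.1 hq).1 ?_
  by_contra hn
  have : 0 < δ⁻¹ * q.im := mul_pos (by positivity) (not_le.1 hn)
  linarith

end IsLeftSide

/-- The density lives where |2 sin(z/2)|² < 2δ². The lower bound (2/π)|z| for the sine gives |z|² ≤
π²δ²/2 ≤ 9δ², and cos² = 1 − (2 sin)²/4 gives the second estimate. -/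
theorem norm_le_of_stepDeriv_ne_zero {δ : ℝ} (hδ : 0 < δ) {z : ℂ} (hz : |z.re| ≤ π)
    (hne : stepDeriv (Complex.normSq (2 * Complex.sin (z / 2)) / δ ^ 2 - 1) ≠ 0) :
    ‖z‖ ≤ 3 * δ ∧ Complex.normSq (Complex.cos (z / 2)) ≤ 1 + δ ^ 2 / 2 := by
  have hpi := Real.pi_pos
  have h1 : Complex.normSq (2 * Complex.sin (z / 2)) < 2 * δ ^ 2 := by
    by_contra hn
    refine hne (stepDeriv_of_one_le ?_)
    rw [le_sub_iff_add_le, le_div_iff₀ (by positivity)]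
    linarith
  constructor
  · have h2 := norm_two_mul_sin_half_ge hz
    rw [← Complex.sq_norm] at h1
    refine le_of_sq_le_sq ?_ (by positivity)
    have h3 : (2 / π * ‖z‖) ^ 2 ≤ 2 * δ ^ 2 :=
      (pow_le_pow_left₀ (by positivity) h2 2).trans h1.le
    have h4 : (1 / 2 : ℝ) ≤ 2 / π := by
      rw [div_le_div_iff₀ two_pos hpi]; linarith [Real.pi_le_four]
    have h5 : ‖z‖ ^ 2 = (2 / π * ‖z‖) ^ 2 * (π ^ 2 / 4) := by field_simp; norm_num
    have h6 : π ^ 2 / 4 ≤ 3 := by nlinarith [Real.pi_lt_d2]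
    rw [h5]
    calc (2 / π * ‖z‖) ^ 2 * (π ^ 2 / 4) ≤ 2 * δ ^ 2 * 3 :=
          mul_le_mul h3 h6 (by positivity) (by positivity)
      _ ≤ (3 * δ) ^ 2 := by nlinarith [sq_nonneg δ]
  · have e : Complex.cos (z / 2) ^ 2 = 1 - (2 * Complex.sin (z / 2)) ^ 2 / 4 := by
      linear_combination Complex.sin_sq_add_cos_sq (z / 2)
    rw [← Complex.sq_norm] at h1
    rw [← Complex.sq_norm, ← norm_pow, e]
    refine (norm_sub_le _ _).trans ?_
    rw [norm_one, norm_div, norm_pow, Complex.norm_ofNat]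
    linarith

theorem regDensity_eq_zero {δ : ℝ} (hδ : 0 < δ) {z : ℂ} (hz : |z.re| ≤ π) (h : 3 * δ < ‖z‖) :
    regDensity δ z = 0 := by
  by_contra hne
  have : stepDeriv (Complex.normSq (2 * Complex.sin (z / 2)) / δ ^ 2 - 1) ≠ 0 := fun h0 =>
    hne (by rw [regDensity, h0, zero_mul, zero_div])
  exact absurd (norm_le_of_stepDeriv_ne_zero hδ hz this).1 (not_le.2 h)

theorem continuous_regDensity (δ : ℝ) : Continuous (regDensity δ) := by
  unfold regDensity
  have h1 : Continuous fun z : ℂ => Complex.normSq (2 * Complex.sin (z / 2)) :=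
    (contDiff_normSq.comp contDiff_two_mul_sin_half).continuous
  have h2 : Continuous fun z : ℂ => Complex.normSq (Complex.cos (z / 2)) :=
    Complex.continuous_normSq.comp (Complex.continuous_cos.comp (by fun_prop))
  exact ((continuous_stepDeriv.comp ((h1.div_const _).sub continuous_const)).mul h2).div_const _

/-- The regularised densities concentrate, and a smooth boundary point sees half of the mass. -/
theorem IsLeftSide.tendsto_integral_regDensity (hΩ : IsLeftSide ζ d Ω) (h : IsPeriodicCurve s ζ)
    (hd : IsTubeWidth ζ d) {f : ℂ → ℂ} (hf : ContinuousOn f (closure Ω)) (α : ℝ) :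
    Tendsto (fun δ => ∫ y in Ω ∩ cell (ζ α), (regDensity δ (ζ α - y) : ℂ) * f y) (𝓝[>] 0)
      (𝓝 (π / 2 * f (ζ α))) := by
  obtain ⟨CS, hCS0, hCS⟩ := exists_stepDeriv_le
  set x := ζ α with hx
  have hxc : x ∈ closure Ω := hΩ.curve_mem_closure hd h α
  set ℓ := fderiv ℝ (height ζ d) x with hℓ
  have hℓ0 : ℓ ≠ 0 := IsLeftSide.fderiv_height_ne_zero hd h α
  set A := Ω ∩ cell x with hA
  have hAm : MeasurableSet A := hΩ.isOpen.measurableSet.inter (measurableSet_cell x)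
  -- Blow-up y = x + δw at the boundary point; δ² is the area factor and makes the density converge.
  set G : ℝ → ℂ → ℂ := fun δ w =>
    A.indicator (fun y => ((δ ^ 2 * regDensity δ (x - y) : ℝ) : ℂ) * f y) (x + δ * w) with hG
  have hfm : AEStronglyMeasurable (A.indicator f) := by
    rw [aestronglyMeasurable_indicator_iff hAm]
    exact (hf.mono (inter_subset_left.trans subset_closure)).aestronglyMeasurable hAm
  have hscale : ∀ δ : ℝ, 0 < δ →
      ∫ y in A, (regDensity δ (x - y) : ℂ) * f y = ∫ w, G δ w := by
    intro δ hδ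
    have h1 := Measure.integral_comp_smul (volume : Measure ℂ)
      (fun y => A.indicator (fun y => ((δ ^ 2 * regDensity δ (x - y) : ℝ) : ℂ) * f y) (x + y)) δ
    simp only [Complex.real_smul] at h1
    have h2 := integral_add_left_eq_self (μ := (volume : Measure ℂ))
      (fun y => A.indicator (fun y => ((δ ^ 2 * regDensity δ (x - y) : ℝ) : ℂ) * f y) y) x
    have h3 : ∫ y, A.indicator (fun y => ((δ ^ 2 * regDensity δ (x - y) : ℝ) : ℂ) * f y) y
        = (δ : ℂ) ^ 2 * ∫ y in A, (regDensity δ (x - y) : ℂ) * f y := by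
      rw [integral_indicator hAm, ← integral_const_mul]
      refine setIntegral_congr_fun hAm fun y _ => ?_
      push_cast
      ring
    rw [hG]
    simp only
    rw [h1, h2, h3, Complex.finrank_real_complex, abs_of_pos (by positivity)]
    push_cast
    have : (δ : ℂ) ≠ 0 := by exact_mod_cast hδ.ne'
    field_simp
  have hlimint : ∫ w, {w : ℂ | 0 < ℓ w}.indicator
      (fun w => ((stepDeriv (‖w‖ ^ 2 - 1) : ℝ) : ℂ) * f x) w = π / 2 * f x := by
    rw [integral_indicator (isOpen_lt continuous_const ℓ.continuous).measurableSet,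
      integral_mul_const, integral_complex_ofReal, integral_halfPlane_stepDeriv hℓ0]
    push_cast
    ring
  rw [← hlimint]
  have hev : (fun δ => ∫ w, G δ w) =ᶠ[𝓝[>] 0]
      fun δ => ∫ y in A, (regDensity δ (x - y) : ℂ) * f y := by
    filter_upwards [self_mem_nhdsWithin] with δ hδ using (hscale δ hδ).symm
  refine Tendsto.congr' hev ?_
  have hfx : ∀ᶠ y in 𝓝[closure Ω] x, ‖f y‖ < ‖f x‖ + 1 :=
    (hf x hxc).norm.eventually (gt_mem_nhds (lt_add_one _))
  rw [eventually_nhdsWithin_iff, Metric.eventually_nhds_iff_ball] at hfx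
  obtain ⟨r, hr, hfx⟩ := hfx
  have hdens : ∀ δ : ℝ, 0 < δ → ∀ z : ℂ, δ ^ 2 * regDensity δ z
      = stepDeriv (Complex.normSq (2 * Complex.sin (z / 2)) / δ ^ 2 - 1)
        * Complex.normSq (Complex.cos (z / 2)) := by
    intro δ hδ z
    rw [regDensity]
    field_simp
  -- The density is carried by |w| ≤ 3. There stepDeriv ≤ CS, |cos|² ≤ 2 for δ < 1, and |f| ≤ |f x|
  -- + 1 once 3δ is below the radius r of continuity.
  refine tendsto_integral_filter_of_dominated_convergence
    ((Metric.closedBall (0 : ℂ) 3).indicator fun _ => CS * 2 * (‖f x‖ + 1)) ?_ ?_ ?_ ?_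
  · filter_upwards [self_mem_nhdsWithin] with δ hδ
    have hδ' : (0 : ℝ) < δ := hδ
    have h1 : AEStronglyMeasurable
        (A.indicator (fun y => ((δ ^ 2 * regDensity δ (x - y) : ℝ) : ℂ) * f y)) := by
      have e : A.indicator (fun y => ((δ ^ 2 * regDensity δ (x - y) : ℝ) : ℂ) * f y)
          = fun y => ((δ ^ 2 * regDensity δ (x - y) : ℝ) : ℂ) * A.indicator f y := by
        funext y
        by_cases hy : y ∈ A <;> simp [hy]
      rw [e]
      refine Continuous.aestronglyMeasurable ?_ |>.mul hfm
      exact Complex.continuous_ofReal.comp (continuous_const.mul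
        ((continuous_regDensity δ).comp (by fun_prop)))
    have hq : Measure.QuasiMeasurePreserving (fun w : ℂ => x + δ * w) volume volume := by
      have h2 : Measure.QuasiMeasurePreserving (fun w : ℂ => δ • w) volume volume := by
        refine ⟨measurable_const_smul δ, ?_⟩
        rw [Measure.map_addHaar_smul _ hδ'.ne']
        exact Measure.smul_absolutelyContinuous
      have h3 := (measurePreserving_add_left (volume : Measure ℂ) x).quasiMeasurePreserving
      have := h3.comp h2
      simpa [Function.comp_def] using this
    exact h1.comp_quasiMeasurePreserving hq
  · have hsm : ∀ᶠ δ : ℝ in 𝓝[>] 0, δ < min 1 (r / 4) := by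
      filter_upwards [Ioo_mem_nhdsGT (lt_min one_pos (by positivity : 0 < r / 4))] with δ hδ
      exact hδ.2
    filter_upwards [hsm, self_mem_nhdsWithin] with δ hδ1 hδ
    have hδ' : (0 : ℝ) < δ := hδ
    have hδ1' : δ < 1 := hδ1.trans_le (min_le_left _ _)
    have hδ2' : δ < r / 4 := hδ1.trans_le (min_le_right _ _)
    refine ae_of_all _ fun w => ?_
    simp only [hG]
    have hb0 : 0 ≤ CS * 2 * (‖f x‖ + 1) := by positivity
    by_cases hy : x + δ * w ∈ A
    · rw [indicator_of_mem hy]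
      by_cases h0 : stepDeriv (Complex.normSq (2 * Complex.sin ((x - (x + δ * w)) / 2)) / δ ^ 2 - 1)
          = 0
      · rw [hdens δ hδ', h0]
        simp only [zero_mul, Complex.ofReal_zero, norm_zero]
        exact indicator_nonneg (fun _ _ => hb0) _
      · obtain ⟨n1, n2⟩ := norm_le_of_stepDeriv_ne_zero hδ' (abs_re_sub_le_of_mem_cell hy.2) h0
        have n3 : δ * ‖w‖ ≤ 3 * δ := by
          simpa [abs_of_pos hδ'] using n1
        have hw : w ∈ Metric.closedBall (0 : ℂ) 3 := by
          rw [mem_closedBall_zero_iff]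
          nlinarith
        rw [indicator_of_mem hw, hdens δ hδ', norm_mul, Complex.norm_real, norm_mul,
          Real.norm_of_nonneg (stepDeriv_nonneg _), Real.norm_of_nonneg (Complex.normSq_nonneg _)]
        have hfy : ‖f (x + δ * w)‖ ≤ ‖f x‖ + 1 := by
          refine (hfx _ ?_ (subset_closure hy.1)).le
          rw [Metric.mem_ball, dist_eq_norm, add_sub_cancel_left, norm_mul, Complex.norm_real,
            Real.norm_of_nonneg hδ'.le]
          linarith
        have hc2 : Complex.normSq (Complex.cos ((x - (x + δ * w)) / 2)) ≤ 2 := by nlinarith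
        gcongr
        · exact Complex.normSq_nonneg _
        · exact hCS _
    · rw [indicator_of_notMem hy, norm_zero]
      exact indicator_nonneg (fun _ _ => hb0) _
  · rw [integrable_indicator_iff measurableSet_closedBall]
    exact integrableOn_const (measure_closedBall_lt_top.ne) (by exact enorm_ne_top)
  · have hnull : ∀ᵐ w : ℂ, ℓ w ≠ 0 := by
      rw [ae_iff]
      have := Measure.addHaar_submodule (volume : Measure ℂ) (LinearMap.ker (ℓ : ℂ →ₗ[ℝ] ℝ)) (by
        intro htop
        refine hℓ0 (ContinuousLinearMap.ext fun w => ?_)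
        have : w ∈ LinearMap.ker (ℓ : ℂ →ₗ[ℝ] ℝ) := htop ▸ Submodule.mem_top
        simpa using this)
      simp only [not_not]
      exact this
    filter_upwards [hnull] with w hw
    have hray : Tendsto (fun δ : ℝ => x + δ * w) (𝓝[>] 0) (𝓝 x) := by
      have : Continuous fun δ : ℝ => x + δ * w := by fun_prop
      simpa using (this.tendsto 0).mono_left nhdsWithin_le_nhds
    rcases lt_or_gt_of_ne hw with hneg | hpos
    · rw [indicator_of_notMem (by simpa using hneg.le)]
      refine tendsto_const_nhds.congr' ?_
      filter_upwards [hΩ.eventually_ray_notMem hd h hneg] with δ hδ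
      simp only [hG]
      rw [indicator_of_notMem fun hy => hδ hy.1]
    · rw [indicator_of_mem (by simpa using hpos)]
      have hin : ∀ᶠ δ : ℝ in 𝓝[>] 0, x + δ * w ∈ A :=
        (hΩ.eventually_ray_mem hd h hpos).and (hray.eventually (cell_mem_nhds x))
      have l1 : Tendsto (fun δ : ℝ => f (x + δ * w)) (𝓝[>] 0) (𝓝 (f x)) :=
        (hf x hxc).tendsto.comp (tendsto_nhdsWithin_iff.2 ⟨hray,
          hin.mono fun δ hδ => subset_closure hδ.1⟩)
      have l2 : Tendsto (fun δ : ℝ => Complex.normSq (Complex.cos ((x - (x + δ * w)) / 2)))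
          (𝓝[>] 0) (𝓝 1) := by
        have : Continuous fun δ : ℝ => Complex.normSq (Complex.cos ((x - (x + δ * w)) / 2)) :=
          Complex.continuous_normSq.comp (Complex.continuous_cos.comp (by fun_prop))
        simpa using (this.tendsto 0).mono_left nhdsWithin_le_nhds
      -- The periodic distance |2 sin(δw/2)|/δ tends to |w|, so the rescaled densities converge to
      -- the radial profile whose half-plane mass is π/2.
      have l3 : Tendsto (fun δ : ℝ =>
          Complex.normSq (2 * Complex.sin ((x - (x + δ * w)) / 2)) / δ ^ 2)
          (𝓝[>] 0) (𝓝 (‖w‖ ^ 2)) := by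
        have hder : HasDerivAt (fun δ : ℝ => 2 * Complex.sin ((x - (x + δ * w)) / 2)) (-w) 0 := by
          have e1 : HasDerivAt (fun δ : ℝ => x - (x + δ * w)) (-w) 0 := by
            have := (((Complex.ofRealCLM.hasDerivAt (x := (0 : ℝ))).mul_const w).const_add
              x).const_sub x
            simpa using this
          have := (hasDerivAt_two_mul_sin_half (x - (x + (0 : ℝ) * w))).comp (0 : ℝ) e1
          simpa [Function.comp_def] using this
        have h1 := hder.tendsto_slope_zero_right
        have h2 := (Complex.continuous_normSq.tendsto _).comp h1
        rw [Complex.normSq_neg, ← Complex.sq_norm] at h2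
        refine h2.congr fun δ => ?_
        simp [Complex.normSq_mul, div_eq_inv_mul, sq]
      have l4 := (continuous_stepDeriv.tendsto _).comp (l3.sub_const 1)
      have l5 := (Complex.continuous_ofReal.tendsto _).comp (l4.mul l2)
      have l6 := l5.mul l1
      rw [mul_one] at l6
      refine l6.congr' ?_
      filter_upwards [hin, self_mem_nhdsWithin] with δ hδ hδ0
      simp only [hG]
      rw [indicator_of_mem hδ, hdens δ hδ0]
      rfl

end

/-! ### Unfolding integrals over a period -/

/-- Translation by `2π` preserves the set `Ω` in both directions. -/
def IsPeriodicSet (Ω : Set ℂ) : Prop := ∀ n : ℤ, ∀ y ∈ Ω, y + ((n * (2 * π) : ℝ) : ℂ) ∈ Ω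

theorem IsPeriodicSet.add_mem_iff {Ω : Set ℂ} (hp : IsPeriodicSet Ω) (n : ℤ) (y : ℂ) :
    y + ((n * (2 * π) : ℝ) : ℂ) ∈ Ω ↔ y ∈ Ω := by
  refine ⟨fun h => ?_, hp n y⟩
  have := hp (-n) _ h
  convert! this using 1
  push_cast
  ring

/-- Periodicity of f is assumed on Ω only. Negative multiples are obtained by stepping forward from
the translated point, which is again in Ω. -/
theorem IsPeriodicSet.add_int_mul {Ω : Set ℂ} (hp : IsPeriodicSet Ω) {β : Type*} {f : ℂ → β}
    (hf : ∀ y ∈ Ω, f (y + ((2 * π : ℝ) : ℂ)) = f y) (n : ℤ) {y : ℂ} (hy : y ∈ Ω) :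
    f (y + ((n * (2 * π) : ℝ) : ℂ)) = f y := by
  have hnat : ∀ (m : ℕ), ∀ y ∈ Ω, f (y + ((m * (2 * π) : ℝ) : ℂ)) = f y := by
    intro m
    induction m with
    | zero => simp
    | succ m ih =>
      intro y hy
      have h1 := hf _ (hp m y hy)
      rw [Int.cast_natCast, ih y hy] at h1
      rw [← h1]
      congr 1
      push_cast
      ring
  obtain ⟨m, rfl | rfl⟩ := n.eq_nat_or_neg
  · exact_mod_cast hnat m y hy
  · have := hnat m _ (hp (-m) y hy)
    rw [← this]
    congr 1
    push_cast
    ring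

/-- A smooth bump on two periods whose translates sum to `1`. -/
def unfoldCutoff (c t : ℝ) : ℝ :=
  Real.smoothTransition ((t - c) / (2 * π) + 1) - Real.smoothTransition ((t - c) / (2 * π))

/-- The derivative of `unfoldCutoff`. -/
def unfoldDeriv (c t : ℝ) : ℝ :=
  (stepDeriv ((t - c) / (2 * π) + 1) - stepDeriv ((t - c) / (2 * π))) / (2 * π)

theorem hasDerivAt_unfoldCutoff (c t : ℝ) :
    HasDerivAt (unfoldCutoff c) (unfoldDeriv c t) t := by
  have h1 : HasDerivAt (fun t => (t - c) / (2 * π)) (1 / (2 * π)) t :=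
    ((hasDerivAt_id t).sub_const c).div_const _
  have h2 := (hasDerivAt_step _).comp t (h1.add_const 1)
  have h3 := (hasDerivAt_step _).comp t h1
  refine (h2.sub h3).congr_deriv ?_
  rw [unfoldDeriv]
  ring

theorem contDiff_unfoldCutoff (c : ℝ) : ContDiff ℝ 1 (unfoldCutoff c) := by
  have h : ContDiff ℝ 1 Real.smoothTransition := Real.smoothTransition.contDiff (n := (1 : ℕ∞))
  have h1 : ContDiff ℝ 1 fun t : ℝ => (t - c) / (2 * π) :=
    (contDiff_id.sub contDiff_const).div_const _
  exact (h.comp (h1.add contDiff_const)).sub (h.comp h1)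

theorem continuous_unfoldDeriv (c : ℝ) : Continuous (unfoldDeriv c) := by
  unfold unfoldDeriv
  exact ((continuous_stepDeriv.comp (by fun_prop)).sub
    (continuous_stepDeriv.comp (by fun_prop))).div_const _

theorem unfold_vanish {c t : ℝ} (ht : t ∉ Ico (c - 2 * π) (c + 2 * π)) :
    unfoldCutoff c t = 0 ∧ unfoldDeriv c t = 0 := by
  have hp := Real.two_pi_pos
  rw [unfoldCutoff, unfoldDeriv]
  rcases lt_or_ge t (c - 2 * π) with h | h
  · have h1 : (t - c) / (2 * π) ≤ -1 := by rw [div_le_iff₀ hp]; linarith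
    rw [Real.smoothTransition.zero_of_nonpos (by linarith),
      Real.smoothTransition.zero_of_nonpos (by linarith), stepDeriv_of_nonpos (by linarith),
      stepDeriv_of_nonpos (by linarith)]
    simp
  · have h2 : c + 2 * π ≤ t := by
      by_contra hn
      exact ht ⟨h, not_le.1 hn⟩
    have h1 : 1 ≤ (t - c) / (2 * π) := by rw [le_div_iff₀ hp]; linarith
    rw [Real.smoothTransition.one_of_one_le (by linarith),
      Real.smoothTransition.one_of_one_le (by linarith), stepDeriv_of_one_le (by linarith),
      stepDeriv_of_one_le (by linarith)]
    simp

/-- The translates telescope: S(τ + 1) − S(τ) plus S(τ) − S(τ − 1) is 1 − 0 for the step S and τ in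
[0, 1]. -/
theorem unfold_add {c t : ℝ} (ht : t ∈ Ico c (c + 2 * π)) :
    unfoldCutoff c t + unfoldCutoff c (t - 2 * π) = 1 ∧
      unfoldDeriv c t + unfoldDeriv c (t - 2 * π) = 0 := by
  have hp := Real.two_pi_pos
  have e : (t - 2 * π - c) / (2 * π) = (t - c) / (2 * π) - 1 := by field_simp; ring
  have h0 : 0 ≤ (t - c) / (2 * π) := div_nonneg (by linarith [ht.1]) hp.le
  have h1 : (t - c) / (2 * π) ≤ 1 := by rw [div_le_one hp]; linarith [ht.2]
  simp only [unfoldCutoff, unfoldDeriv, e, sub_add_cancel]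
  rw [Real.smoothTransition.one_of_one_le (by linarith),
      Real.smoothTransition.zero_of_nonpos (x := (t - c) / (2 * π) - 1) (by linarith),
      stepDeriv_of_one_le (r := (t - c) / (2 * π) + 1) (by linarith),
      stepDeriv_of_nonpos (r := (t - c) / (2 * π) - 1) (by linarith)]
  constructor
  · ring
  · ring

/-- The support of χ covers two periods; translating the left one onto the cell adds the two values
of χ. -/
theorem setIntegral_unfold {Ω : Set ℂ} (hm : MeasurableSet Ω) (hp : IsPeriodicSet Ω) {G : ℂ → ℂ}
    (hG : ∀ y ∈ Ω, G (y + ((2 * π : ℝ) : ℂ)) = G y) (x : ℂ) {χ : ℝ → ℝ}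
    (hχ : ∀ t ∉ Ico (x.re - π - 2 * π) (x.re - π + 2 * π), χ t = 0)
    (hi : IntegrableOn (fun y => (χ y.re : ℂ) * G y) Ω) :
    ∫ y in Ω, (χ y.re : ℂ) * G y
      = ∫ y in Ω ∩ cell x, ((χ y.re + χ (y.re - 2 * π) : ℝ) : ℂ) * G y := by
  set L : Set ℂ := Ω ∩ {y | x.re - π - 2 * π ≤ y.re ∧ y.re < x.re - π} with hL
  have hLm : MeasurableSet L := hm.inter ((measurableSet_le measurable_const
    Complex.measurable_re).inter (measurableSet_lt Complex.measurable_re measurable_const))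
  have hRm : MeasurableSet (Ω ∩ cell x) := hm.inter (measurableSet_cell x)
  set e : ℂ → ℂ := fun y => y + ((((-1 : ℤ) : ℝ) * (2 * π) : ℝ) : ℂ) with he
  have hemp : MeasurePreserving e volume volume := measurePreserving_add_right _ _
  have heemb : MeasurableEmbedding e := measurableEmbedding_addRight _
  have hpre : e ⁻¹' L = Ω ∩ cell x := by
    ext y
    simp only [mem_preimage, hL, mem_inter_iff, he, hp.add_mem_iff, cell]
    refine and_congr_right fun _ => ?_
    simp only [Complex.add_re, Complex.ofReal_re, mem_ofPred]
    push_cast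
    constructor <;> rintro ⟨h1, h2⟩ <;> constructor <;> linarith
  have hLR : ∫ y in L, (χ y.re : ℂ) * G y
      = ∫ y in Ω ∩ cell x, (χ (y.re - 2 * π) : ℂ) * G y := by
    rw [← hemp.setIntegral_preimage_emb heemb, hpre]
    refine setIntegral_congr_fun hRm fun y hy => ?_
    have h1 : G (e y) = G y := hp.add_int_mul hG (-1) hy.1
    have h2 : (e y).re = y.re - 2 * π := by
      simp only [he, Complex.add_re, Complex.ofReal_re]; push_cast; ring
    simp only [h1, h2]
  have hLi : IntegrableOn (fun y => (χ (y.re - 2 * π) : ℂ) * G y) (Ω ∩ cell x) := by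
    have := (hemp.integrableOn_comp_preimage heemb).2 (hi.mono_set (inter_subset_left : L ⊆ Ω))
    rw [hpre] at this
    refine this.congr_fun (fun y hy => ?_) hRm
    have h1 : G (e y) = G y := hp.add_int_mul hG (-1) hy.1
    have h2 : (e y).re = y.re - 2 * π := by
      simp only [he, Complex.add_re, Complex.ofReal_re]; push_cast; ring
    simp only [Function.comp, h1, h2]
  have hdisj : Disjoint L (Ω ∩ cell x) := by
    rw [disjoint_left]
    rintro y ⟨-, -, h1⟩ ⟨-, h2, -⟩
    exact absurd h1 (not_lt.2 h2)
  have hout : ∀ y ∈ Ω \ (L ∪ Ω ∩ cell x), (χ y.re : ℂ) * G y = 0 := by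
    rintro y ⟨hy, hn⟩
    have : χ y.re = 0 := by
      refine hχ _ fun ht => hn ?_
      rcases lt_or_ge y.re (x.re - π) with h | h
      · exact Or.inl ⟨hy, ht.1, h⟩
      · exact Or.inr ⟨hy, h, by linarith [ht.2]⟩
    simp [this]
  have hres : ∫ y in Ω, (χ y.re : ℂ) * G y = ∫ y in L ∪ Ω ∩ cell x, (χ y.re : ℂ) * G y :=
    setIntegral_eq_of_subset_of_forall_sdiff_eq_zero hm
      (union_subset inter_subset_left inter_subset_left) hout
  rw [hres, setIntegral_union hdisj hRm (hi.mono_set inter_subset_left) (hi.mono_set inter_subset_left),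
    hLR, add_comm, ← integral_add (hi.mono_set inter_subset_left) hLi]
  refine setIntegral_congr_fun hRm fun y _ => ?_
  push_cast
  ring

/-- With A = S((Re ζ − c)/2π) g for the step S, the integrand is A(β + 2π) − A(β). Since A vanishes
far to the left and equals g far to the right, one period of g remains. -/
theorem integral_curve_unfold_aux {ζ : ℝ → ℂ} (h : IsPeriodicCurve 1 ζ) {g : ℝ → ℂ}
    (hg : Continuous g) (hgp : Function.Periodic g (2 * π)) (c α : ℝ) :
    ∫ β, (unfoldCutoff c (ζ β).re : ℂ) * g β = ∫ β in (α - π)..(α + π), g β := by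
  have hp := Real.two_pi_pos
  obtain ⟨C, hC0, hC⟩ := h.exists_abs_re_sub_le
  set A : ℝ → ℂ := fun β => (Real.smoothTransition (((ζ β).re - c) / (2 * π)) : ℂ) * g β with hA
  have hAc : Continuous A := by
    refine Continuous.mul (Complex.continuous_ofReal.comp
      (Real.smoothTransition.continuous.comp ?_)) hg
    exact ((Complex.continuous_re.comp h.continuous).sub continuous_const).div_const _
  have hper : ∀ β, (unfoldCutoff c (ζ β).re : ℂ) * g β = A (β + 2 * π) - A β := by
    intro β
    have h1 : (ζ (β + 2 * π)).re = (ζ β).re + 2 * π := by rw [h.periodic]; simp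
    have h2 : ((ζ β).re + 2 * π - c) / (2 * π) = ((ζ β).re - c) / (2 * π) + 1 := by
      field_simp; ring
    simp only [hA, h1, hgp β, h2, unfoldCutoff]
    push_cast
    ring
  set L : ℝ := C + |c| + 6 * π with hL
  have hsupp : Function.support (fun β => (unfoldCutoff c (ζ β).re : ℂ) * g β) ⊆ Ioc (-L) L := by
    intro β hβ
    by_contra hn
    refine hβ ?_
    have h1 := abs_le.1 (hC β)
    have : (ζ β).re ∉ Ico (c - 2 * π) (c + 2 * π) := by
      rintro ⟨h2, h3⟩
      refine hn ⟨?_, ?_⟩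
      · linarith [neg_abs_le c]
      · linarith [le_abs_self c]
    simp [(unfold_vanish this).1]
  rw [← intervalIntegral.integral_eq_integral_of_support_subset hsupp]
  simp only [hper]
  have hi : ∀ a b : ℝ, IntervalIntegrable A volume a b := fun a b => hAc.intervalIntegrable a b
  have hs : IntervalIntegrable (fun β => A (β + 2 * π)) volume (-L) L :=
    (hAc.comp (by fun_prop)).intervalIntegrable _ _
  rw [intervalIntegral.integral_sub hs (hi _ _),
    intervalIntegral.integral_comp_add_right (fun β => A β) (2 * π),
    ← intervalIntegral.integral_add_adjacent_intervals (hi (-L + 2 * π) L) (hi L (L + 2 * π)),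
    ← intervalIntegral.integral_add_adjacent_intervals (hi (-L) (-L + 2 * π)) (hi (-L + 2 * π) L)]
  have h1 : ∫ β in (-L)..(-L + 2 * π), A β = 0 := by
    rw [intervalIntegral.integral_congr (g := fun _ => (0 : ℂ)), intervalIntegral.integral_zero]
    intro β hβ
    rw [uIcc_of_le (by linarith)] at hβ
    have h2 := abs_le.1 (hC β)
    have : Real.smoothTransition (((ζ β).re - c) / (2 * π)) = 0 := by
      refine Real.smoothTransition.zero_of_nonpos (div_nonpos_of_nonpos_of_nonneg ?_ hp.le)
      linarith [hβ.2, neg_abs_le c]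
    simp [hA, this]
  have h2 : ∫ β in L..(L + 2 * π), A β = ∫ β in L..(L + 2 * π), g β := by
    refine intervalIntegral.integral_congr fun β hβ => ?_
    rw [uIcc_of_le (by linarith)] at hβ
    have h2 := abs_le.1 (hC β)
    have : Real.smoothTransition (((ζ β).re - c) / (2 * π)) = 1 := by
      refine Real.smoothTransition.one_of_one_le ?_
      rw [le_div_iff₀ hp]
      linarith [hβ.1, le_abs_self c]
    simp [hA, this]
  have h3 := hgp.intervalIntegral_add_eq L (α - π)
  rw [show α - π + 2 * π = α + π by ring] at h3
  rw [h1, h2, h3]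
  ring

/-- Reversing the parameter changes neither integral and reduces s = −1 to s = 1. -/
theorem integral_curve_unfold {s : ℝ} {ζ : ℝ → ℂ} (h : IsPeriodicCurve s ζ) {g : ℝ → ℂ}
    (hg : Continuous g) (hgp : Function.Periodic g (2 * π)) (c α : ℝ) :
    ∫ β, (unfoldCutoff c (ζ β).re : ℂ) * g β = ∫ β in (α - π)..(α + π), g β := by
  rcases h.orientation with rfl | rfl
  · exact integral_curve_unfold_aux h hg hgp c α
  · have hr : IsPeriodicCurve 1 (reverse ζ) := by simpa using h.reverse
    have hgn : Function.Periodic (fun β => g (-β)) (2 * π) := by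
      intro β
      have := hgp.neg (-β)
      show g (-(β + 2 * π)) = g (-β)
      rw [← this]
      congr 1
      ring
    have h1 := integral_curve_unfold_aux hr (hg.comp continuous_neg) hgn c (-α)
    rw [← integral_neg_eq_self (fun β => (unfoldCutoff c (ζ β).re : ℂ) * g β)]
    refine h1.trans ?_
    show ∫ β in (-α - π)..(-α + π), g (-β) = _
    rw [intervalIntegral.integral_comp_neg (fun β => g β)]
    congr 1 <;> ring

section

/-! ### The regularised Cauchy integral of a periodic function -/

theorem volume_cell_inter_im (x : ℂ) (S : Set ℝ) :
    volume (cell x ∩ {y | y.im ∈ S}) = ENNReal.ofReal (2 * π) * volume S := by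
  have h := Complex.volume_preserving_equiv_real_prod.measure_preimage_equiv
    (Ico (x.re - π) (x.re + π) ×ˢ S)
  rw [Measure.volume_eq_prod, Measure.prod_prod, Real.volume_Ico] at h
  have e : x.re + π - (x.re - π) = 2 * π := by ring
  rw [e] at h
  rw [← h]
  rfl

theorem exists_abs_plateauDeriv_le : ∃ C, 0 ≤ C ∧ ∀ M t, |plateauDeriv M t| ≤ C := by
  obtain ⟨C, hC0, hC⟩ := exists_stepDeriv_le
  refine ⟨C + C, by positivity, fun M t => ?_⟩
  rw [plateauDeriv]
  refine (abs_add_le _ _).trans (add_le_add ?_ ?_)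
  · rw [abs_mul, abs_neg, abs_of_nonneg (stepDeriv_nonneg _),
      abs_of_nonneg (Real.smoothTransition.nonneg _)]
    exact (mul_le_of_le_one_right (stepDeriv_nonneg _) (Real.smoothTransition.le_one _)).trans
      (hC _)
  · rw [abs_mul, abs_of_nonneg (stepDeriv_nonneg _),
      abs_of_nonneg (Real.smoothTransition.nonneg _)]
    exact (mul_le_of_le_one_left (stepDeriv_nonneg _) (Real.smoothTransition.le_one _)).trans
      (hC _)

theorem plateauDeriv_of_le_abs {M t : ℝ} (h : M + 1 ≤ |t|) : plateauDeriv M t = 0 := by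
  rw [plateauDeriv]
  rcases le_abs.1 h with h1 | h1
  · rw [Real.smoothTransition.zero_of_nonpos (x := M + 1 - t) (by linarith),
      stepDeriv_of_nonpos (r := M + 1 - t) (by linarith)]
    ring
  · rw [Real.smoothTransition.zero_of_nonpos (x := M + 1 + t) (by linarith),
      stepDeriv_of_nonpos (r := M + 1 + t) (by linarith)]
    ring

theorem continuous_plateauDeriv (M : ℝ) : Continuous (plateauDeriv M) := by
  unfold plateauDeriv
  have h : Continuous Real.smoothTransition := Real.smoothTransition.continuous
  have h' := continuous_stepDeriv
  exact ((h'.comp (by fun_prop)).neg.mul (h.comp (by fun_prop))).add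
    ((h.comp (by fun_prop)).mul (h'.comp (by fun_prop)))

variable {s d : ℝ} {ζ : ℝ → ℂ} {Ω : Set ℂ}

theorem IsPeriodicCurve.periodic_comp (h : IsPeriodicCurve s ζ) {D : Set ℂ} {β : Type*}
    {G : ℂ → β} (hζD : ∀ a, ζ a ∈ D) (hG : ∀ y ∈ D, G (y + ((2 * π : ℝ) : ℂ)) = G y) :
    Function.Periodic (fun a => G (ζ a)) (2 * π) := by
  intro a
  have h1 := h.periodic a
  rcases h.orientation with rfl | rfl
  · have : ζ (a + 2 * π) = ζ a + ((2 * π : ℝ) : ℂ) := by rw [h1]; push_cast; ring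
    show G (ζ (a + 2 * π)) = G (ζ a)
    rw [this, hG _ (hζD a)]
  · have : ζ a = ζ (a + 2 * π) + ((2 * π : ℝ) : ℂ) := by rw [h1]; push_cast; ring
    show G (ζ (a + 2 * π)) = G (ζ a)
    rw [this, hG _ (hζD _)]

theorem IsPeriodicSet.dbar_add {G : ℂ → ℂ} (ho : IsOpen Ω)
    (hG : ∀ y ∈ Ω, G (y + ((2 * π : ℝ) : ℂ)) = G y) {y : ℂ} (hy : y ∈ Ω) :
    dbar G (y + ((2 * π : ℝ) : ℂ)) = dbar G y := by
  have h1 : (fun w => G (w + ((2 * π : ℝ) : ℂ))) =ᶠ[𝓝 y] G := by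
    filter_upwards [ho.mem_nhds hy] with w hw using hG w hw
  rw [← dbar_congr h1]
  simp only [dbar, fderiv_comp_add_right]

/-- Green's formula over a period. -/
theorem IsLeftSide.integral_period_eq (hΩ : IsLeftSide ζ d Ω) (h : IsPeriodicCurve s ζ)
    (hd : IsTubeWidth ζ d) (hp : IsPeriodicSet Ω) {G : ℂ → ℂ} (hG : ContDiffOn ℝ 1 G (closure Ω))
    (hGp : ∀ y ∈ closure Ω, G (y + ((2 * π : ℝ) : ℂ)) = G y) {B : ℝ}
    (hB : ∀ y : ℂ, B ≤ |y.im| → G y = 0) (x : ℂ) (α : ℝ) :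
    ∫ β in (α - π)..(α + π), G (ζ β) * deriv ζ β = I * ∫ y in Ω ∩ cell x, dbar G y := by
  set c := x.re - π with hc
  have hΩm : MeasurableSet Ω := hΩ.isOpen.measurableSet
  set χ : ℂ → ℝ := fun y => unfoldCutoff c y.re with hχ
  have hχs : ContDiff ℝ 1 χ := (contDiff_unfoldCutoff c).comp Complex.reCLM.contDiff
  set F : ℂ → ℂ := fun y => χ y • G y with hF
  have hFs : ContDiffOn ℝ 1 F (closure Ω) := hχs.contDiffOn.smul hG
  set K : Set ℂ := Icc (c - 2 * π) (c + 2 * π) ×ℂ Icc (-B) B with hK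
  have hKc : IsCompact K := isCompact_Icc.reProdIm isCompact_Icc
  have hout : ∀ y, y ∉ K → y.re ∉ Ico (c - 2 * π) (c + 2 * π) ∨ B < |y.im| := by
    intro y hy
    by_contra! hn
    refine hy ⟨⟨hn.1.1, hn.1.2.le⟩, abs_le.1 hn.2⟩
  have hFc : HasCompactSupport F := by
    refine HasCompactSupport.intro hKc fun y hy => ?_
    rcases hout y hy with h1 | h1
    · simp [hF, hχ, (unfold_vanish h1).1]
    · simp [hF, hB y h1.le]
  have hG' : ∀ y : ℂ, B < |y.im| → dbar G y = 0 := by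
    intro y hy
    have h1 : G =ᶠ[𝓝 y] fun _ => 0 := by
      filter_upwards [(isOpen_lt continuous_const
        (continuous_abs.comp Complex.continuous_im)).mem_nhds hy] with w hw using hB w hw.le
    rw [dbar_congr h1]
    simp [dbar]
  have hζ : ∀ a, ζ a ∈ closure Ω := hΩ.curve_mem_closure hd h
  have hGζ : Continuous fun a => G (ζ a) :=
    hG.continuousOn.comp_continuous h.continuous hζ
  have hgreen := hΩ.integral_curve_eq h hd hFs hFc
  have hlhs : ∫ a, F (ζ a) * deriv ζ a = ∫ β in (α - π)..(α + π), G (ζ β) * deriv ζ β := by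
    have h1 : Function.Periodic (fun a => G (ζ a) * deriv ζ a) (2 * π) :=
      (h.periodic_comp hζ hGp).mul h.deriv_periodic
    rw [← integral_curve_unfold h (g := fun a => G (ζ a) * deriv ζ a)
      (hGζ.mul h.continuous_deriv) h1 c α]
    refine integral_congr_ae (ae_of_all _ fun a => ?_)
    simp only [hF, hχ, Complex.real_smul, mul_assoc]
  rw [← hlhs, hgreen]
  congr 1
  have hGcont : ContinuousOn G Ω := hG.continuousOn.mono subset_closure
  have hGd : ∀ y ∈ Ω, DifferentiableAt ℝ G y := fun y hy =>
    (hG.contDiffAt (mem_of_superset (hΩ.isOpen.mem_nhds hy) subset_closure)).differentiableAt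
      one_ne_zero
  have hdF : ∀ y ∈ Ω, dbar F y = (unfoldDeriv c y.re : ℂ) * G y + (χ y : ℂ) * dbar G y := by
    intro y hy
    rw [hF, dbar_smul (hχs.differentiable one_ne_zero y) (hGd y hy)]
    congr 2
    exact dbarReal_comp_re (hasDerivAt_unfoldCutoff c y.re)
  have hi1 : IntegrableOn (fun y : ℂ => (unfoldDeriv c y.re : ℂ) * G y) Ω := by
    have h1 : IntegrableOn (fun y : ℂ => (unfoldDeriv c y.re : ℂ) * G y) (closure Ω ∩ K) := by
      refine ContinuousOn.integrableOn_compact (hKc.inter_left isClosed_closure) ?_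
      refine ContinuousOn.mul (Continuous.continuousOn ?_)
        (hG.continuousOn.mono inter_subset_left)
      exact Complex.continuous_ofReal.comp
        ((continuous_unfoldDeriv c).comp Complex.continuous_re)
    refine (h1.mono_set (inter_subset_inter_left _ subset_closure)).of_forall_sdiff_eq_zero hΩm
      fun y hy => ?_
    rcases hout y fun hk => hy.2 ⟨hy.1, hk⟩ with h2 | h2
    · simp [(unfold_vanish h2).2]
    · simp [hB y h2.le]
  have hi2 : IntegrableOn (fun y : ℂ => (χ y : ℂ) * dbar G y) Ω := by
    have h1 : IntegrableOn (fun y : ℂ => (χ y : ℂ) * dbar G y) (Ω ∩ K) := by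
      refine (integrableOn_dbar_of_contDiffOn_closure hΩ.isOpen hG hKc).continuousOn_mul_of_subset
        (K := K) (Complex.continuous_ofReal.comp hχs.continuous).continuousOn
        hKc (hΩm.inter hKc.measurableSet) inter_subset_right
    refine h1.of_forall_sdiff_eq_zero hΩm fun y hy => ?_
    rcases hout y fun hk => hy.2 ⟨hy.1, hk⟩ with h2 | h2
    · simp [hχ, (unfold_vanish h2).1]
    · simp [hG' y h2]
  have hcell : ∀ y ∈ Ω ∩ cell x, y.re ∈ Ico c (c + 2 * π) := fun y hy =>
    ⟨hy.2.1, by linarith [hy.2.2]⟩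
  have hm := hΩm.inter (measurableSet_cell x)
  -- After unfolding, the translates of the cutoff's derivative add up to 0 and those of the cutoff
  -- to 1: the localisation leaves no trace.
  have e1 : ∫ y in Ω, (unfoldDeriv c y.re : ℂ) * G y = 0 := by
    rw [setIntegral_unfold hΩm hp (fun y hy => hGp y (subset_closure hy)) x
      (fun t ht => (unfold_vanish ht).2) hi1]
    refine setIntegral_eq_zero_of_forall_eq_zero fun y hy => ?_
    rw [(unfold_add (hcell y hy)).2, Complex.ofReal_zero, zero_mul]
  have e2 : ∫ y in Ω, (χ y : ℂ) * dbar G y = ∫ y in Ω ∩ cell x, dbar G y := by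
    rw [setIntegral_unfold hΩm hp
      (fun y hy => IsPeriodicSet.dbar_add hΩ.isOpen (fun w hw => hGp w (subset_closure hw)) hy) x
      (fun t ht => (unfold_vanish ht).1) hi2]
    refine setIntegral_congr_fun hm fun y hy => ?_
    show ((unfoldCutoff c y.re + unfoldCutoff c (y.re - 2 * π) : ℝ) : ℂ) * dbar G y = _
    rw [(unfold_add (hcell y hy)).1, Complex.ofReal_one, one_mul]
  rw [setIntegral_congr_fun hΩm hdF, integral_add hi1 hi2, e1, e2, zero_add]

end

section

/-! ### The Plemelj formula for the regularised kernel -/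

/-- In polar coordinates the area element r dr cancels the singularity. -/
theorem integrableOn_inv_norm_ball (x : ℂ) (r : ℝ) :
    IntegrableOn (fun y : ℂ => ‖x - y‖⁻¹) (Metric.ball x r) := by
  have h1 : IntegrableOn (fun y : ℂ => ‖y‖⁻¹) (Metric.ball (0 : ℂ) r) := by
    rw [integrableOn_fun_norm_addHaar (volume : Measure ℂ) (f := fun t : ℝ => t⁻¹)]
    refine IntegrableOn.congr_fun (f := fun _ => (1 : ℝ)) ?_ (fun t ht => ?_) measurableSet_Ioo
    · exact integrableOn_const (by simp) (by simp)
    · simp [Complex.finrank_real_complex, ht.1.ne']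
  have h2 := (Measure.measurePreserving_sub_left (volume : Measure ℂ) x).integrableOn_comp_preimage
    (Homeomorph.subLeft x).measurableEmbedding (f := fun y : ℂ => ‖y‖⁻¹) (s := Metric.ball (0 : ℂ) r)
  have e : (fun y => x - y) ⁻¹' Metric.ball (0 : ℂ) r = Metric.ball x r := by
    ext y
    simp [dist_eq_norm, norm_sub_rev]
  rw [e] at h2
  exact h2.2 h1

/-- The Newtonian kernel is integrable against an integrable function that is bounded near the
singularity. -/
theorem integrableOn_inv_norm_mul {A : Set ℂ} (hA : MeasurableSet A) {g : ℂ → ℂ} {x : ℂ}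
    (hg : IntegrableOn g A) (hb : ∃ C, ∀ᶠ y in 𝓝[A] x, ‖g y‖ ≤ C) :
    IntegrableOn (fun y => ‖x - y‖⁻¹ * ‖g y‖) A := by
  obtain ⟨C, hC⟩ := hb
  rw [eventually_nhdsWithin_iff, Metric.eventually_nhds_iff_ball] at hC
  obtain ⟨r, hr, hC⟩ := hC
  have hmeas : Measurable fun y : ℂ => ‖x - y‖⁻¹ := by fun_prop
  rw [← inter_union_sdiff A (Metric.ball x r)]
  refine IntegrableOn.union ?_ ?_
  · refine Integrable.mono' (g := fun y => ‖x - y‖⁻¹ * C)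
      (((integrableOn_inv_norm_ball x r).mono_set inter_subset_right).mul_const C)
      (hmeas.aestronglyMeasurable.mul (hg.mono_set inter_subset_left).1.norm) ?_
    filter_upwards [ae_restrict_mem (hA.inter measurableSet_ball)] with y hy
    rw [Real.norm_of_nonneg (by positivity)]
    gcongr
    exact hC y hy.2 hy.1
  · refine Integrable.mono' (g := fun y => r⁻¹ * ‖g y‖)
      ((hg.mono_set sdiff_subset).norm.const_mul _)
      (hmeas.aestronglyMeasurable.mul (hg.mono_set sdiff_subset).1.norm) ?_
    filter_upwards [ae_restrict_mem (hA.diff measurableSet_ball)] with y hy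
    rw [Real.norm_of_nonneg (by positivity)]
    have : r ≤ ‖x - y‖ := by
      have := hy.2
      rwa [Metric.mem_ball, not_lt, dist_comm, dist_eq_norm] at this
    gcongr

variable {s d : ℝ} {ζ : ℝ → ℂ} {Ω : Set ℂ}

/-- A complex field on `Ω`, `C¹` up to the boundary and `2π`-periodic, that vanishes at infinity
and whose `∂̄`-derivative is integrable over a period. -/
structure IsPeriodicField (Ω : Set ℂ) (f : ℂ → ℂ) : Prop where
  smooth : ContDiffOn ℝ 1 f (closure Ω)
  periodic : ∀ y ∈ closure Ω, f (y + ((2 * π : ℝ) : ℂ)) = f y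
  decay : ∀ ε > 0, ∃ M : ℝ, ∀ y ∈ Ω, M < |y.im| → ‖f y‖ < ε
  integrable : ∀ x, IntegrableOn (dbar f) (Ω ∩ cell x)

theorem contDiff_regKernel_sub (δ : ℝ) (x : ℂ) : ContDiff ℝ 1 fun y => regKernel δ (x - y) :=
  (contDiff_regKernel δ).comp (contDiff_const.sub contDiff_id)

theorem regKernel_sub_add (δ : ℝ) (x y : ℂ) :
    regKernel δ (x - (y + ((2 * π : ℝ) : ℂ))) = regKernel δ (x - y) := by
  rw [← regKernel_add_int_mul δ (x - y) (-1)]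
  congr 1
  push_cast
  ring

theorem dbar_regKernel_sub {δ : ℝ} (hδ : 0 < δ) (x y : ℂ) :
    dbar (fun y => regKernel δ (x - y)) y = -((2 * regDensity δ (x - y) : ℝ) : ℂ) := by
  have h1 : HasFDerivAt (regKernel δ) (fderiv ℝ (regKernel δ) (x - y)) (x - y) :=
    ((contDiff_regKernel δ).differentiable one_ne_zero _).hasFDerivAt
  have h2 : HasFDerivAt (fun y : ℂ => x - y) (-ContinuousLinearMap.id ℝ ℂ) y :=
    (hasFDerivAt_id y).const_sub x
  have h3 : HasFDerivAt (fun y => regKernel δ (x - y))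
      ((fderiv ℝ (regKernel δ) (x - y)).comp (-ContinuousLinearMap.id ℝ ℂ)) y :=
    h1.comp y h2
  rw [← dbar_regKernel hδ, dbar, dbar, h3.fderiv]
  simp
  ring

namespace IsLeftSide

theorem integrableOn_regDensity_mul (hΩ : IsLeftSide ζ d Ω) {f : ℂ → ℂ}
    (hf : ContinuousOn f (closure Ω)) {δ : ℝ} (hδ : 0 < δ) (x : ℂ) :
    IntegrableOn (fun y => (regDensity δ (x - y) : ℂ) * f y) (Ω ∩ cell x) := by
  have h1 : IntegrableOn (fun y => (regDensity δ (x - y) : ℂ) * f y)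
      (closure Ω ∩ Metric.closedBall x (3 * δ)) := by
    refine ContinuousOn.integrableOn_compact
      ((isCompact_closedBall _ _).inter_left isClosed_closure) ?_
    refine ContinuousOn.mul (Continuous.continuousOn ?_) (hf.mono inter_subset_left)
    exact Complex.continuous_ofReal.comp ((continuous_regDensity δ).comp (by fun_prop))
  refine IntegrableOn.of_forall_sdiff_eq_zero
    (s := closure Ω ∩ Metric.closedBall x (3 * δ) ∩ cell x) (h1.mono_set inter_subset_left)
    (hΩ.isOpen.measurableSet.inter (measurableSet_cell x)) fun y hy => ?_
  rw [regDensity_eq_zero hδ (abs_re_sub_le_of_mem_cell hy.1.2), Complex.ofReal_zero, zero_mul]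
  by_contra hn
  refine hy.2 ⟨⟨subset_closure hy.1.1, ?_⟩, hy.1.2⟩
  rw [Metric.mem_closedBall, dist_comm, dist_eq_norm]
  exact not_lt.1 hn

/-- Nothing comes from infinity: in a cell the flanks of the plateau have area at most 4π for every
M, the regularised kernel is bounded, and f tends to 0 uniformly. Without the decay a constant would
survive, since the periodic kernel tends to ∓i/2 as Im z → ±∞. -/
theorem tendsto_integral_plateauDeriv (hΩ : IsLeftSide ζ d Ω) {f : ℂ → ℂ}
    (hf : IsPeriodicField Ω f) {δ : ℝ} (hδ : 0 < δ) (x : ℂ) :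
    Tendsto (fun M => ∫ y in Ω ∩ cell x,
      I * (plateauDeriv M y.im : ℂ) * (regKernel δ (x - y) * f y)) atTop (𝓝 0) := by
  obtain ⟨C, hC0, hC⟩ := exists_abs_plateauDeriv_le
  set D := δ⁻¹ + 1 / 2 with hD
  have hD0 : 0 < D := by positivity
  have hpi := Real.pi_pos
  rw [Metric.tendsto_atTop]
  intro ε hε
  set η := ε / (C * D * (4 * π) + 1) with hη
  have hη0 : 0 < η := by positivity
  obtain ⟨M₀, hM₀⟩ := hf.decay η hη0
  refine ⟨M₀ + 1, fun M hM => ?_⟩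
  rw [dist_zero_right]
  set S : Set ℝ := {t | M ≤ |t| ∧ |t| ≤ M + 1} with hS
  have hSv : volume S ≤ 2 := by
    have : S ⊆ Icc M (M + 1) ∪ Icc (-M - 1) (-M) := by
      rintro t ⟨h1, h2⟩
      rcases le_abs.1 h1 with h | h
      · exact Or.inl ⟨h, (abs_le.1 h2).2⟩
      · exact Or.inr ⟨by linarith [(abs_le.1 h2).1], by linarith⟩
    refine (measure_mono this).trans ((measure_union_le _ _).trans ?_)
    rw [Real.volume_Icc, Real.volume_Icc]
    ring_nf
    norm_num
  have hcs : volume (cell x ∩ {y | y.im ∈ S}) ≤ ENNReal.ofReal (4 * π) := by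
    rw [volume_cell_inter_im]
    calc ENNReal.ofReal (2 * π) * volume S ≤ ENNReal.ofReal (2 * π) * ENNReal.ofReal 2 := by
          gcongr; simpa using hSv
      _ = ENNReal.ofReal (4 * π) := by rw [← ENNReal.ofReal_mul (by positivity)]; ring_nf
  set A := Ω ∩ cell x with hA
  have hAm : MeasurableSet A := hΩ.isOpen.measurableSet.inter (measurableSet_cell x)
  have hAv : volume (A ∩ {y | y.im ∈ S}) ≤ ENNReal.ofReal (4 * π) :=
    (measure_mono (inter_subset_inter_left _ inter_subset_right)).trans hcs
  have hres : ∫ y in A, I * (plateauDeriv M y.im : ℂ) * (regKernel δ (x - y) * f y)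
      = ∫ y in A ∩ {y | y.im ∈ S}, I * (plateauDeriv M y.im : ℂ) * (regKernel δ (x - y) * f y) := by
    refine setIntegral_eq_of_subset_of_forall_sdiff_eq_zero hAm inter_subset_left fun y hy => ?_
    have h0 : plateauDeriv M y.im = 0 := by
      by_cases h1 : |y.im| ≤ M
      · exact plateauDeriv_of_abs_le h1
      · refine plateauDeriv_of_le_abs (le_of_not_ge fun h2 => hy.2 ⟨hy.1, (not_le.1 h1).le, h2⟩)
    rw [h0]
    simp
  rw [hres]
  have hbound : ∀ y ∈ A ∩ {y | y.im ∈ S},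
      ‖I * (plateauDeriv M y.im : ℂ) * (regKernel δ (x - y) * f y)‖ ≤ C * (D * η) := by
    rintro y ⟨hy, hyS⟩
    rw [norm_mul, norm_mul, norm_mul, Complex.norm_I, one_mul, Complex.norm_real]
    gcongr
    · exact hC _ _
    · exact norm_regKernel_le hδ _
    · exact (hM₀ y hy.1 (by linarith [hyS.1])).le
  have hfin := norm_setIntegral_le_of_norm_le_const (hAv.trans_lt ENNReal.ofReal_lt_top) hbound
  refine hfin.trans_lt ?_
  have hr : volume.real (A ∩ {y | y.im ∈ S}) ≤ 4 * π :=
    ENNReal.toReal_le_of_le_ofReal (by positivity) hAv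
  calc C * (D * η) * volume.real (A ∩ {y | y.im ∈ S}) ≤ C * (D * η) * (4 * π) := by gcongr
    _ = (C * D * (4 * π)) * η := by ring
    _ < (C * D * (4 * π) + 1) * η := by nlinarith
    _ = ε := by rw [hη]; field_simp

/-- The regularised Cauchy integral over a period as an area integral. -/
theorem integral_regKernel_eq (hΩ : IsLeftSide ζ d Ω) (h : IsPeriodicCurve s ζ)
    (hd : IsTubeWidth ζ d) (hp : IsPeriodicSet Ω) {f : ℂ → ℂ} (hf : IsPeriodicField Ω f)
    {δ : ℝ} (hδ : 0 < δ) (x : ℂ) (α : ℝ) :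
    ∫ β in (α - π)..(α + π), regKernel δ (x - ζ β) * f (ζ β) * deriv ζ β
      = I * (∫ y in Ω ∩ cell x, regKernel δ (x - y) * dbar f y)
        - 2 * I * ∫ y in Ω ∩ cell x, (regDensity δ (x - y) : ℂ) * f y := by
  obtain ⟨C, hC0, hC⟩ := h.exists_abs_im_le
  set A := Ω ∩ cell x with hA
  have hAm : MeasurableSet A := hΩ.isOpen.measurableSet.inter (measurableSet_cell x)
  set k : ℂ → ℂ := fun y => regKernel δ (x - y) with hk
  have hks : ContDiff ℝ 1 k := contDiff_regKernel_sub δ x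
  -- The plateau cuts off the heights, as Green's formula over a period requires; it is removed by M
  -- → ∞.
  set P : ℝ → ℂ → ℂ := fun M y => plateau M y.im • (k y * f y) with hP
  have hps : ∀ M, ContDiff ℝ 1 fun y : ℂ => plateau M y.im := fun M =>
    (contDiff_plateau M).comp Complex.imCLM.contDiff
  have hgreen : ∀ M, ∫ β in (α - π)..(α + π), P M (ζ β) * deriv ζ β
      = I * ∫ y in A, dbar (P M) y := by
    intro M
    refine hΩ.integral_period_eq h hd hp (B := M + 1) ?_ ?_ ?_ x α
    · exact (hps M).contDiffOn.smul (hks.contDiffOn.mul hf.smooth)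
    · intro y hy
      simp only [hP, hk, hf.periodic y hy, regKernel_sub_add]
      congr 2
      simp
    · intro y hy
      simp only [hP, plateau_of_le_abs hy, zero_smul]
  have hfd : ∀ y ∈ Ω, DifferentiableAt ℝ f y := fun y hy =>
    (hf.smooth.contDiffAt (mem_of_superset (hΩ.isOpen.mem_nhds hy)
      subset_closure)).differentiableAt one_ne_zero
  set H : ℂ → ℂ := fun y => k y * dbar f y - 2 * ((regDensity δ (x - y) : ℂ) * f y) with hH
  have hdP : ∀ M, ∀ y ∈ A, dbar (P M) y
      = I * (plateauDeriv M y.im : ℂ) * (k y * f y) + (plateau M y.im : ℂ) * H y := by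
    intro M y hy
    have hkd := hks.differentiable one_ne_zero y
    have e : dbar k y = -((2 * regDensity δ (x - y) : ℝ) : ℂ) := dbar_regKernel_sub hδ x y
    rw [hP]
    simp only
    rw [dbar_smul (F := fun y => k y * f y) ((hps M).differentiable one_ne_zero y) (hkd.mul (hfd y hy.1)),
      dbar_mul hkd (hfd y hy.1), e, dbarReal_comp_im (hasDerivAt_plateau M y.im)]
    simp only [hH]
    push_cast
    ring
  have hi1 : IntegrableOn (fun y => k y * dbar f y) A :=
    (hf.integrable x).bdd_mul (c := δ⁻¹ + 1 / 2) hks.continuous.aestronglyMeasurable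
      (ae_of_all _ fun y => norm_regKernel_le hδ _)
  have hi2 : IntegrableOn (fun y => (regDensity δ (x - y) : ℂ) * f y) A :=
    hΩ.integrableOn_regDensity_mul hf.smooth.continuousOn hδ x
  have hHi : IntegrableOn H A := hi1.sub (hi2.const_mul 2)
  have hHv : I * ∫ y in A, H y = I * (∫ y in A, k y * dbar f y)
      - 2 * I * ∫ y in A, (regDensity δ (x - y) : ℂ) * f y := by
    rw [hH, integral_sub hi1 (hi2.const_mul 2), integral_const_mul]
    ring
  have hpc : ∀ M, Continuous fun y : ℂ => (plateau M y.im : ℂ) := fun M =>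
    Complex.continuous_ofReal.comp (hps M).continuous
  have hi3 : ∀ M, IntegrableOn (fun y => (plateau M y.im : ℂ) * H y) A := fun M =>
    hHi.bdd_mul (c := 1) (hpc M).aestronglyMeasurable
      (ae_of_all _ fun y => by rw [Complex.norm_real]; exact abs_plateau_le _ _)
  have hi4 : ∀ M, IntegrableOn
      (fun y => I * (plateauDeriv M y.im : ℂ) * (k y * f y)) A := by
    intro M
    have h1 : IntegrableOn (fun y => I * (plateauDeriv M y.im : ℂ) * (k y * f y))
        (closure Ω ∩ (Icc (x.re - π) (x.re + π) ×ℂ Icc (-(M + 1)) (M + 1))) := by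
      refine ContinuousOn.integrableOn_compact
        ((isCompact_Icc.reProdIm isCompact_Icc).inter_left isClosed_closure) ?_
      refine ContinuousOn.mul (Continuous.continuousOn ?_)
        (hks.continuous.continuousOn.mul (hf.smooth.continuousOn.mono inter_subset_left))
      exact continuous_const.mul (Complex.continuous_ofReal.comp
        ((continuous_plateauDeriv M).comp Complex.continuous_im))
    refine IntegrableOn.of_forall_sdiff_eq_zero h1 hAm fun y hy => ?_
    have h0 : plateauDeriv M y.im = 0 := by
      refine plateauDeriv_of_le_abs (le_of_not_ge fun h2 => hy.2 ⟨subset_closure hy.1.1, ?_⟩)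
      exact ⟨⟨hy.1.2.1, hy.1.2.2.le⟩, abs_le.1 h2⟩
    rw [h0]
    simp
  have hlim : Tendsto (fun M => I * ∫ y in A, dbar (P M) y) atTop (𝓝 (I * ∫ y in A, H y)) := by
    have e : ∀ M, ∫ y in A, dbar (P M) y
        = (∫ y in A, I * (plateauDeriv M y.im : ℂ) * (k y * f y))
          + ∫ y in A, (plateau M y.im : ℂ) * H y := by
      intro M
      rw [setIntegral_congr_fun hAm (hdP M), integral_add (hi4 M) (hi3 M)]
    simp only [e]
    refine Tendsto.const_mul I ?_
    have t2 : Tendsto (fun M => ∫ y in A, (plateau M y.im : ℂ) * H y) atTop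
        (𝓝 (∫ y in A, H y)) := by
      refine tendsto_integral_filter_of_dominated_convergence (fun y => ‖H y‖)
        (Eventually.of_forall fun M => (hi3 M).1) (Eventually.of_forall fun M => ?_) hHi.norm ?_
      · refine ae_of_all _ fun y => ?_
        rw [norm_mul, Complex.norm_real]
        exact mul_le_of_le_one_left (norm_nonneg _) (abs_plateau_le _ _)
      · refine ae_of_all _ fun y => tendsto_const_nhds.congr' ?_
        filter_upwards [eventually_ge_atTop |y.im|] with M hM
        rw [plateau_of_abs_le hM, Complex.ofReal_one, one_mul]
    simpa using (hΩ.tendsto_integral_plateauDeriv hf hδ x).add t2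
  -- Once M exceeds the height of the curve, the plateau is 1 on it and the line integral no longer
  -- depends on M.
  have hconst : (fun M => I * ∫ y in A, dbar (P M) y) =ᶠ[atTop]
      fun _ => ∫ β in (α - π)..(α + π), k (ζ β) * f (ζ β) * deriv ζ β := by
    filter_upwards [eventually_ge_atTop C] with M hM
    rw [← hgreen M]
    refine intervalIntegral.integral_congr fun β _ => ?_
    simp only [hP, plateau_of_abs_le ((hC β).trans hM), one_smul]
  rw [← hHv]
  exact tendsto_nhds_unique tendsto_const_nhds (hlim.congr' hconst)

theorem integrableOn_inv_norm_mul_dbar (hΩ : IsLeftSide ζ d Ω) {f : ℂ → ℂ}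
    (hf : IsPeriodicField Ω f) {x : ℂ} (hx : x ∈ closure Ω) :
    IntegrableOn (fun y => ‖x - y‖⁻¹ * ‖dbar f y‖) (Ω ∩ cell x) := by
  refine integrableOn_inv_norm_mul (hΩ.isOpen.measurableSet.inter (measurableSet_cell x))
    (hf.integrable x) ?_
  obtain ⟨C, hC⟩ := exists_fderiv_le_of_contDiffOn_closure hΩ.isOpen hf.smooth hx
  refine ⟨2 * C, ?_⟩
  filter_upwards [nhdsWithin_mono x inter_subset_left hC] with y hy
  exact (norm_dbar_le f y).trans (by linarith)

/-- The **Plemelj formula** for the regularised periodic Cauchy kernel. -/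
theorem tendsto_integral_regKernel (hΩ : IsLeftSide ζ d Ω) (h : IsPeriodicCurve s ζ)
    (hd : IsTubeWidth ζ d) (hp : IsPeriodicSet Ω) {f : ℂ → ℂ} (hf : IsPeriodicField Ω f) (α : ℝ) :
    Tendsto (fun δ => ∫ β in (α - π)..(α + π), regKernel δ (ζ α - ζ β) * f (ζ β) * deriv ζ β)
      (𝓝[>] 0) (𝓝 (I * (∫ y in Ω ∩ cell (ζ α), periodicKernel (ζ α - y) * dbar f y)
        - I * π * f (ζ α))) := by
  set x := ζ α with hx
  have hxc : x ∈ closure Ω := hΩ.curve_mem_closure hd h α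
  have hm := hΩ.isOpen.measurableSet.inter (measurableSet_cell x)
  have t1 := hΩ.tendsto_integral_regDensity h hd hf.smooth.continuousOn α
  have t2 : Tendsto (fun δ => ∫ y in Ω ∩ cell x, regKernel δ (x - y) * dbar f y) (𝓝[>] 0)
      (𝓝 (∫ y in Ω ∩ cell x, periodicKernel (x - y) * dbar f y)) := by
    refine tendsto_integral_filter_of_dominated_convergence
      (fun y => π / 2 * (‖x - y‖⁻¹ * ‖dbar f y‖) + 1 / 2 * ‖dbar f y‖)
      (Eventually.of_forall fun δ => ?_) (Eventually.of_forall fun δ => ?_) ?_ ?_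
    · exact (contDiff_regKernel_sub δ x).continuous.aestronglyMeasurable.mul (hf.integrable x).1
    · filter_upwards [ae_restrict_mem hm] with y hy
      rw [norm_mul]
      have := (norm_regKernel_le_periodicKernel δ (x - y)).trans
        (norm_periodicKernel_le (abs_re_sub_le_of_mem_cell hy.2))
      calc _ ≤ (π / 2 * ‖x - y‖⁻¹ + 1 / 2) * ‖dbar f y‖ := by gcongr
        _ = _ := by ring
    · exact ((hΩ.integrableOn_inv_norm_mul_dbar hf hxc).const_mul _).add
        ((hf.integrable x).norm.const_mul _)
    · exact ae_of_all _ fun y => (tendsto_regKernel (x - y)).mul_const _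
  have t3 := (t2.const_mul I).sub (t1.const_mul (2 * I))
  -- Half the mass, π/2, times the factor 2 from ∂̄ of the kernel: half of the residue 2πi.
  have e : (2 * I * (π / 2 * f x) : ℂ) = I * π * f x := by ring
  rw [e] at t3
  refine t3.congr' ?_
  filter_upwards [self_mem_nhdsWithin] with δ hδ
  exact (hΩ.integral_regKernel_eq h hd hp hf hδ x α).symm

end IsLeftSide

end

section

/-! ### Smooth and sharp cutoffs of a principal value -/

/-- A smooth and a sharp symmetric cutoff of `N h / h` define the same principal value. -/
theorem tendsto_integral_cutoff_sub {a : ℝ} (ha : 0 < a) {m : ℝ → ℝ} {N : ℝ → ℂ}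
    (hm : ContinuousOn m (Icc (-a) a)) (hm0 : m 0 = 1) (hpos : ∀ h ∈ Icc (-a) a, 0 < m h)
    (hN : ContinuousOn N (Icc (-a) a)) :
    Tendsto (fun δ : ℝ => ∫ h in (-a)..a,
      ((Real.smoothTransition (h ^ 2 * m h / δ ^ 2 - 1) - if δ < |h| then 1 else 0 : ℝ) : ℂ)
        * (N h / h)) (𝓝[>] 0) (𝓝 0) := by
  have hne : (Icc (-a) a).Nonempty := ⟨0, by constructor <;> linarith⟩
  obtain ⟨h₁, h₁m, hlow⟩ := isCompact_Icc.exists_isMinOn hne hm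
  obtain ⟨h₂, h₂m, hup⟩ := isCompact_Icc.exists_isMaxOn hne hm
  obtain ⟨C, hC⟩ := isCompact_Icc.exists_bound_of_continuousOn hN
  have hlow' : ∀ h ∈ Icc (-a) a, m h₁ ≤ m h := fun h hh => hlow hh
  have hup' : ∀ h ∈ Icc (-a) a, m h ≤ m h₂ := fun h hh => hup hh
  have hp1 := hpos _ h₁m
  have hp2 := hpos _ h₂m
  have h0 : (0 : ℝ) ∈ Icc (-a) a := by constructor <;> linarith
  have hC0 : 0 ≤ C := (norm_nonneg _).trans (hC 0 h0)
  set b : ℝ → ℝ → ℝ := fun δ h =>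
    Real.smoothTransition (h ^ 2 * m h / δ ^ 2 - 1) - if δ < |h| then 1 else 0 with hb
  set F : ℝ → ℝ → ℂ := fun δ => (Ioc (-a) a).indicator fun h => (b δ h : ℂ) * (N h / h) with hF
  set L : ℝ → ℂ := fun r =>
    ((Real.smoothTransition (r ^ 2 - 1) - if 1 < |r| then 1 else 0 : ℝ) : ℂ) * (N 0 / r) with hL
  -- After the substitution h = δr the limiting integrand is odd, since m and N are frozen at 0.
  -- This is why the two cutoffs give the same principal value.
  have hL0 : ∫ r, L r = 0 := by
    have h1 := integral_neg_eq_self L volume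
    have h2 : ∀ r, L (-r) = -L r := by
      intro r
      simp only [hL, abs_neg, neg_sq, Complex.ofReal_neg, div_neg, mul_neg]
    simp only [h2, integral_neg] at h1
    exact self_eq_neg.1 h1.symm
  have hscale : ∀ δ : ℝ, 0 < δ → ∫ h in (-a)..a, (b δ h : ℂ) * (N h / h)
      = ∫ r, (δ : ℂ) * F δ (δ * r) := by
    intro δ hδ
    rw [integral_const_mul, Measure.integral_comp_mul_left (F δ) δ,
      intervalIntegral.integral_of_le (by linarith), ← integral_indicator measurableSet_Ioc,
      abs_of_pos (by positivity), Complex.real_smul, ← mul_assoc]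
    have : (δ : ℂ) ≠ 0 := by exact_mod_cast hδ.ne'
    push_cast
    rw [mul_inv_cancel₀ this, one_mul]
  have hval : ∀ δ r : ℝ, 0 < δ → δ * r ∈ Ioc (-a) a → (δ : ℂ) * F δ (δ * r)
      = ((Real.smoothTransition (r ^ 2 * m (δ * r) - 1) - if 1 < |r| then 1 else 0 : ℝ) : ℂ)
        * (N (δ * r) / r) := by
    intro δ r hδ hr
    have h1 : (δ * r) ^ 2 * m (δ * r) / δ ^ 2 = r ^ 2 * m (δ * r) := by field_simp
    have h2 : δ < |δ * r| ↔ 1 < |r| := by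
      rw [abs_mul, abs_of_pos hδ]
      exact lt_mul_iff_one_lt_right hδ
    have : (δ : ℂ) ≠ 0 := by exact_mod_cast hδ.ne'
    simp only [hF]
    rw [indicator_of_mem hr]
    simp only [hb, h1, h2]
    rcases eq_or_ne r 0 with rfl | hr0
    · simp
    have : (r : ℂ) ≠ 0 := by exact_mod_cast hr0
    push_cast
    field_simp
  rw [← hL0]
  have hev : (fun δ : ℝ => ∫ r, (δ : ℂ) * F δ (δ * r)) =ᶠ[𝓝[>] 0]
      fun δ => ∫ h in (-a)..a, (b δ h : ℂ) * (N h / h) := by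
    filter_upwards [self_mem_nhdsWithin] with δ hδ using (hscale δ hδ).symm
  refine Tendsto.congr' hev ?_
  -- Where the cutoffs differ, r² m is below 2 if |r| > 1 and above 1 if |r| ≤ 1. With m₁ = `m h₁`
  -- and m₂ = `m h₂` the extreme values of m, this confines |r| between ρ and 1 + 2/m₁, away from
  -- the pole; for |r| ≤ 1 the bound uses |r| ≥ r² ≥ 1/m₂.
  set ρ := min 1 (1 / m h₂) with hρ
  have hρ0 : 0 < ρ := lt_min one_pos (by positivity)
  refine tendsto_integral_filter_of_dominated_convergence
    ((Icc (-(1 + 2 / m h₁)) (1 + 2 / m h₁)).indicator fun _ => C / ρ) ?_ ?_ ?_ ?_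
  · filter_upwards [self_mem_nhdsWithin] with δ hδ
    have hδ' : (0 : ℝ) < δ := hδ
    have hbm : AEStronglyMeasurable (F δ) := by
      rw [aestronglyMeasurable_indicator_iff measurableSet_Ioc]
      have h1 : AEStronglyMeasurable (fun h => b δ h) (volume.restrict (Ioc (-a) a)) := by
        refine AEStronglyMeasurable.sub ?_ ?_
        · refine ContinuousOn.aestronglyMeasurable ?_ measurableSet_Ioc
          refine Real.smoothTransition.continuous.comp_continuousOn ?_
          exact (((continuousOn_id.pow 2).mul (hm.mono Ioc_subset_Icc_self)).div_const _).sub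
            continuousOn_const
        · exact (Measurable.ite (measurableSet_lt measurable_const (by fun_prop))
            measurable_const measurable_const).aestronglyMeasurable
      refine (Complex.continuous_ofReal.comp_aestronglyMeasurable h1).mul ?_
      have h2 : AEStronglyMeasurable N (volume.restrict (Ioc (-a) a)) :=
        (hN.mono Ioc_subset_Icc_self).aestronglyMeasurable measurableSet_Ioc
      have h3 : Measurable fun h : ℝ => ((h : ℂ))⁻¹ := by fun_prop
      simp only [div_eq_mul_inv]
      exact h2.mul h3.aestronglyMeasurable
    have hq : Measure.QuasiMeasurePreserving (fun r : ℝ => δ * r) volume volume := by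
      refine ⟨measurable_const_mul δ, ?_⟩
      rw [Real.map_volume_mul_left hδ'.ne']
      exact Measure.smul_absolutelyContinuous
    exact (hbm.comp_quasiMeasurePreserving hq).const_mul _
  · filter_upwards [self_mem_nhdsWithin] with δ hδ
    have hδ' : (0 : ℝ) < δ := hδ
    refine ae_of_all _ fun r => ?_
    have hb0 : 0 ≤ C / ρ := by positivity
    by_cases hr : δ * r ∈ Ioc (-a) a
    · have hr' := Ioc_subset_Icc_self hr
      rw [hval δ r hδ' hr]
      set B : ℝ := Real.smoothTransition (r ^ 2 * m (δ * r) - 1) - if 1 < |r| then 1 else 0 with hB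
      by_cases hB0 : B = 0
      · rw [hB0]
        simp only [Complex.ofReal_zero, zero_mul, norm_zero]
        exact indicator_nonneg (fun _ _ => hb0) _
      have hB1 : |B| ≤ 1 := by
        have h1 := Real.smoothTransition.nonneg (r ^ 2 * m (δ * r) - 1)
        have h2 := Real.smoothTransition.le_one (r ^ 2 * m (δ * r) - 1)
        rw [abs_le, hB]
        split_ifs <;> constructor <;> linarith
      have hbig : |r| ≤ 1 + 2 / m h₁ ∧ ρ ≤ |r| := by
        by_cases h1 : 1 < |r|
        · refine ⟨?_, (min_le_left _ _).trans h1.le⟩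
          have h2 : r ^ 2 * m (δ * r) < 2 := by
            by_contra hn
            refine hB0 ?_
            rw [hB, if_pos h1, Real.smoothTransition.one_of_one_le (by linarith), sub_self]
          have h3 : r ^ 2 ≤ 2 / m h₁ := by
            rw [le_div_iff₀ hp1]
            exact (mul_le_mul_of_nonneg_left (hlow' _ hr') (sq_nonneg r)).trans h2.le
          nlinarith [sq_abs r]
        · have h1' := not_lt.1 h1
          refine ⟨h1'.trans (by have : 0 < 2 / m h₁ := by positivity
                                linarith), ?_⟩
          have h2 : 1 < r ^ 2 * m (δ * r) := by
            by_contra hn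
            refine hB0 ?_
            rw [hB, if_neg h1, Real.smoothTransition.zero_of_nonpos (by linarith), sub_self]
          have h3 : 1 / m h₂ ≤ r ^ 2 := by
            rw [div_le_iff₀ hp2]
            exact h2.le.trans (mul_le_mul_of_nonneg_left (hup' _ hr') (sq_nonneg r))
          refine (min_le_right _ _).trans (h3.trans ?_)
          rw [← sq_abs]
          nlinarith [abs_nonneg r]
      have hmem : r ∈ Icc (-(1 + 2 / m h₁)) (1 + 2 / m h₁) := abs_le.1 hbig.1
      rw [indicator_of_mem hmem, norm_mul, Complex.norm_real, norm_div,
        Complex.norm_real, Real.norm_eq_abs, Real.norm_eq_abs]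
      calc |B| * (‖N (δ * r)‖ / |r|) ≤ 1 * (C / ρ) := by
            gcongr
            · exact hC _ hr'
            · exact hbig.2
        _ = C / ρ := one_mul _
    · simp only [hF]
      rw [indicator_of_notMem hr, mul_zero, norm_zero]
      exact indicator_nonneg (fun _ _ => hb0) _
  · rw [integrable_indicator_iff measurableSet_Icc]
    exact integrableOn_const (by simp) (by simp)
  · refine ae_of_all _ fun r => ?_
    have hray : Tendsto (fun δ : ℝ => δ * r) (𝓝[>] 0) (𝓝 0) := by
      have : Continuous fun δ : ℝ => δ * r := by fun_prop
      simpa using (this.tendsto 0).mono_left nhdsWithin_le_nhds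
    have hIcc : Icc (-a) a ∈ 𝓝 (0 : ℝ) := Icc_mem_nhds (by linarith) ha
    have l1 : Tendsto (fun δ : ℝ => m (δ * r)) (𝓝[>] 0) (𝓝 1) :=
      hm0 ▸ (hm.continuousAt hIcc).tendsto.comp hray
    have l2 : Tendsto (fun δ : ℝ => N (δ * r)) (𝓝[>] 0) (𝓝 (N 0)) :=
      (hN.continuousAt hIcc).tendsto.comp hray
    have l3 : Tendsto (fun δ : ℝ => Real.smoothTransition (r ^ 2 * m (δ * r) - 1)) (𝓝[>] 0)
        (𝓝 (Real.smoothTransition (r ^ 2 - 1))) := by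
      refine (Real.smoothTransition.continuous.tendsto _).comp ?_
      simpa using (l1.const_mul (r ^ 2)).sub_const 1
    have l4 := (Complex.continuous_ofReal.tendsto _).comp
      (l3.sub_const (if 1 < |r| then (1 : ℝ) else 0))
    refine (l4.mul (l2.div_const (r : ℂ))).congr' ?_
    have hin : ∀ᶠ δ : ℝ in 𝓝[>] 0, δ * r ∈ Ioc (-a) a :=
      hray.eventually (Ioc_mem_nhds (by linarith) ha)
    filter_upwards [hin, self_mem_nhdsWithin] with δ hδ hδ0
    exact (hval δ r hδ0 hδ).symm

variable {s : ℝ} {ζ : ℝ → ℂ}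

/-- The chord from the point with parameter `α + h` to the point with parameter `α`. -/
def chord (ζ : ℝ → ℂ) (α h : ℝ) : ℂ := ζ α - ζ (α + h)

namespace IsPeriodicCurve

/-- A lattice translate of a curve point is the curve point whose parameter is shifted by the
corresponding period. Injectivity identifies the parameters, which are less than a period apart. -/
theorem eq_of_sub_eq_lattice (h : IsPeriodicCurve s ζ) {a b : ℝ} (hab : |b - a| < 2 * π) {n : ℤ}
    (he : ζ a - ζ b = ((n * (2 * π) : ℝ) : ℂ)) : a = b ∧ n = 0 := by
  have hp := Real.two_pi_pos
  have key : ∀ m : ℤ, a = b + m * (2 * π) → m = 0 := by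
    intro m hm
    rw [show b - a = -(m * (2 * π)) by linarith, abs_neg, abs_mul, abs_of_pos hp] at hab
    have h1 : |(m : ℝ)| < 1 := by nlinarith
    exact Int.abs_lt_one_iff.1 (by exact_mod_cast h1)
  rcases h.orientation with rfl | rfl
  · have h1 := h.add_int_mul b n
    rw [one_mul, ← he, add_sub_cancel] at h1
    have h2 := h.injective h1.symm
    have h3 := key n h2
    exact ⟨by rw [h2, h3]; simp, h3⟩
  · have h1 := h.add_int_mul b (-n)
    have e : ((-1 * (((-n : ℤ) : ℝ) * (2 * π)) : ℝ) : ℂ) = ((n * (2 * π) : ℝ) : ℂ) := by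
      push_cast; ring
    rw [e, ← he, add_sub_cancel] at h1
    have h2 := h.injective h1.symm
    have h3 := key (-n) h2
    have h4 : n = 0 := by omega
    exact ⟨by rw [h2, h3]; simp, h4⟩

theorem continuous_chord (h : IsPeriodicCurve s ζ) (α : ℝ) : Continuous (chord ζ α) := by
  have := h.continuous
  unfold chord
  fun_prop

/-- The quotient of `2 sin (D / 2)` by the parameter, for a chord `D`. -/
theorem exists_chord_quotient (h : IsPeriodicCurve s ζ) (α : ℝ) :
    ∃ q : ℝ → ℂ, Continuous q ∧ q 0 = -deriv ζ α ∧ (∀ r ∈ Icc (-π) π, q r ≠ 0) ∧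
      ∀ r : ℝ, 2 * Complex.sin (chord ζ α r / 2) = r * q r := by
  set E : ℝ → ℂ := fun r => 2 * Complex.sin (chord ζ α r / 2) with hE
  have hder : HasDerivAt E (-deriv ζ α) 0 := by
    have h1 : HasDerivAt (chord ζ α) (-deriv ζ α) 0 := by
      have h2 := h.hasDerivAt (α + 0)
      have h3 : HasDerivAt (fun r : ℝ => ζ (α + r)) (deriv ζ (α + 0)) 0 := h2.comp_const_add α 0
      rw [add_zero] at h3
      exact h3.const_sub (ζ α)
    have h4 := (hasDerivAt_two_mul_sin_half (chord ζ α 0)).comp (0 : ℝ) h1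
    have h0 : chord ζ α 0 = 0 := by simp [chord]
    rw [h0] at h4
    simpa [Function.comp_def] using h4
  have hE0 : E 0 = 0 := by simp [hE, chord]
  have hEc : Continuous E := by
    have := h.continuous_chord α
    exact contDiff_two_mul_sin_half.continuous.comp this
  have hmul : ∀ r : ℝ, E r = r * dslope E 0 r := by
    intro r
    have := sub_smul_dslope E 0 r
    rw [hE0, sub_zero, sub_zero, Complex.real_smul] at this
    exact this.symm
  have hq0 : dslope E 0 0 = -deriv ζ α := by rw [dslope_same, hder.deriv]
  refine ⟨dslope E 0, ?_, hq0, ?_, hmul⟩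
  · rw [← continuousOn_univ, continuousOn_dslope univ_mem]
    exact ⟨hEc.continuousOn, hder.differentiableAt⟩
  · intro r hr h0
    rcases eq_or_ne r 0 with rfl | hr0
    · rw [hq0, neg_eq_zero] at h0
      exact h.regular α h0
    · have h1 := hmul r
      rw [h0, mul_zero, hE] at h1
      have h2 : Complex.sin (chord ζ α r / 2) = 0 := by simpa using h1
      obtain ⟨n, hn⟩ := sin_half_eq_zero_iff.1 h2
      have h3 : |α + r - α| < 2 * π := by
        rw [add_sub_cancel_left]
        exact (abs_le.2 hr).trans_lt (by linarith [Real.pi_pos])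
      have := (h.eq_of_sub_eq_lattice h3 hn).1
      exact hr0 (by linarith)

/-- The principal value of the periodic Cauchy integral is the limit of its regularisations. -/
theorem tendsto_integral_sharp (h : IsPeriodicCurve s ζ) {g : ℝ → ℂ} (hg : Continuous g) {α : ℝ}
    {L : ℂ} (hL : Tendsto (fun δ => ∫ β in (α - π)..(α + π), regKernel δ (ζ α - ζ β) * g β)
      (𝓝[>] 0) (𝓝 L)) :
    Tendsto (fun δ : ℝ => ∫ r in (-π)..π,
      if δ < |r| then periodicKernel (chord ζ α r) * g (α + r) else 0) (𝓝[>] 0) (𝓝 L) := by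
  obtain ⟨q, hqc, hq0, hqne, hq⟩ := h.exists_chord_quotient α
  have hpi := Real.pi_pos
  -- The smooth cutoff measures distance in the plane, the sharp one in the parameter. Regularising
  -- at scale |ζ'(α)| δ reconciles them and normalises m(0) = 1.
  set lam := ‖deriv ζ α‖ with hlam
  have hlam0 : 0 < lam := norm_pos_iff.2 (h.regular α)
  set m : ℝ → ℝ := fun r => ‖q r‖ ^ 2 / lam ^ 2 with hm
  set N : ℝ → ℂ := fun r => Complex.cos (chord ζ α r / 2) * g (α + r) / q r with hN
  have hchord := h.continuous_chord α
  have hNc : ContinuousOn N (Icc (-π) π) := by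
    refine ContinuousOn.div (Continuous.continuousOn ?_) hqc.continuousOn hqne
    exact (Complex.continuous_cos.comp (by fun_prop)).mul (hg.comp (by fun_prop))
  have hK : ∀ r, periodicKernel (chord ζ α r) * g (α + r) = N r / r := by
    intro r
    rw [periodicKernel, hq, div_mul_eq_mul_div, hN, div_div, mul_comm (q r)]
  have hreg : ∀ δ r : ℝ, regKernel (lam * δ) (chord ζ α r) * g (α + r)
      = (Real.smoothTransition (r ^ 2 * m r / δ ^ 2 - 1) : ℂ) * (N r / r) := by
    intro δ r
    rw [regKernel, Complex.real_smul, mul_assoc, hK, hq]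
    congr 4
    rw [Complex.normSq_mul, Complex.normSq_ofReal, ← Complex.sq_norm, hm, mul_pow]
    simp only
    rw [← sq, mul_div_assoc', div_div]
  have hcut := tendsto_integral_cutoff_sub hpi (m := m) (N := N)
    (((hqc.norm.pow 2).div_const _).continuousOn)
    (by simp only [hm, hq0, norm_neg, ← hlam]; field_simp)
    (fun r hr => by have := norm_pos_iff.2 (hqne r hr); positivity) hNc
  have hL' : Tendsto (fun δ : ℝ => ∫ r in (-π)..π,
      (Real.smoothTransition (r ^ 2 * m r / δ ^ 2 - 1) : ℂ) * (N r / r)) (𝓝[>] 0) (𝓝 L) := by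
    have h1 : Tendsto (fun δ : ℝ => lam * δ) (𝓝[>] 0) (𝓝[>] 0) := by
      refine tendsto_nhdsWithin_iff.2 ⟨?_, ?_⟩
      · have : Continuous fun δ : ℝ => lam * δ := by fun_prop
        simpa using (this.tendsto 0).mono_left nhdsWithin_le_nhds
      · filter_upwards [self_mem_nhdsWithin] with δ hδ using mul_pos hlam0 hδ
    refine (hL.comp h1).congr fun δ => ?_
    simp only [Function.comp]
    rw [show α - π = α + -π by ring, ← intervalIntegral.integral_comp_add_left
      (fun β => regKernel (lam * δ) (ζ α - ζ β) * g β) α]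
    exact intervalIntegral.integral_congr fun r _ => hreg δ r
  have h1 := hL'.sub hcut
  rw [sub_zero] at h1
  refine h1.congr' ?_
  obtain ⟨C, hC⟩ := isCompact_Icc.exists_bound_of_continuousOn hNc
  filter_upwards [self_mem_nhdsWithin] with δ hδ
  have hδ' : (0 : ℝ) < δ := hδ
  have hi1 : IntervalIntegrable (fun r : ℝ =>
      (Real.smoothTransition (r ^ 2 * m r / δ ^ 2 - 1) : ℂ) * (N r / r)) volume (-π) π := by
    have : Continuous fun r => regKernel (lam * δ) (chord ζ α r) * g (α + r) :=
      ((contDiff_regKernel _).continuous.comp hchord).mul (hg.comp (by fun_prop))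
    exact (this.congr (hreg δ)).intervalIntegrable _ _
  have hite : Measurable fun r : ℝ => if δ < |r| then (1 : ℝ) else 0 :=
    Measurable.ite (measurableSet_lt measurable_const (by fun_prop)) measurable_const
      measurable_const
  have hi2 : IntervalIntegrable (fun r : ℝ => ((if δ < |r| then 1 else 0 : ℝ) : ℂ) * (N r / r))
      volume (-π) π := by
    rw [intervalIntegrable_iff_integrableOn_Ioc_of_le (by linarith)]
    refine Integrable.mono' (g := fun _ => C / δ) (integrableOn_const (by simp) (by simp)) ?_ ?_
    · refine (Complex.continuous_ofReal.measurable.comp hite).aestronglyMeasurable.mul ?_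
      simp only [div_eq_mul_inv]
      have h3 : Measurable fun h : ℝ => ((h : ℂ))⁻¹ := by fun_prop
      exact ((hNc.mono Ioc_subset_Icc_self).aestronglyMeasurable measurableSet_Ioc).mul
        h3.aestronglyMeasurable
    · filter_upwards [ae_restrict_mem measurableSet_Ioc] with r hr
      have hCr := hC r (Ioc_subset_Icc_self hr)
      have hC0 := (norm_nonneg _).trans hCr
      split_ifs with h2
      · rw [Complex.ofReal_one, one_mul, norm_div, Complex.norm_real, Real.norm_eq_abs]
        gcongr
      · simp only [Complex.ofReal_zero, zero_mul, norm_zero]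
        positivity
  have hsplit : ∀ r : ℝ, ((Real.smoothTransition (r ^ 2 * m r / δ ^ 2 - 1)
      - if δ < |r| then 1 else 0 : ℝ) : ℂ) * (N r / r)
      = (Real.smoothTransition (r ^ 2 * m r / δ ^ 2 - 1) : ℂ) * (N r / r)
        - ((if δ < |r| then 1 else 0 : ℝ) : ℂ) * (N r / r) := by
    intro r
    push_cast
    ring
  simp only [hsplit]
  rw [intervalIntegral.integral_sub hi1 hi2, sub_sub_cancel]
  refine intervalIntegral.integral_congr fun r _ => ?_
  simp only [hK]
  split_ifs <;> simp

end IsPeriodicCurve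

end

section

/-! ### The truncated Cauchy integral along the curve -/

theorem measurable_periodicKernel : Measurable periodicKernel := by
  unfold periodicKernel
  fun_prop

/-- The number of complete periods in the window of size `R`. -/
def periodCount (R : ℝ) : ℕ := ⌊(R / π - 1) / 2⌋₊

theorem tendsto_periodCount : Tendsto periodCount atTop atTop := by
  have hpi := Real.pi_pos
  refine tendsto_nat_floor_atTop.comp ?_
  refine Tendsto.atTop_div_const two_pos (tendsto_atTop_add_const_right _ _ ?_)
  exact tendsto_id.atTop_div_const hpi

theorem periodCount_le {R : ℝ} (hR : π ≤ R) : (2 * periodCount R + 1) * π ≤ R := by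
  have hpi := Real.pi_pos
  have h1 : 1 ≤ R / π := by rwa [le_div_iff₀ hpi, one_mul]
  have h2 := Nat.floor_le (a := (R / π - 1) / 2) (by linarith)
  have h3 : (2 * periodCount R + 1 : ℝ) ≤ R / π := by rw [periodCount]; linarith
  rwa [le_div_iff₀ hpi] at h3

theorem lt_periodCount (R : ℝ) : R < (2 * periodCount R + 1) * π + 2 * π := by
  have hpi := Real.pi_pos
  have h2 := Nat.lt_floor_add_one ((R / π - 1) / 2)
  have h3 : R / π < 2 * periodCount R + 3 := by rw [periodCount]; linarith
  rw [div_lt_iff₀ hpi] at h3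
  linarith

variable {s : ℝ} {ζ : ℝ → ℂ}

namespace IsPeriodicCurve

theorem chord_ne_zero (h : IsPeriodicCurve s ζ) (α : ℝ) {r : ℝ} (hr : r ≠ 0) :
    chord ζ α r ≠ 0 := by
  intro h0
  have := h.injective (sub_eq_zero.1 h0)
  exact hr (by linarith)

theorem chord_add_int_mul (h : IsPeriodicCurve s ζ) (α r : ℝ) (n : ℤ) :
    chord ζ α (r + n * (2 * π)) = chord ζ α r - ((s * (n * (2 * π)) : ℝ) : ℂ) := by
  rw [chord, ← add_assoc, h.add_int_mul, chord]
  ring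

theorem continuousOn_div_chord (h : IsPeriodicCurve s ζ) {g : ℝ → ℂ} (hg : Continuous g) (α : ℝ) :
    ContinuousOn (fun r => g (α + r) / chord ζ α r) {0}ᶜ :=
  ContinuousOn.div (by fun_prop) (h.continuous_chord α).continuousOn
    fun _ hr => h.chord_ne_zero α hr

theorem intervalIntegrable_div_chord (h : IsPeriodicCurve s ζ) {g : ℝ → ℂ} (hg : Continuous g)
    (α : ℝ) {a b : ℝ} (hab : (0 : ℝ) ∉ uIcc a b) :
    IntervalIntegrable (fun r => g (α + r) / chord ζ α r) volume a b :=
  ((h.continuousOn_div_chord hg α).mono fun r hr h0 => hab (by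
    rw [mem_singleton_iff] at h0; rwa [← h0])).intervalIntegrable

/-- The part of the Cauchy integral at a parameter distance between `π` and `R`. -/
def farPart (ζ : ℝ → ℂ) (g : ℝ → ℂ) (α R : ℝ) : ℂ :=
  (∫ r in π..R, g (α + r) / chord ζ α r) + ∫ r in (-R)..(-π), g (α + r) / chord ζ α r

theorem farPart_sub (h : IsPeriodicCurve s ζ) {g : ℝ → ℂ} (hg : Continuous g) (α : ℝ) {R S : ℝ}
    (hR : π ≤ R) (hS : R ≤ S) : farPart ζ g α S - farPart ζ g α R
      = (∫ r in R..S, g (α + r) / chord ζ α r) + ∫ r in (-S)..(-R), g (α + r) / chord ζ α r := by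
  have hpi := Real.pi_pos
  have h1 := intervalIntegral.integral_add_adjacent_intervals
    (h.intervalIntegrable_div_chord hg α (a := π) (b := R)
      (fun h0 => by rw [uIcc_of_le hR] at h0; linarith [h0.1]))
    (h.intervalIntegrable_div_chord hg α (a := R) (b := S)
      (fun h0 => by rw [uIcc_of_le hS] at h0; linarith [h0.1]))
  have h2 := intervalIntegral.integral_add_adjacent_intervals
    (h.intervalIntegrable_div_chord hg α (a := -S) (b := -R)
      (fun h0 => by rw [uIcc_of_le (by linarith)] at h0; linarith [h0.2]))
    (h.intervalIntegrable_div_chord hg α (a := -R) (b := -π)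
      (fun h0 => by rw [uIcc_of_le (by linarith)] at h0; linarith [h0.2]))
  rw [farPart, farPart, ← h1, ← h2]
  ring

theorem integral_div_chord_shift (h : IsPeriodicCurve s ζ) {g : ℝ → ℂ}
    (hgp : Function.Periodic g (2 * π)) (α : ℝ) (n : ℤ) :
    ∫ r in (n * (2 * π) - π)..(n * (2 * π) + π), g (α + r) / chord ζ α r
      = ∫ r in (-π)..π, g (α + r) / (chord ζ α r - ((s * (n * (2 * π)) : ℝ) : ℂ)) := by
  have h1 := intervalIntegral.integral_comp_add_right (a := -π) (b := π)
    (fun r => g (α + r) / chord ζ α r) (n * (2 * π))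
  rw [show -π + n * (2 * π) = n * (2 * π) - π by ring,
    show π + n * (2 * π) = n * (2 * π) + π by ring] at h1
  rw [← h1]
  refine intervalIntegral.integral_congr fun r _ => ?_
  have h2 := (hgp.int_mul n) (α + r)
  rw [h.chord_add_int_mul, ← add_assoc, h2]

theorem chord_ne_lattice (h : IsPeriodicCurve s ζ) (α : ℝ) {r : ℝ} (hr : r ∈ Icc (-π) π) (n : ℤ)
    (hn : n ≠ 0) : chord ζ α r ≠ ((n * (2 * π) : ℝ) : ℂ) := by
  intro he
  have h3 : |α + r - α| < 2 * π := by
    rw [add_sub_cancel_left]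
    exact (abs_le.2 hr).trans_lt (by linarith [Real.pi_pos])
  exact hn (h.eq_of_sub_eq_lattice h3 he).2

/-- At R = (2n + 1)π the far part consists of n complete periods on either side. Shifting them back
to [−π, π] gives the pairs of the cotangent series; the central term 1/chord is missing because that
period is the near part. -/
theorem farPart_odd (h : IsPeriodicCurve s ζ) {g : ℝ → ℂ} (hg : Continuous g)
    (hgp : Function.Periodic g (2 * π)) (α : ℝ) (n : ℕ) :
    IntervalIntegrable
        (fun r => (partialKernel n (chord ζ α r) - 1 / chord ζ α r) * g (α + r)) volume (-π) π ∧
      farPart ζ g α ((2 * n + 1) * π)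
        = ∫ r in (-π)..π, (partialKernel n (chord ζ α r) - 1 / chord ζ α r) * g (α + r) := by
  have hpi := Real.pi_pos
  have hch := h.continuous_chord α
  have hcont : ∀ k : ℤ, k ≠ 0 → ContinuousOn
      (fun r => g (α + r) / (chord ζ α r - ((s * (k * (2 * π)) : ℝ) : ℂ))) (uIcc (-π) π) := by
    intro k hk
    rw [uIcc_of_le (by linarith)]
    refine ContinuousOn.div (by fun_prop) (by fun_prop) fun r hr h0 => ?_
    rcases h.orientation with rfl | rfl
    · exact h.chord_ne_lattice α hr k hk (by rw [sub_eq_zero.1 h0, one_mul])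
    · exact h.chord_ne_lattice α hr (-k) (neg_ne_zero.2 hk) (by
        rw [sub_eq_zero.1 h0]; push_cast; ring)
  induction n with
  | zero => simp [farPart, partialKernel]
  | succ n ih =>
    obtain ⟨hik, ih⟩ := ih
    have h1 := h.farPart_sub hg α (R := (2 * n + 1) * π) (S := (2 * (n + 1 : ℕ) + 1) * π)
      (by nlinarith [(Nat.cast_nonneg n : (0 : ℝ) ≤ n)]) (by push_cast; nlinarith)
    have h2 := h.integral_div_chord_shift hgp α (n + 1)
    have h3 := h.integral_div_chord_shift hgp α (-(n + 1))
    rw [show (((n : ℤ) + 1 : ℤ) : ℝ) * (2 * π) - π = (2 * n + 1) * π by push_cast; ring,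
      show (((n : ℤ) + 1 : ℤ) : ℝ) * (2 * π) + π = (2 * (n + 1 : ℕ) + 1) * π by
        push_cast; ring] at h2
    rw [show ((-((n : ℤ) + 1) : ℤ) : ℝ) * (2 * π) - π = -((2 * (n + 1 : ℕ) + 1) * π) by
        push_cast; ring,
      show ((-((n : ℤ) + 1) : ℤ) : ℝ) * (2 * π) + π = -((2 * n + 1) * π) by
        push_cast; ring] at h3
    have hi1 := (hcont (n + 1) (by omega)).intervalIntegrable (μ := volume)
    have hi2 := (hcont (-(n + 1)) (by omega)).intervalIntegrable (μ := volume)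
    -- For s = −1 the two members of the pair trade places, and the sum is the same.
    have hterm : ∀ r, g (α + r) / (chord ζ α r - ((s * ((((n : ℤ) + 1 : ℤ) : ℝ) * (2 * π)) : ℝ) : ℂ))
        + g (α + r) / (chord ζ α r - ((s * (((-((n : ℤ) + 1) : ℤ) : ℝ) * (2 * π)) : ℝ) : ℂ))
        = latticeTerm n (chord ζ α r) * g (α + r) := by
      intro r
      rw [latticeTerm]
      rcases h.orientation with rfl | rfl
      · rw [show (1 : ℝ) * ((((n : ℤ) + 1 : ℤ) : ℝ) * (2 * π)) = 2 * π * (n + 1) by push_cast; ring,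
          show (1 : ℝ) * (((-((n : ℤ) + 1) : ℤ) : ℝ) * (2 * π)) = -(2 * π * (n + 1)) by
            push_cast; ring, Complex.ofReal_neg, sub_neg_eq_add]
        ring
      · rw [show (-1 : ℝ) * ((((n : ℤ) + 1 : ℤ) : ℝ) * (2 * π)) = -(2 * π * (n + 1)) by
            push_cast; ring,
          show (-1 : ℝ) * (((-((n : ℤ) + 1) : ℤ) : ℝ) * (2 * π)) = 2 * π * (n + 1) by
            push_cast; ring, Complex.ofReal_neg, sub_neg_eq_add]
        ring
    have hnext : ∀ r, (g (α + r) / (chord ζ α r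
          - ((s * ((((n : ℤ) + 1 : ℤ) : ℝ) * (2 * π)) : ℝ) : ℂ))
        + g (α + r) / (chord ζ α r - ((s * (((-((n : ℤ) + 1) : ℤ) : ℝ) * (2 * π)) : ℝ) : ℂ)))
        + (partialKernel n (chord ζ α r) - 1 / chord ζ α r) * g (α + r)
        = (partialKernel (n + 1) (chord ζ α r) - 1 / chord ζ α r) * g (α + r) := by
      intro r
      rw [hterm, partialKernel, partialKernel, Finset.sum_range_succ]
      ring
    refine ⟨((hi1.add hi2).add hik).congr fun r _ => hnext r, ?_⟩
    rw [← sub_add_cancel (farPart ζ g α ((2 * (n + 1 : ℕ) + 1) * π))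
      (farPart ζ g α ((2 * n + 1) * π)), h1, h2, h3, ih,
      ← intervalIntegral.integral_add hi1 hi2, ← intervalIntegral.integral_add (hi1.add hi2) hik]
    refine intervalIntegral.integral_congr fun r _ => ?_
    exact hnext r

/-- The chord grows linearly in the parameter while the periodic g stays bounded. -/
theorem norm_div_chord_le (h : IsPeriodicCurve s ζ) {g : ℝ → ℂ} (hg : Continuous g)
    (hgp : Function.Periodic g (2 * π)) (α : ℝ) {ε : ℝ} (hε : 0 < ε) :
    ∃ R, ∀ r, R ≤ |r| → ‖g (α + r) / chord ζ α r‖ ≤ ε := by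
  obtain ⟨D, hD⟩ := (hgp.isBounded_of_continuous Real.two_pi_pos.ne' hg).exists_norm_le
  obtain ⟨C, hC0, hC⟩ := h.exists_abs_re_sub_le
  have hD0 : 0 ≤ D := (norm_nonneg _).trans (hD _ ⟨0, rfl⟩)
  refine ⟨2 * C + D / ε + 1, fun r hr => ?_⟩
  have h1 : |r| - 2 * C ≤ ‖chord ζ α r‖ := by
    refine le_trans ?_ (Complex.abs_re_le_norm _)
    have e : s * r = ((ζ α).re - s * α) - ((ζ (α + r)).re - s * (α + r)) - (chord ζ α r).re := by
      rw [chord, Complex.sub_re]; ring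
    have h2 : |r| = |s * r| := by rw [abs_mul, h.abs_orientation, one_mul]
    rw [h2, e]
    have h3 := abs_sub (((ζ α).re - s * α) - ((ζ (α + r)).re - s * (α + r))) (chord ζ α r).re
    have h4 := abs_sub ((ζ α).re - s * α) ((ζ (α + r)).re - s * (α + r))
    linarith [hC α, hC (α + r)]
  have h5 : D / ε < ‖chord ζ α r‖ := by linarith
  have h6 : 0 < ‖chord ζ α r‖ := lt_of_le_of_lt (by positivity) h5
  rw [norm_div, div_le_iff₀ h6]
  rw [div_lt_iff₀ hε] at h5
  linarith [hD _ ⟨α + r, rfl⟩]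

/-- The two kernels differ by a bounded function near the diagonal. -/
theorem exists_norm_partialKernel_chord_le (h : IsPeriodicCurve s ζ) (α : ℝ) :
    ∃ C, ∀ r ∈ Icc (-π) π,
      (∀ n, ‖partialKernel n (chord ζ α r) - 1 / chord ζ α r‖ ≤ C) ∧
      ‖periodicKernel (chord ζ α r) - 1 / chord ζ α r‖ ≤ C := by
  obtain ⟨C, hC⟩ := exists_norm_partialKernel_sub_le
    (isCompact_Icc.image (h.continuous_chord α) : IsCompact (chord ζ α '' Icc (-π) π)) (by
      rintro _ ⟨r, hr, rfl⟩ n hn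
      exact h.chord_ne_lattice α hr n hn)
  refine ⟨C, fun r hr => ⟨fun n => hC n _ ⟨r, hr, rfl⟩, ?_⟩⟩
  have ht := (tendsto_partialKernel (h.chord_ne_lattice α hr)).sub_const (1 / chord ζ α r)
  exact le_of_tendsto ht.norm (Eventually.of_forall fun n => hC n _ ⟨r, hr, rfl⟩)

/-- Along odd multiples of π this is dominated convergence of the cotangent series. Between them,
two intervals of length at most 2π are left, on which the integrand tends to 0. -/
theorem tendsto_farPart (h : IsPeriodicCurve s ζ) {g : ℝ → ℂ} (hg : Continuous g)
    (hgp : Function.Periodic g (2 * π)) (α : ℝ) :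
    Tendsto (farPart ζ g α) atTop (𝓝 (∫ r in (-π)..π,
      (periodicKernel (chord ζ α r) - 1 / chord ζ α r) * g (α + r))) := by
  have hpi := Real.pi_pos
  obtain ⟨C, hC⟩ := h.exists_norm_partialKernel_chord_le α
  have t1 : Tendsto (fun n : ℕ => farPart ζ g α ((2 * n + 1) * π)) atTop (𝓝 (∫ r in (-π)..π,
      (periodicKernel (chord ζ α r) - 1 / chord ζ α r) * g (α + r))) := by
    simp only [(h.farPart_odd hg hgp α _).2]
    have hu : uIoc (-π) π ⊆ Icc (-π) π := by
      rw [uIoc_of_le (by linarith)]; exact Ioc_subset_Icc_self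
    refine intervalIntegral.tendsto_integral_filter_of_dominated_convergence
      (fun r => C * ‖g (α + r)‖) (Eventually.of_forall fun n => ?_)
      (Eventually.of_forall fun n => ae_of_all _ fun r hr => ?_) ?_ (ae_of_all _ fun r hr => ?_)
    · exact ((intervalIntegrable_iff.1 (h.farPart_odd hg hgp α n).1)).aestronglyMeasurable
    · rw [norm_mul]
      gcongr
      exact (hC r (hu hr)).1 n
    · exact Continuous.intervalIntegrable (by fun_prop) _ _
    · exact ((tendsto_partialKernel (h.chord_ne_lattice α (hu hr))).sub_const _).mul_const _
  have t2 := t1.comp tendsto_periodCount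
  have t3 : Tendsto (fun R => farPart ζ g α R - farPart ζ g α ((2 * periodCount R + 1) * π))
      atTop (𝓝 0) := by
    rw [Metric.tendsto_nhds]
    intro ε hε
    obtain ⟨R₀, hR₀⟩ := h.norm_div_chord_le hg hgp α (ε := ε / (4 * π + 1)) (by positivity)
    filter_upwards [eventually_ge_atTop (max π (R₀ + 2 * π))] with R hR
    have h1 := periodCount_le ((le_max_left _ _).trans hR)
    have h2 := lt_periodCount R
    have h3 : R₀ + 2 * π ≤ R := (le_max_right _ _).trans hR
    set S := (2 * (periodCount R : ℝ) + 1) * π with hS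
    have hS1 : π ≤ S := by nlinarith [(Nat.cast_nonneg (periodCount R) : (0 : ℝ) ≤ _)]
    rw [dist_zero_right, h.farPart_sub hg α hS1 h1]
    have b1 : ‖∫ r in S..R, g (α + r) / chord ζ α r‖ ≤ ε / (4 * π + 1) * |R - S| := by
      refine intervalIntegral.norm_integral_le_of_norm_le_const fun r hr => hR₀ r ?_
      rw [uIoc_of_le h1] at hr
      rw [abs_of_pos (by linarith [hr.1])]
      linarith [hr.1]
    have b2 : ‖∫ r in (-R)..(-S), g (α + r) / chord ζ α r‖ ≤ ε / (4 * π + 1) * |-S - -R| := by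
      refine intervalIntegral.norm_integral_le_of_norm_le_const fun r hr => hR₀ r ?_
      rw [uIoc_of_le (by linarith)] at hr
      rw [abs_of_neg (by linarith [hr.2])]
      linarith [hr.2]
    rw [abs_of_nonneg (by linarith)] at b1 b2
    have hε' : 0 < ε / (4 * π + 1) := by positivity
    calc _ ≤ ε / (4 * π + 1) * (R - S) + ε / (4 * π + 1) * (-S - -R) :=
          (norm_add_le _ _).trans (add_le_add b1 b2)
      _ = ε / (4 * π + 1) * (2 * (R - S)) := by ring
      _ ≤ ε / (4 * π + 1) * (4 * π) := mul_le_mul_of_nonneg_left (by linarith) hε'.le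
      _ < ε / (4 * π + 1) * (4 * π + 1) := by nlinarith
      _ = ε := by field_simp
  have t4 := t3.add t2
  rw [zero_add] at t4
  exact t4.congr fun R => by simp only [Function.comp]; ring

theorem integrableOn_div_chord (h : IsPeriodicCurve s ζ) {g : ℝ → ℂ} (hg : Continuous g) (α : ℝ)
    {δ : ℝ} (hδ : 0 < δ) (R : ℝ) :
    IntegrableOn (fun r => g (α + r) / chord ζ α r) {r | δ < |r| ∧ |r| < R} := by
  have hc : IsCompact (Icc (-R) R ∩ {r | δ ≤ |r|}) :=
    isCompact_Icc.inter_right (isClosed_le continuous_const continuous_abs)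
  refine (((h.continuousOn_div_chord hg α).mono ?_).integrableOn_compact hc).mono_set ?_
  · rintro r ⟨-, hr⟩ h0
    rw [mem_singleton_iff] at h0
    rw [h0] at hr
    have hr' : δ ≤ |(0 : ℝ)| := hr
    rw [abs_zero] at hr'
    linarith
  · rintro r ⟨h1, h2⟩
    exact ⟨abs_le.1 h2.le, h1.le⟩

theorem integral_truncated_eq (h : IsPeriodicCurve s ζ) {g : ℝ → ℂ} (hg : Continuous g) (α : ℝ)
    {δ R : ℝ} (hδ : 0 < δ) (hδπ : δ < π) (hR : π ≤ R) :
    ∫ r in {r | δ < |r| ∧ |r| < R}, g (α + r) / chord ζ α r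
      = (∫ r in (-π)..π, if δ < |r| then g (α + r) / chord ζ α r else 0) + farPart ζ g α R := by
  have hpi := Real.pi_pos
  set ψ : ℝ → ℂ := fun r => if δ < |r| then g (α + r) / chord ζ α r else 0 with hψ
  have hm : MeasurableSet {r : ℝ | δ < |r| ∧ |r| < R + 1} :=
    ((isOpen_lt continuous_const continuous_abs).inter
      (isOpen_lt continuous_abs continuous_const)).measurableSet
  have hm' : MeasurableSet {r : ℝ | δ < |r| ∧ |r| < R} :=
    ((isOpen_lt continuous_const continuous_abs).inter
      (isOpen_lt continuous_abs continuous_const)).measurableSet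
  have hi : IntegrableOn ψ (Icc (-R) R) := by
    have h1 := (integrable_indicator_iff hm).2 (h.integrableOn_div_chord hg α hδ (R + 1))
    refine (h1.integrableOn (s := Icc (-R) R)).congr_fun (fun r hr => ?_) measurableSet_Icc
    have h2 := abs_le.2 hr
    by_cases h3 : δ < |r|
    · have h4 : r ∈ {r : ℝ | δ < |r| ∧ |r| < R + 1} := ⟨h3, by linarith⟩
      rw [indicator_of_mem h4]
      simp only [hψ, if_pos h3]
    · rw [indicator_of_notMem fun h4 => h3 h4.1]
      simp only [hψ, if_neg h3]
  have hii : ∀ a b : ℝ, -R ≤ a → a ≤ b → b ≤ R → IntervalIntegrable ψ volume a b := by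
    intro a b h1 h2 h3
    rw [intervalIntegrable_iff_integrableOn_Ioc_of_le h2]
    exact hi.mono_set fun r hr => ⟨by linarith [hr.1], by linarith [hr.2]⟩
  have e1 : ∫ r in {r | δ < |r| ∧ |r| < R}, g (α + r) / chord ζ α r = ∫ r in (-R)..R, ψ r := by
    rw [intervalIntegral.integral_of_le (by linarith), integral_Ioc_eq_integral_Ioo,
      ← integral_indicator hm', ← integral_indicator measurableSet_Ioo]
    congr 1
    funext r
    by_cases h1 : |r| < R
    · have h2 : r ∈ Ioo (-R) R := abs_lt.1 h1
      rw [indicator_of_mem h2]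
      by_cases h3 : δ < |r|
      · have h4 : r ∈ {r : ℝ | δ < |r| ∧ |r| < R} := ⟨h3, h1⟩
        rw [indicator_of_mem h4]
        simp only [hψ, if_pos h3]
      · rw [indicator_of_notMem fun h4 => h3 h4.1]
        simp only [hψ, if_neg h3]
    · have h2 : r ∉ Ioo (-R) R := fun h2 => h1 (abs_lt.2 h2)
      rw [indicator_of_notMem h2, indicator_of_notMem fun h4 => h1 h4.2]
  have e2 : ∫ r in π..R, ψ r = ∫ r in π..R, g (α + r) / chord ζ α r := by
    refine intervalIntegral.integral_congr fun r hr => ?_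
    rw [uIcc_of_le hR] at hr
    have : δ < |r| := by rw [abs_of_pos (by linarith [hr.1])]; linarith [hr.1]
    simp only [hψ, if_pos this]
  have e3 : ∫ r in (-R)..(-π), ψ r = ∫ r in (-R)..(-π), g (α + r) / chord ζ α r := by
    refine intervalIntegral.integral_congr fun r hr => ?_
    rw [uIcc_of_le (by linarith)] at hr
    have : δ < |r| := by rw [abs_of_neg (by linarith [hr.2])]; linarith [hr.2]
    simp only [hψ, if_pos this]
  rw [e1, farPart, ← e2, ← e3, ← intervalIntegral.integral_add_adjacent_intervals
      (hii (-R) (-π) le_rfl (by linarith) (by linarith))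
      (hii (-π) R (by linarith) (by linarith) le_rfl),
    ← intervalIntegral.integral_add_adjacent_intervals
      (hii (-π) π (by linarith) (by linarith) hR) (hii π R (by linarith) hR le_rfl)]
  ring

/-- The principal value of the Cauchy integral, in both truncation parameters. -/
theorem tendsto_integral_truncated (h : IsPeriodicCurve s ζ) {g : ℝ → ℂ} (hg : Continuous g)
    (hgp : Function.Periodic g (2 * π)) {α : ℝ} {L : ℂ}
    (hL : Tendsto (fun δ => ∫ β in (α - π)..(α + π), regKernel δ (ζ α - ζ β) * g β)
      (𝓝[>] 0) (𝓝 L)) :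
    Tendsto (fun r : ℝ × ℝ => ∫ t in {t | r.1 < |t| ∧ |t| < r.2}, g (α + t) / chord ζ α t)
      (𝓝[>] 0 ×ˢ atTop) (𝓝 L) := by
  have hpi := Real.pi_pos
  obtain ⟨C, hC⟩ := h.exists_norm_partialKernel_chord_le α
  have hch := h.continuous_chord α
  -- The difference of the two kernels is bounded near the diagonal, so it contributes an ordinary
  -- integral and the same integral, with opposite sign, is what the far part supplies.
  set k : ℝ → ℂ := fun r => (periodicKernel (chord ζ α r) - 1 / chord ζ α r) * g (α + r) with hk
  have hkm : Measurable k := by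
    refine ((measurable_periodicKernel.comp hch.measurable).sub ?_).mul
      (hg.measurable.comp (by fun_prop))
    exact measurable_const.div hch.measurable
  have hu : uIoc (-π) π ⊆ Icc (-π) π := by
    rw [uIoc_of_le (by linarith)]; exact Ioc_subset_Icc_self
  have hgi : IntervalIntegrable (fun r => C * ‖g (α + r)‖) volume (-π) π :=
    Continuous.intervalIntegrable (by fun_prop) _ _
  have hbound : ∀ r ∈ Icc (-π) π, ‖k r‖ ≤ C * ‖g (α + r)‖ := by
    intro r hr
    rw [hk, norm_mul]
    gcongr
    exact (hC r hr).2
  have t1 : Tendsto (fun δ : ℝ => ∫ r in (-π)..π, if δ < |r| then k r else 0) (𝓝[>] 0)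
      (𝓝 (∫ r in (-π)..π, k r)) := by
    refine intervalIntegral.tendsto_integral_filter_of_dominated_convergence
      (fun r => C * ‖g (α + r)‖) (Eventually.of_forall fun δ => ?_)
      (Eventually.of_forall fun δ => ae_of_all _ fun r hr => ?_) hgi ?_
    · exact (Measurable.ite (measurableSet_lt measurable_const (by fun_prop)) hkm
        measurable_const).aestronglyMeasurable
    · split_ifs
      · exact hbound r (hu hr)
      · rw [norm_zero]
        exact (norm_nonneg _).trans (hbound r (hu hr))
    · refine (Measure.ae_ne volume (0 : ℝ)).mono fun r hr _ => tendsto_const_nhds.congr' ?_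
      filter_upwards [Ioo_mem_nhdsGT (abs_pos.2 hr)] with δ hδ
      rw [if_pos hδ.2]
  have t2 := h.tendsto_integral_sharp hg hL
  have t3 : Tendsto (fun δ : ℝ => ∫ r in (-π)..π,
      if δ < |r| then g (α + r) / chord ζ α r else 0) (𝓝[>] 0)
      (𝓝 (L - ∫ r in (-π)..π, k r)) := by
    refine (t2.sub t1).congr' ?_
    filter_upwards [self_mem_nhdsWithin] with δ hδ
    have hδ' : (0 : ℝ) < δ := hδ
    have hi1 : IntervalIntegrable (fun r => if δ < |r| then k r else 0) volume (-π) π := by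
      refine hgi.mono_fun' ?_ ?_
      · exact (Measurable.ite (measurableSet_lt measurable_const (by fun_prop)) hkm
          measurable_const).aestronglyMeasurable
      · filter_upwards [ae_restrict_mem measurableSet_uIoc] with r hr
        split_ifs
        · exact hbound r (hu hr)
        · rw [norm_zero]
          exact (norm_nonneg _).trans (hbound r (hu hr))
    have hi2 : IntervalIntegrable (fun r => if δ < |r| then g (α + r) / chord ζ α r else 0)
        volume (-π) π := by
      rw [intervalIntegrable_iff_integrableOn_Ioc_of_le (by linarith)]
      have hm : MeasurableSet {r : ℝ | δ < |r| ∧ |r| < π + 1} :=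
        ((isOpen_lt continuous_const continuous_abs).inter
          (isOpen_lt continuous_abs continuous_const)).measurableSet
      have h1 := (integrable_indicator_iff hm).2 (h.integrableOn_div_chord hg α hδ' (π + 1))
      refine (h1.integrableOn (s := Ioc (-π) π)).congr_fun (fun r hr => ?_) measurableSet_Ioc
      have h2 := abs_le.2 (Ioc_subset_Icc_self hr)
      by_cases h3 : δ < |r|
      · have h4 : r ∈ {r : ℝ | δ < |r| ∧ |r| < π + 1} := ⟨h3, by linarith⟩
        rw [indicator_of_mem h4]
        simp only [if_pos h3]
      · rw [indicator_of_notMem fun h4 => h3 h4.1]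
        simp only [if_neg h3]
    have e : ∀ r : ℝ, (if δ < |r| then periodicKernel (chord ζ α r) * g (α + r) else 0)
        = (if δ < |r| then g (α + r) / chord ζ α r else 0) + if δ < |r| then k r else 0 := by
      intro r
      split_ifs
      · simp only [hk]; ring
      · simp
    simp only [e]
    rw [intervalIntegral.integral_add hi2 hi1, add_sub_cancel_right]
  -- The near part depends on δ alone and the far part on R alone, so the limit exists along the
  -- product filter, without any relation between δ and R.
  have t4 := (t3.comp tendsto_fst).add
    ((h.tendsto_farPart hg hgp α).comp (tendsto_snd (f := 𝓝[>] (0 : ℝ))))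
  rw [sub_add_cancel] at t4
  refine t4.congr' ?_
  have hev : ∀ᶠ r : ℝ × ℝ in 𝓝[>] 0 ×ˢ atTop, r.1 ∈ Ioo 0 π ∧ π ≤ r.2 :=
    Eventually.prod_mk (pa := fun δ : ℝ => δ ∈ Ioo 0 π) (pb := fun R : ℝ => π ≤ R)
      (Ioo_mem_nhdsGT hpi) (eventually_ge_atTop π)
  filter_upwards [hev] with r hr
  exact (h.integral_truncated_eq hg α hr.1.1 hr.1.2 hr.2).symm

end IsPeriodicCurve

end

section

/-! ### The truncated area integral -/

/-- The window made of the `2n + 1` period cells around `x`. -/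
def window (x : ℂ) (n : ℕ) : Set ℂ :=
  {y | x.re - (2 * n + 1) * π ≤ y.re ∧ y.re < x.re + (2 * n + 1) * π}

theorem measurableSet_window (x : ℂ) (n : ℕ) : MeasurableSet (window x n) :=
  (measurableSet_le measurable_const Complex.measurable_re).inter
    (measurableSet_lt Complex.measurable_re measurable_const)

/-- The `k`-th translate of the period cell centred at `x`. -/
def shiftCell (x : ℂ) (k : ℤ) : Set ℂ := cell (x + ((k * (2 * π) : ℝ) : ℂ))

theorem mem_shiftCell {x y : ℂ} {k : ℤ} : y ∈ shiftCell x k ↔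
    x.re + k * (2 * π) - π ≤ y.re ∧ y.re < x.re + k * (2 * π) + π := by
  simp [shiftCell, cell]

theorem window_succ (x : ℂ) (n : ℕ) : window x (n + 1)
    = (shiftCell x (n + 1) ∪ shiftCell x (-(n + 1))) ∪ window x n := by
  have hpi := Real.pi_pos
  have hn : (0 : ℝ) ≤ n * π := by positivity
  ext y
  simp only [mem_union, mem_shiftCell, window, mem_ofPred]
  push_cast
  constructor
  · rintro ⟨h1, h2⟩
    by_cases h3 : x.re - (2 * n + 1) * π ≤ y.re
    · by_cases h4 : y.re < x.re + (2 * n + 1) * π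
      · exact Or.inr ⟨h3, h4⟩
      · exact Or.inl (Or.inl ⟨by linarith, by linarith⟩)
    · exact Or.inl (Or.inr ⟨by linarith, by linarith⟩)
  · rintro ((⟨h1, h2⟩ | ⟨h1, h2⟩) | ⟨h1, h2⟩) <;> constructor <;> linarith

theorem disjoint_shiftCell_neg (x : ℂ) (n : ℕ) :
    Disjoint (shiftCell x (n + 1)) (shiftCell x (-(n + 1))) := by
  have hpi := Real.pi_pos
  have hn : (0 : ℝ) ≤ n * π := by positivity
  rw [disjoint_left]
  intro y h1 h2
  rw [mem_shiftCell] at h1 h2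
  push_cast at h1 h2
  linarith [h1.1, h2.2]

theorem disjoint_shiftCell_window (x : ℂ) (n : ℕ) :
    Disjoint (shiftCell x (n + 1) ∪ shiftCell x (-(n + 1))) (window x n) := by
  rw [disjoint_left]
  rintro y (h1 | h1) h2 <;> rw [mem_shiftCell] at h1 <;> push_cast at h1
  · linarith [h1.1, h2.2]
  · linarith [h1.2, h2.1]

variable {Ω : Set ℂ}

namespace IsPeriodicSet

theorem preimage_shiftCell (hp : IsPeriodicSet Ω) (x : ℂ) (k : ℤ) :
    (fun y : ℂ => y + ((k * (2 * π) : ℝ) : ℂ)) ⁻¹' (Ω ∩ shiftCell x k) = Ω ∩ cell x := by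
  ext y
  simp only [mem_preimage, mem_inter_iff, hp.add_mem_iff, mem_shiftCell, cell, Complex.add_re,
    Complex.ofReal_re, mem_ofPred]
  refine and_congr_right fun _ => ?_
  constructor <;> rintro ⟨h1, h2⟩ <;> constructor <;> linarith

theorem setIntegral_shiftCell {E : Type*} [NormedAddCommGroup E] [NormedSpace ℝ E]
    (hp : IsPeriodicSet Ω) (x : ℂ) (k : ℤ) (F : ℂ → E) :
    ∫ y in Ω ∩ shiftCell x k, F y = ∫ y in Ω ∩ cell x, F (y + ((k * (2 * π) : ℝ) : ℂ)) := by
  rw [← (measurePreserving_add_right volume ((k * (2 * π) : ℝ) : ℂ)).setIntegral_preimage_emb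
    (measurableEmbedding_addRight _), hp.preimage_shiftCell]

theorem integrableOn_shiftCell {E : Type*} [NormedAddCommGroup E]
    (hp : IsPeriodicSet Ω) (x : ℂ) (k : ℤ) {F : ℂ → E} :
    IntegrableOn F (Ω ∩ shiftCell x k) ↔
      IntegrableOn (fun y => F (y + ((k * (2 * π) : ℝ) : ℂ))) (Ω ∩ cell x) := by
  rw [← (measurePreserving_add_right volume ((k * (2 * π) : ℝ) : ℂ)).integrableOn_comp_preimage
    (measurableEmbedding_addRight _), hp.preimage_shiftCell]
  rfl

end IsPeriodicSet

/-- A density on `Ω`, periodic, integrable over a period, and bounded near the point `x`. -/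
structure IsPeriodicDensity (Ω : Set ℂ) (x : ℂ) (g : ℂ → ℂ) : Prop where
  measurableSet : MeasurableSet Ω
  isPeriodicSet : IsPeriodicSet Ω
  periodic : ∀ y ∈ Ω, g (y + ((2 * π : ℝ) : ℂ)) = g y
  integrable : IntegrableOn g (Ω ∩ cell x)
  bounded : ∃ C, ∀ᶠ y in 𝓝[Ω] x, ‖g y‖ ≤ C

namespace IsPeriodicDensity

variable {x : ℂ} {g : ℂ → ℂ}

theorem apply_add (h : IsPeriodicDensity Ω x g) (k : ℤ) {y : ℂ} (hy : y ∈ Ω) :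
    g (y + ((k * (2 * π) : ℝ) : ℂ)) = g y :=
  h.isPeriodicSet.add_int_mul h.periodic k hy

theorem measurableSet_cell (h : IsPeriodicDensity Ω x g) : MeasurableSet (Ω ∩ cell x) :=
  h.measurableSet.inter (TwoFluid.measurableSet_cell x)

theorem measurableSet_shiftCell (h : IsPeriodicDensity Ω x g) (k : ℤ) :
    MeasurableSet (Ω ∩ shiftCell x k) :=
  h.measurableSet.inter (TwoFluid.measurableSet_cell _)

theorem integrableOn_shiftCell (h : IsPeriodicDensity Ω x g) (k : ℤ) :
    IntegrableOn g (Ω ∩ shiftCell x k) := by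
  rw [h.isPeriodicSet.integrableOn_shiftCell]
  exact h.integrable.congr_fun (fun y hy => (h.apply_add k hy.1).symm) h.measurableSet_cell

theorem integrableOn_window (h : IsPeriodicDensity Ω x g) (n : ℕ) :
    IntegrableOn g (Ω ∩ window x n) := by
  induction n with
  | zero =>
    refine h.integrable.mono_set (inter_subset_inter_right _ fun y hy => ?_)
    have h1 := hy.1
    have h2 := hy.2
    norm_num at h1 h2
    exact ⟨by linarith, h2⟩
  | succ n ih =>
    rw [window_succ, inter_union_distrib_left, inter_union_distrib_left]
    exact ((h.integrableOn_shiftCell _).union (h.integrableOn_shiftCell _)).union ih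

theorem integrableOn_div (h : IsPeriodicDensity Ω x g) (n : ℕ) :
    IntegrableOn (fun y => g y / (x - y)) (Ω ∩ window x n) := by
  have hm := h.measurableSet.inter (measurableSet_window x n)
  obtain ⟨C, hC⟩ := h.bounded
  have h1 := integrableOn_inv_norm_mul hm (h.integrableOn_window n)
    ⟨C, nhdsWithin_mono x inter_subset_left hC⟩
  refine h1.mono' ?_ (ae_of_all _ fun y => ?_)
  · have h2 : Measurable fun y : ℂ => (x - y)⁻¹ := by fun_prop
    simp only [div_eq_mul_inv]
    exact (h.integrableOn_window n).aestronglyMeasurable.mul h2.aestronglyMeasurable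
  · rw [norm_div, div_eq_inv_mul]

theorem setOf_abs_lt_subset (x : ℂ) {R : ℝ} :
    {y : ℂ | |y.re - x.re| < R} ⊆ window x (periodCount R + 1) := by
  intro y hy
  have hy' : |y.re - x.re| < R := hy
  have h1 := abs_lt.1 hy'
  have h2 := lt_periodCount R
  constructor <;> push_cast <;> linarith

theorem integrableOn_div_abs_lt (h : IsPeriodicDensity Ω x g) (R : ℝ) :
    IntegrableOn (fun y => g y / (x - y)) (Ω ∩ {y | |y.re - x.re| < R}) :=
  (h.integrableOn_div _).mono_set (inter_subset_inter_right _ (setOf_abs_lt_subset x))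

/-- Each pair of outer cells, shifted back onto the central one, adds one pair of lattice terms to
the kernel. -/
theorem setIntegral_window (h : IsPeriodicDensity Ω x g) (n : ℕ) :
    IntegrableOn (fun y => partialKernel n (x - y) * g y) (Ω ∩ cell x) ∧
    ∫ y in Ω ∩ window x n, g y / (x - y)
      = ∫ y in Ω ∩ cell x, partialKernel n (x - y) * g y := by
  have hw0 : window x 0 = cell x := by
    ext y
    simp [window, cell]
  induction n with
  | zero =>
    have e : ∀ y, g y / (x - y) = partialKernel 0 (x - y) * g y := by
      intro y
      simp [partialKernel, div_eq_inv_mul]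
    have hi := h.integrableOn_div 0
    rw [hw0] at hi ⊢
    simp only [← e]
    exact ⟨hi, trivial⟩
  | succ n ih =>
    obtain ⟨hi, ih⟩ := ih
    have hsub : ∀ k : ℤ, k = n + 1 ∨ k = -(n + 1) →
        Ω ∩ shiftCell x k ⊆ Ω ∩ window x (n + 1) := by
      rintro k hk
      refine inter_subset_inter_right _ ?_
      rw [window_succ]
      refine subset_trans ?_ subset_union_left
      rcases hk with rfl | rfl
      · exact subset_union_left
      · exact subset_union_right
    have hki : ∀ k : ℤ, k = n + 1 ∨ k = -(n + 1) →
        IntegrableOn (fun y => g y / (x - y)) (Ω ∩ shiftCell x k) := fun k hk =>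
      (h.integrableOn_div (n + 1)).mono_set (hsub k hk)
    have hcongr : ∀ k : ℤ, ∀ y ∈ Ω ∩ cell x,
        g (y + ((k * (2 * π) : ℝ) : ℂ)) / (x - (y + ((k * (2 * π) : ℝ) : ℂ)))
          = g y / (x - y - ((k * (2 * π) : ℝ) : ℂ)) := by
      intro k y hy
      rw [h.apply_add k hy.1, sub_sub]
    have hki' : ∀ k : ℤ, k = n + 1 ∨ k = -(n + 1) → IntegrableOn
        (fun y => g y / (x - y - ((k * (2 * π) : ℝ) : ℂ))) (Ω ∩ cell x) := fun k hk =>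
      ((h.isPeriodicSet.integrableOn_shiftCell x k).1 (hki k hk)).congr_fun (hcongr k)
        h.measurableSet_cell
    have hint : ∀ k : ℤ, ∫ y in Ω ∩ shiftCell x k, g y / (x - y)
        = ∫ y in Ω ∩ cell x, g y / (x - y - ((k * (2 * π) : ℝ) : ℂ)) := fun k => by
      rw [h.isPeriodicSet.setIntegral_shiftCell]
      exact setIntegral_congr_fun h.measurableSet_cell (hcongr k)
    have hterm : ∀ y, (g y / (x - y - (((n + 1 : ℤ) * (2 * π) : ℝ) : ℂ))
        + g y / (x - y - (((-(n + 1) : ℤ) * (2 * π) : ℝ) : ℂ))) + partialKernel n (x - y) * g y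
        = partialKernel (n + 1) (x - y) * g y := by
      intro y
      rw [partialKernel, partialKernel, Finset.sum_range_succ, latticeTerm,
        show (((n + 1 : ℤ) : ℝ) * (2 * π)) = 2 * π * (n + 1) by push_cast; ring,
        show (((-(n + 1) : ℤ) : ℝ) * (2 * π)) = -(2 * π * (n + 1)) by push_cast; ring,
        Complex.ofReal_neg, sub_neg_eq_add]
      ring
    have h1 := hki' _ (Or.inl rfl)
    have h2 := hki' _ (Or.inr rfl)
    refine ⟨((h1.add h2).add hi).congr_fun (fun y _ => hterm y) h.measurableSet_cell, ?_⟩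
    rw [window_succ, inter_union_distrib_left, inter_union_distrib_left,
      setIntegral_union ?_ (h.measurableSet.inter (measurableSet_window x n))
        ((hki _ (Or.inl rfl)).union (hki _ (Or.inr rfl))) (h.integrableOn_div n),
      setIntegral_union ?_ (h.measurableSet_shiftCell _) (hki _ (Or.inl rfl))
        (hki _ (Or.inr rfl)), hint, hint, ih, ← integral_add h1 h2,
      ← integral_add (f := fun y => g y / (x - y - (((n + 1 : ℤ) * (2 * π) : ℝ) : ℂ))
        + g y / (x - y - (((-(n + 1) : ℤ) * (2 * π) : ℝ) : ℂ))) (h1.add h2) hi]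
    · exact integral_congr_ae (ae_of_all _ fun y => hterm y)
    · exact (disjoint_shiftCell_neg x n).mono inter_subset_right inter_subset_right
    · rw [← inter_union_distrib_left]
      exact (disjoint_shiftCell_window x n).mono inter_subset_right inter_subset_right

/-- In a cell the partial kernels stay within a constant of 1/(x − y), and g/(x − y) is integrable
since g is bounded near x; this is the domination. The limit is pointwise because the cell meets no
other pole. -/
theorem tendsto_setIntegral_window (h : IsPeriodicDensity Ω x g) :
    Tendsto (fun n => ∫ y in Ω ∩ window x n, g y / (x - y)) atTop
      (𝓝 (∫ y in Ω ∩ cell x, periodicKernel (x - y) * g y)) := by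
  have hpi := Real.pi_pos
  simp only [(h.setIntegral_window _).2]
  have hm := h.measurableSet_cell
  obtain ⟨C, hC⟩ := h.bounded
  have h1 := integrableOn_inv_norm_mul hm h.integrable
    ⟨C, nhdsWithin_mono x inter_subset_left hC⟩
  refine tendsto_integral_filter_of_dominated_convergence
    (fun y => ‖x - y‖⁻¹ * ‖g y‖ + 16 * (π + 1) * ‖g y‖)
    (Eventually.of_forall fun n => (h.setIntegral_window n).1.aestronglyMeasurable)
    (Eventually.of_forall fun n => ?_) (h1.add (h.integrable.norm.const_mul _)) ?_
  · filter_upwards [ae_restrict_mem hm] with y hy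
    have h2 := norm_partialKernel_sub_le (abs_re_sub_le_of_mem_cell hy.2) n
    have h3 : ‖partialKernel n (x - y)‖ ≤ ‖x - y‖⁻¹ + 16 * (π + 1) := by
      calc _ = ‖1 / (x - y) + (partialKernel n (x - y) - 1 / (x - y))‖ := by rw [add_sub_cancel]
        _ ≤ ‖1 / (x - y)‖ + 16 * (π + 1) := (norm_add_le _ _).trans (by gcongr)
        _ = _ := by rw [norm_div, norm_one, one_div]
    rw [norm_mul, ← add_mul]
    gcongr
  · filter_upwards [ae_restrict_mem hm] with y hy
    refine (tendsto_partialKernel fun n hn he => ?_).mul_const _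
    have h2 := abs_re_sub_le_of_mem_cell hy.2
    rw [he, Complex.ofReal_re, abs_mul, abs_of_pos Real.two_pi_pos] at h2
    have h3 : (1 : ℝ) ≤ |(n : ℝ)| := by exact_mod_cast Int.one_le_abs hn
    nlinarith

/-- The area integral with the kernel `1 / (x - y)`, as a principal value at infinity. -/
theorem tendsto_setIntegral_abs_lt (h : IsPeriodicDensity Ω x g) :
    Tendsto (fun R => ∫ y in Ω ∩ {y | |y.re - x.re| < R}, g y / (x - y)) atTop
      (𝓝 (∫ y in Ω ∩ cell x, periodicKernel (x - y) * g y)) := by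
  have hpi := Real.pi_pos
  -- One period more on each side than `periodCount R` makes the window contain the whole strip; the
  -- excess is estimated next.
  have t1 := (tendsto_add_atTop_iff_nat 1).2 h.tendsto_setIntegral_window
  have t2 := t1.comp tendsto_periodCount
  set J := ∫ y in Ω ∩ cell x, ‖g y‖ with hJ
  have hJk : ∀ k : ℤ, ∫ y in Ω ∩ shiftCell x k, ‖g y‖ = J := fun k => by
    rw [h.isPeriodicSet.setIntegral_shiftCell]
    exact setIntegral_congr_fun h.measurableSet_cell fun y hy => by
      simp only [h.apply_add k hy.1]
  have t3 : Tendsto (fun R => (∫ y in Ω ∩ window x (periodCount R + 1), g y / (x - y))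
      - ∫ y in Ω ∩ {y | |y.re - x.re| < R}, g y / (x - y)) atTop (𝓝 0) := by
    have hlim : Tendsto (fun R : ℝ => R⁻¹ * (J + J + J)) atTop (𝓝 0) := by
      simpa using tendsto_inv_atTop_zero.mul_const (J + J + J)
    refine squeeze_zero_norm' ?_ hlim
    filter_upwards [eventually_ge_atTop π] with R hR
    have hR0 : 0 < R := hpi.trans_le hR
    set n := periodCount R with hn
    have hnR := periodCount_le hR
    rw [← hn] at hnR
    set V : Set ℂ := Ω ∩ {y | |y.re - x.re| < R} with hV
    have hVm : MeasurableSet V := h.measurableSet.inter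
      (isOpen_lt (by fun_prop) continuous_const).measurableSet
    have hVW : V ⊆ Ω ∩ window x (n + 1) := inter_subset_inter_right _ (setOf_abs_lt_subset x)
    rw [← setIntegral_sdiff hVm (h.integrableOn_div _) hVW]
    set S := (Ω ∩ window x (n + 1)) \ V with hS
    have hSm : MeasurableSet S := (h.measurableSet.inter (measurableSet_window x _)).diff hVm
    -- The third cell is needed only for the left edge of the half-open window, a line that is
    -- excluded from the strip when R = (2n + 1)π. In all, the excess has |g|-mass at most 3J at
    -- distance at least R.
    have hSsub : S ⊆ (Ω ∩ shiftCell x (n + 1) ∪ Ω ∩ shiftCell x (-(n + 1)))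
        ∪ Ω ∩ shiftCell x (-n) := by
      rintro y ⟨⟨hy, hw⟩, hyV⟩
      rw [window_succ] at hw
      rcases hw with (h1 | h1) | h1
      · exact Or.inl (Or.inl ⟨hy, h1⟩)
      · exact Or.inl (Or.inr ⟨hy, h1⟩)
      · refine Or.inr ⟨hy, ?_⟩
        have h2 : R ≤ |y.re - x.re| := not_lt.1 fun h3 => hyV ⟨hy, h3⟩
        rw [mem_shiftCell]
        push_cast
        rcases le_abs.1 h2 with h3 | h3
        · linarith [h1.2]
        · constructor <;> linarith [h1.1]
    have hSfar : ∀ y ∈ S, R ≤ ‖x - y‖ := by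
      rintro y ⟨⟨hy, -⟩, hyV⟩
      have h2 : R ≤ |y.re - x.re| := not_lt.1 fun h3 => hyV ⟨hy, h3⟩
      rw [abs_sub_comm] at h2
      exact h2.trans (by simpa using Complex.abs_re_le_norm (x - y))
    have hgS : IntegrableOn g S := (h.integrableOn_window _).mono_set sdiff_subset
    have b1 : ‖∫ y in S, g y / (x - y)‖ ≤ ∫ y in S, R⁻¹ * ‖g y‖ := by
      refine norm_integral_le_of_norm_le (hgS.norm.const_mul _) ?_
      filter_upwards [ae_restrict_mem hSm] with y hy
      rw [norm_div, div_eq_inv_mul]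
      gcongr
      exact hSfar y hy
    have b2 : ∫ y in S, ‖g y‖ ≤ J + J + J := by
      have i1 := (h.integrableOn_shiftCell (n + 1)).norm
      have i2 := (h.integrableOn_shiftCell (-(n + 1))).norm
      have i3 := (h.integrableOn_shiftCell (-n)).norm
      have h1 : volume.restrict S ≤ (volume.restrict (Ω ∩ shiftCell x (n + 1))
          + volume.restrict (Ω ∩ shiftCell x (-(n + 1)))) + volume.restrict (Ω ∩ shiftCell x (-n)) := by
        refine (Measure.restrict_mono hSsub le_rfl).trans ?_
        refine (Measure.restrict_union_le _ _).trans ?_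
        gcongr
        exact Measure.restrict_union_le _ _
      have h2 := integral_mono_measure h1 (ae_of_all _ fun y => norm_nonneg (g y))
        ((i1.add_measure i2).add_measure i3)
      rwa [integral_add_measure (i1.add_measure i2) i3, integral_add_measure i1 i2, hJk, hJk,
        hJk] at h2
    rw [integral_const_mul] at b1
    exact b1.trans (mul_le_mul_of_nonneg_left b2 (by positivity))
  have t4 := t2.sub t3
  rw [sub_zero] at t4
  exact t4.congr fun R => sub_sub_cancel _ _

end IsPeriodicDensity

end

section

/-! ### The jump relation for two fields on the two sides of a curve -/

variable {s : ℝ} {ζ : ℝ → ℂ} {E N : Set ℂ}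

namespace IsSeparated

theorem isPeriodicSet_E (h : IsSeparated s ζ E N) (hζ : IsPeriodicCurve s ζ) : IsPeriodicSet E :=
  fun n => (h.add_int_mul_mem hζ n).1

theorem isPeriodicSet_N (h : IsSeparated s ζ E N) (hζ : IsPeriodicCurve s ζ) : IsPeriodicSet N :=
  fun n => (h.add_int_mul_mem hζ n).2

theorem curve_mem_closure (h : IsSeparated s ζ E N) (hζ : IsPeriodicCurve s ζ) (a : ℝ) :
    ζ a ∈ closure E ∧ ζ a ∈ closure N := by
  obtain ⟨d, hd, hd', hN, hE⟩ := h.exists_isLeftSide hζ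
  refine ⟨?_, hN.curve_mem_closure hd hζ a⟩
  simpa [reverse] using hE.curve_mem_closure hd' hζ.reverse (-a)

/-- The Plemelj formula for N along ζ and for E along the reversed curve. Reversal changes the sign
of the line integral, so in the integral of the jump the half residues combine to the sum of the two
fields; the area term of E vanishes by holomorphy. -/
theorem tendsto_integral_regKernel_sub (h : IsSeparated s ζ E N) (hζ : IsPeriodicCurve s ζ)
    {fE fN : ℂ → ℂ} (hfE : IsPeriodicField E fE) (hfN : IsPeriodicField N fN)
    (hol : ∀ y ∈ E, dbar fE y = 0) (α : ℝ) :
    Tendsto (fun δ => ∫ β in (α - π)..(α + π),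
        regKernel δ (ζ α - ζ β) * ((fE (ζ β) - fN (ζ β)) * deriv ζ β)) (𝓝[>] 0)
      (𝓝 (I * π * (fE (ζ α) + fN (ζ α))
        - I * ∫ y in N ∩ cell (ζ α), periodicKernel (ζ α - y) * dbar fN y)) := by
  obtain ⟨d, hd, hd', hN, hE⟩ := h.exists_isLeftSide hζ
  have t1 := hN.tendsto_integral_regKernel hζ hd (h.isPeriodicSet_N hζ) hfN α
  have t2 := hE.tendsto_integral_regKernel hζ.reverse hd' (h.isPeriodicSet_E hζ) hfE (-α)
  have hcl := h.curve_mem_closure hζ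
  have hcE : Continuous fun β => fE (ζ β) :=
    hfE.smooth.continuousOn.comp_continuous hζ.continuous fun a => (hcl a).1
  have hcN : Continuous fun β => fN (ζ β) :=
    hfN.smooth.continuousOn.comp_continuous hζ.continuous fun a => (hcl a).2
  have hz0 : ∫ y in E ∩ cell (reverse ζ (-α)), periodicKernel (reverse ζ (-α) - y) * dbar fE y
      = 0 := by
    refine setIntegral_eq_zero_of_forall_eq_zero fun y hy => ?_
    rw [hol y hy.1, mul_zero]
  have hr : reverse ζ (-α) = ζ α := by simp [reverse]
  rw [hz0, hr] at t2
  have e2 : ∀ δ, ∫ β in (-α - π)..(-α + π),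
      regKernel δ (ζ α - reverse ζ β) * fE (reverse ζ β) * deriv (reverse ζ) β
      = -∫ β in (α - π)..(α + π), regKernel δ (ζ α - ζ β) * fE (ζ β) * deriv ζ β := by
    intro δ
    have := intervalIntegral.integral_comp_neg (a := -α - π) (b := -α + π)
      (fun β => regKernel δ (ζ α - ζ β) * fE (ζ β) * deriv ζ β)
    rw [show -(-α + π) = α - π by ring, show -(-α - π) = α + π by ring] at this
    rw [← this, ← intervalIntegral.integral_neg]
    refine intervalIntegral.integral_congr fun β _ => ?_
    simp only [deriv_reverse, reverse, mul_neg]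
  simp only [e2] at t2
  have t3 := (t2.neg).sub t1
  have e3 : -(I * 0 - I * π * fE (ζ α)) - (I * (∫ y in N ∩ cell (ζ α),
      periodicKernel (ζ α - y) * dbar fN y) - I * π * fN (ζ α))
      = I * π * (fE (ζ α) + fN (ζ α))
        - I * ∫ y in N ∩ cell (ζ α), periodicKernel (ζ α - y) * dbar fN y := by ring
  rw [e3] at t3
  refine t3.congr fun δ => ?_
  have hk : Continuous fun β => regKernel δ (ζ α - ζ β) :=
    (contDiff_regKernel δ).continuous.comp (continuous_const.sub hζ.continuous)
  have i1 : IntervalIntegrable (fun β => regKernel δ (ζ α - ζ β) * fE (ζ β) * deriv ζ β) volume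
      (α - π) (α + π) := ((hk.mul hcE).mul hζ.continuous_deriv).intervalIntegrable _ _
  have i2 : IntervalIntegrable (fun β => regKernel δ (ζ α - ζ β) * fN (ζ β) * deriv ζ β) volume
      (α - π) (α + π) := ((hk.mul hcN).mul hζ.continuous_deriv).intervalIntegrable _ _
  rw [neg_neg, ← intervalIntegral.integral_sub i1 i2]
  refine intervalIntegral.integral_congr fun β _ => ?_
  ring

/-- The principal values of the Cauchy integrals of the jump and of the area density. -/
theorem tendsto_cauchy (h : IsSeparated s ζ E N) (hζ : IsPeriodicCurve s ζ)
    {fE fN : ℂ → ℂ} (hfE : IsPeriodicField E fE) (hfN : IsPeriodicField N fN)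
    (hol : ∀ y ∈ E, dbar fE y = 0) (α : ℝ) {g : ℝ → ℂ}
    (hg : ∀ β, g β = (fE (ζ β) - fN (ζ β)) * deriv ζ β) :
    (Continuous g) ∧
    (∀ R : ℝ, IntegrableOn (fun y => dbar fN y / (ζ α - y)) (N ∩ {y | |y.re - (ζ α).re| < R})) ∧
    ∃ L J : ℂ, Tendsto (fun r : ℝ × ℝ => ∫ t in {t | r.1 < |t| ∧ |t| < r.2},
        g (α + t) / chord ζ α t) (𝓝[>] 0 ×ˢ atTop) (𝓝 L) ∧
      Tendsto (fun R => ∫ y in N ∩ {y | |y.re - (ζ α).re| < R}, dbar fN y / (ζ α - y))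
        atTop (𝓝 J) ∧
      L + I * J = I * π * (fE (ζ α) + fN (ζ α)) := by
  have hcl := h.curve_mem_closure hζ
  have hge : g = fun β => (fE (ζ β) - fN (ζ β)) * deriv ζ β := funext hg
  have hcE : Continuous fun β => fE (ζ β) :=
    hfE.smooth.continuousOn.comp_continuous hζ.continuous fun a => (hcl a).1
  have hcN : Continuous fun β => fN (ζ β) :=
    hfN.smooth.continuousOn.comp_continuous hζ.continuous fun a => (hcl a).2
  have hgc : Continuous g := hge ▸ (hcE.sub hcN).mul hζ.continuous_deriv
  have hgp : Function.Periodic g (2 * π) := hge ▸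
    ((hζ.periodic_comp (fun a => (hcl a).1) hfE.periodic).sub
      (hζ.periodic_comp (fun a => (hcl a).2) hfN.periodic)).mul hζ.deriv_periodic
  have hdens : IsPeriodicDensity N (ζ α) (dbar fN) :=
    { measurableSet := h.isOpen_N.measurableSet
      isPeriodicSet := h.isPeriodicSet_N hζ
      periodic := fun y hy => IsPeriodicSet.dbar_add h.isOpen_N
        (fun w hw => hfN.periodic w (subset_closure hw)) hy
      integrable := hfN.integrable _
      bounded := by
        obtain ⟨C, hC⟩ := exists_fderiv_le_of_contDiffOn_closure h.isOpen_N hfN.smooth (hcl α).2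
        exact ⟨2 * C, hC.mono fun y hy => (norm_dbar_le fN y).trans (by linarith)⟩ }
  refine ⟨hgc, hdens.integrableOn_div_abs_lt, I * π * (fE (ζ α) + fN (ζ α))
      - I * ∫ y in N ∩ cell (ζ α), periodicKernel (ζ α - y) * dbar fN y, _,
    hζ.tendsto_integral_truncated hgc hgp ?_, hdens.tendsto_setIntegral_abs_lt, ?_⟩
  · simp only [hg]
    exact h.tendsto_integral_regKernel_sub hζ hfE hfN hol α
  · ring

end IsSeparated

end

section

/-! ### Transfer between the Euclidean plane and the complex numbers -/

/-- The identification of the plane with `ℂ`. -/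
def toC : Plane ≃ₗᵢ[ℝ] ℂ := Complex.orthonormalBasisOneI.repr.symm

theorem toC_apply (x : Plane) : toC x = x 0 + x 1 * I :=
  Complex.orthonormalBasisOneI_repr_symm_apply x

theorem toC_re (x : Plane) : (toC x).re = x 0 := by simp [toC_apply]

theorem toC_im (x : Plane) : (toC x).im = x 1 := by simp [toC_apply]

theorem toC_symm_zero (y : ℂ) : (toC.symm y) 0 = y.re := by
  rw [← toC_re, LinearIsometryEquiv.apply_symm_apply]

theorem toC_symm_one (y : ℂ) : (toC.symm y) 1 = y.im := by
  rw [← toC_im, LinearIsometryEquiv.apply_symm_apply]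

theorem toC_e₁ : toC e₁ = 1 := by simp [toC_apply, e₁]

theorem toC_e₂ : toC e₂ = I := by simp [toC_apply, e₂]

theorem toC_symm_one_eq : toC.symm 1 = e₁ := by rw [← toC_e₁, LinearIsometryEquiv.symm_apply_apply]

theorem toC_symm_I : toC.symm I = e₂ := by rw [← toC_e₂, LinearIsometryEquiv.symm_apply_apply]

theorem toC_perp (x : Plane) : toC (perp x) = I * toC x := by
  simp only [toC_apply, perp]
  simp
  linear_combination (-(x 1 : ℂ)) * Complex.I_mul_I

theorem toC_smul (c : ℝ) (x : Plane) : toC (c • x) = c * toC x := by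
  rw [map_smul, Complex.real_smul]

theorem toC_symm_add_ofReal (y : ℂ) (c : ℝ) : toC.symm (y + (c : ℂ)) = toC.symm y + c • e₁ := by
  apply toC.injective
  rw [LinearIsometryEquiv.apply_symm_apply, map_add, toC_smul, toC_e₁,
    LinearIsometryEquiv.apply_symm_apply, mul_one]

/-- The conjugate of the identification of the plane with `ℂ`. -/
def conjC : Plane ≃ₗᵢ[ℝ] ℂ := toC.trans Complex.conjLIE

theorem conjC_apply (x : Plane) : conjC x = conj (toC x) := rfl

theorem conjC_smul (c : ℝ) (x : Plane) : conjC (c • x) = c * conjC x := by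
  rw [map_smul, Complex.real_smul]

/-- The conjugate of the kernel `x^⊥ / |x|²` is `-i / x`. -/
theorem conjC_kernel (x : Plane) : conjC (kernel x) = -I / toC x := by
  rw [kernel, conjC_smul, conjC_apply, toC_perp, map_mul, Complex.conj_I, ← toC.norm_map x]
  rcases eq_or_ne (toC x) 0 with h | h
  · simp [h]
  · have h1 : (toC x) * conj (toC x) = ((‖toC x‖ ^ 2 : ℝ) : ℂ) := by
      rw [Complex.mul_conj, Complex.normSq_eq_norm_sq]
    have h2 : ((‖toC x‖ ^ 2 : ℝ) : ℂ) ≠ 0 := by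
      have : 0 < ‖toC x‖ := norm_pos_iff.2 h
      exact_mod_cast (by positivity : ‖toC x‖ ^ 2 ≠ 0)
    rw [Complex.ofReal_inv]
    field_simp
    rw [mul_comm, h1]

/-- The imaginary part is a cross product, so it isolates the component of a normal to b, which
vanishes for the velocity jump and the tangent. -/
theorem conjC_mul_toC (a b : Plane) :
    conjC a * toC b = ((inner ℝ a b : ℝ) : ℂ) + ((a 0 * b 1 - a 1 * b 0 : ℝ) : ℂ) * I := by
  rw [conjC_apply, toC_apply, toC_apply, PiLp.inner_apply, Fin.sum_univ_two]
  simp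
  linear_combination (-(a 1 : ℂ) * b 1) * Complex.I_mul_I

/-- A set of the plane as a set of complex numbers. -/
def region (Ω : Set Plane) : Set ℂ := toC.symm ⁻¹' Ω

theorem closure_region (Ω : Set Plane) : closure (region Ω) = region (closure Ω) :=
  (toC.symm.toHomeomorph.preimage_closure Ω).symm

/-- The conjugate of a vector field, as a function of a complex variable. -/
def field (w : Plane → Plane) (y : ℂ) : ℂ := conjC (w (toC.symm y))

/-- The reason for the conjugation: divergence and curl become real and imaginary parts of a single
∂̄-derivative. -/
theorem dbar_field {w : Plane → Plane} {y : ℂ} (hw : DifferentiableAt ℝ w (toC.symm y)) :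
    dbar (field w) y
      = (divergence w (toC.symm y) : ℂ) - I * (curl w (toC.symm y) : ℂ) := by
  have h1 : HasFDerivAt (field w) ((conjC.toContinuousLinearEquiv : Plane →L[ℝ] ℂ).comp
      ((fderiv ℝ w (toC.symm y)).comp (toC.symm.toContinuousLinearEquiv : ℂ →L[ℝ] Plane))) y :=
    (conjC.toContinuousLinearEquiv : Plane →L[ℝ] ℂ).hasFDerivAt.comp y
      (hw.hasFDerivAt.comp y (toC.symm.toContinuousLinearEquiv : ℂ →L[ℝ] Plane).hasFDerivAt)
  have h2 : ∀ v : ℂ, fderiv ℝ (field w) y v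
      = conjC (fderiv ℝ w (toC.symm y) (toC.symm v)) := fun v => by
    rw [h1.fderiv]; rfl
  rw [dbar, h2, h2, toC_symm_one_eq, toC_symm_I, conjC_apply, conjC_apply, toC_apply, toC_apply,
    divergence, curl]
  simp
  linear_combination (-((fderiv ℝ w (toC.symm y) e₂) 1 : ℂ)) * Complex.I_mul_I

theorem setIntegral_region {F : Type*} [NormedAddCommGroup F] [NormedSpace ℝ F] (A : Set Plane)
    (f : Plane → F) : ∫ y in region A, f (toC.symm y) = ∫ x in A, f x :=
  toC.symm.measurePreserving.setIntegral_preimage_emb toC.symm.toMeasurableEquiv.measurableEmbedding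
    f A

theorem integrableOn_region {F : Type*} [NormedAddCommGroup F] (A : Set Plane) {f : Plane → F} :
    IntegrableOn (fun y => f (toC.symm y)) (region A) ↔ IntegrableOn f A :=
  toC.symm.measurePreserving.integrableOn_comp_preimage
    toC.symm.toMeasurableEquiv.measurableEmbedding

/-! ### The two-fluid interface in complex notation -/

section Interface

variable {T s : ℝ} {z : ℝ → ℝ → Plane} {ΩE ΩNS : ℝ → Set Plane} {t : ℝ}

/-- The interface at time `t` in complex notation. -/
def complexCurve (z : ℝ → ℝ → Plane) (t a : ℝ) : ℂ := toC (z t a)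

namespace IsInterface

theorem contDiff (h : IsInterface T s z ΩE ΩNS) (ht : t ∈ Icc 0 T) : ContDiff ℝ 4 (z t) := by
  have h1 : ContDiff ℝ 4 fun a : ℝ => (t, a) := contDiff_const.prodMk contDiff_id
  have h2 := h.smooth.comp (s := univ) h1.contDiffOn fun a _ => ⟨ht, mem_univ a⟩
  rw [← contDiffOn_univ]
  exact h2

theorem deriv_complexCurve (h : IsInterface T s z ΩE ΩNS) (ht : t ∈ Icc 0 T) (a : ℝ) :
    deriv (complexCurve z t) a = toC (deriv (z t) a) := by
  have h1 := (((h.contDiff ht).differentiable (by norm_num)) a).hasDerivAt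
  exact ((toC.toContinuousLinearEquiv : Plane →L[ℝ] ℂ).hasFDerivAt.comp_hasDerivAt a h1).deriv

theorem isPeriodicCurve (h : IsInterface T s z ΩE ΩNS) (ht : t ∈ Icc 0 T) :
    IsPeriodicCurve s (complexCurve z t) where
  orientation := h.orientation
  smooth := toC.toContinuousLinearEquiv.contDiff.comp ((h.contDiff ht).of_le (by norm_num))
  periodic a := by
    rw [complexCurve, h.periodic t ht a, map_add, toC_smul, toC_e₁, mul_one]
    rfl
  injective := toC.injective.comp (h.injective t ht)
  regular a := by
    rw [h.deriv_complexCurve ht]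
    exact fun h0 => h.regular t ht a ((map_eq_zero_iff toC toC.injective).1 h0)

theorem isSeparated (h : IsInterface T s z ΩE ΩNS) (ht : t ∈ Icc 0 T) :
    IsSeparated s (complexCurve z t) (region (ΩE t)) (region (ΩNS t)) := by
  have hr : range (complexCurve z t) = region (range (z t)) := by
    ext y
    constructor
    · rintro ⟨a, rfl⟩
      exact ⟨a, by simp [complexCurve]⟩
    · rintro ⟨a, ha⟩
      exact ⟨a, by simp [complexCurve, ha]⟩
  exact
    { isOpen_E := (h.isOpen_E t ht).preimage toC.symm.continuous
      isOpen_N := (h.isOpen_NS t ht).preimage toC.symm.continuous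
      isConnected_E := toC.symm.toHomeomorph.isConnected_preimage.2 (h.isConnected_E t ht)
      isConnected_N := toC.symm.toHomeomorph.isConnected_preimage.2 (h.isConnected_NS t ht)
      cover := by
        rw [hr, region, region, region, ← preimage_union, ← preimage_union, h.cover t ht,
          preimage_univ]
      disjoint_E_N := (h.disjoint_E_NS t ht).preimage _
      disjoint_E_curve := hr ▸ (h.disjoint_E_curve t ht).preimage _
      disjoint_N_curve := hr ▸ (h.disjoint_NS_curve t ht).preimage _
      side_E := by
        obtain ⟨M, hM⟩ := h.side_E t ht
        exact ⟨M, fun y hy => hM _ (by rwa [toC_symm_one])⟩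
      side_N := by
        obtain ⟨M, hM⟩ := h.side_NS t ht
        exact ⟨M, fun y hy => hM _ (by rwa [toC_symm_one])⟩ }

end IsInterface

theorem contDiffOn_field {Ω : ℝ → Set Plane} {w : ℝ → Plane → Plane}
    (hw : ContDiffOn ℝ 1 (fun q : ℝ × Plane => w q.1 q.2) (spaceTime T Ω)) (ht : t ∈ Icc 0 T) :
    ContDiffOn ℝ 1 (w t) (closure (Ω t)) ∧
      ContDiffOn ℝ 1 (field (w t)) (closure (region (Ω t))) := by
  have h1 : ContDiff ℝ 1 fun x : Plane => (t, x) := contDiff_const.prodMk contDiff_id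
  have h2 : ContDiffOn ℝ 1 (w t) (closure (Ω t)) :=
    hw.comp (s := closure (Ω t)) h1.contDiffOn fun x hx => ⟨ht, hx⟩
  refine ⟨h2, ?_⟩
  rw [closure_region]
  exact conjC.toContinuousLinearEquiv.contDiff.comp_contDiffOn
    (h2.comp toC.symm.toContinuousLinearEquiv.contDiff.contDiffOn fun y hy => hy)

/-- Integrability over one period strip implies integrability over every period cell. -/
theorem IsPeriodicSet.integrableOn_cell {Ω : Set ℂ} (hm : MeasurableSet Ω) (hp : IsPeriodicSet Ω)
    {g : ℂ → ℂ} (hg : ∀ y ∈ Ω, g (y + ((2 * π : ℝ) : ℂ)) = g y) {x₀ : ℂ}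
    (hi : IntegrableOn g (Ω ∩ cell x₀)) (x : ℂ) : IntegrableOn g (Ω ∩ cell x) := by
  have hpi := Real.two_pi_pos
  have hk : ∀ k : ℤ, IntegrableOn g (Ω ∩ shiftCell x₀ k) := fun k => by
    rw [hp.integrableOn_shiftCell]
    exact hi.congr_fun (fun y hy => (hp.add_int_mul hg k hy.1).symm)
      (hm.inter (measurableSet_cell x₀))
  set k : ℤ := ⌊(x.re - x₀.re) / (2 * π)⌋ with hkdef
  have h1 : (k : ℝ) * (2 * π) ≤ x.re - x₀.re := by
    rw [← le_div_iff₀ hpi]; exact Int.floor_le _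
  have h2 : x.re - x₀.re < (k + 1) * (2 * π) := by
    rw [← div_lt_iff₀ hpi]; exact Int.lt_floor_add_one _
  refine ((hk k).union (hk (k + 1))).mono_set fun y hy => ?_
  rw [← inter_union_distrib_left]
  refine ⟨hy.1, ?_⟩
  have h3 := hy.2.1
  have h4 := hy.2.2
  by_cases h5 : y.re < x₀.re + k * (2 * π) + π
  · exact Or.inl (mem_shiftCell.2 ⟨by linarith, h5⟩)
  · refine Or.inr (mem_shiftCell.2 ?_)
    push_cast
    constructor <;> linarith

end Interface

end

section

/-! ### The velocity fields in complex notation -/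

variable {ρE ρNS ν g σ T s : ℝ} {z : ℝ → ℝ → Plane} {ΩE ΩNS : ℝ → Set Plane}
  {u v : ℝ → Plane → Plane} {p q : ℝ → Plane → ℝ} {t : ℝ}

theorem dbar_field_of_mem {Ω : Set Plane} (ho : IsOpen Ω) {w : Plane → Plane}
    (hw : ContDiffOn ℝ 1 w (closure Ω)) {y : ℂ} (hy : y ∈ region Ω)
    (hdiv : ∀ x ∈ Ω, divergence w x = 0) :
    dbar (field w) y = -I * (curl w (toC.symm y) : ℂ) := by
  have h1 : DifferentiableAt ℝ w (toC.symm y) :=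
    (hw.contDiffAt (mem_of_superset (ho.mem_nhds hy) subset_closure)).differentiableAt one_ne_zero
  rw [dbar_field h1, hdiv _ hy]
  push_cast
  ring

theorem field_periodic {Ω : Set Plane} {w : Plane → Plane}
    (hw : ∀ x ∈ closure Ω, w (x + (2 * π) • e₁) = w x) :
    ∀ y ∈ closure (region Ω), field w (y + ((2 * π : ℝ) : ℂ)) = field w y := by
  intro y hy
  rw [closure_region] at hy
  rw [field, field, toC_symm_add_ofReal, hw _ hy]

theorem field_decay {Ω : Set Plane} {w : Plane → Plane}
    (hw : ∀ ε > 0, ∃ M : ℝ, ∀ x ∈ Ω, M < |x 1| → ‖w x‖ < ε) :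
    ∀ ε > 0, ∃ M : ℝ, ∀ y ∈ region Ω, M < |y.im| → ‖field w y‖ < ε := by
  intro ε hε
  obtain ⟨M, hM⟩ := hw ε hε
  refine ⟨M, fun y hy him => ?_⟩
  rw [field, conjC.norm_map]
  exact hM _ hy (by rwa [toC_symm_one])

theorem isPeriodicField_euler (hz : IsInterface T s z ΩE ΩNS)
    (hspace : InFunctionSpaces T ΩE ΩNS u v p q)
    (hsol : SolvesSystem ρE ρNS ν g σ T z ΩE ΩNS u v p q) (ht : t ∈ Icc 0 T) :
    IsPeriodicField (region (ΩE t)) (field (u t)) ∧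
      ∀ y ∈ region (ΩE t), dbar (field (u t)) y = 0 := by
  obtain ⟨h1, h2⟩ := contDiffOn_field hspace.smooth_u ht
  have h3 : ∀ y ∈ region (ΩE t), dbar (field (u t)) y = 0 := fun y hy => by
    rw [dbar_field_of_mem (hz.isOpen_E t ht) h1 hy (hsol.div_u t ht), hsol.curl_u t ht _ hy]
    simp
  have hm : MeasurableSet (region (ΩE t)) := (hz.isSeparated ht).isOpen_E.measurableSet
  refine ⟨⟨h2, field_periodic (hspace.periodic_u t ht), field_decay (hspace.decay_u t ht),
    fun x => ?_⟩, h3⟩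
  exact integrableOn_zero.congr_fun (fun y hy => (h3 y hy.1).symm) (hm.inter (measurableSet_cell x))

theorem isPeriodicField_navierStokes (hz : IsInterface T s z ΩE ΩNS)
    (hspace : InFunctionSpaces T ΩE ΩNS u v p q)
    (hsol : SolvesSystem ρE ρNS ν g σ T z ΩE ΩNS u v p q) (ht : t ∈ Icc 0 T) :
    IsPeriodicField (region (ΩNS t)) (field (v t)) ∧
      ∀ y ∈ region (ΩNS t), dbar (field (v t)) y = -I * (curl (v t) (toC.symm y) : ℂ) := by
  obtain ⟨h1, h2⟩ := contDiffOn_field (hspace.smooth_v.of_le (by norm_num)) ht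
  have h3 : ∀ y ∈ region (ΩNS t), dbar (field (v t)) y = -I * (curl (v t) (toC.symm y) : ℂ) :=
    fun y hy => dbar_field_of_mem (hz.isOpen_NS t ht) h1 hy (hsol.div_v t ht)
  have hsep := hz.isSeparated ht
  have ho : IsOpen (region (ΩNS t)) := hsep.isOpen_N
  have hm : MeasurableSet (region (ΩNS t)) := ho.measurableSet
  have hper := field_periodic (hspace.periodic_v t ht)
  refine ⟨⟨h2, hper, field_decay (hspace.decay_v t ht), fun x => ?_⟩, h3⟩
  -- The cell centred at π is the strip 0 ≤ x₁ < 2π of the integrability hypothesis; periodicity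
  -- transfers it to all cells.
  refine (hsep.isPeriodicSet_N (hz.isPeriodicCurve ht)).integrableOn_cell hm
    (fun y hy => IsPeriodicSet.dbar_add ho (fun w hw => hper w (subset_closure hw)) hy)
    (x₀ := (π : ℂ)) ?_ x
  have h4 := (integrableOn_region _).2 (hspace.integrable_curl t ht)
  have e : region (ΩNS t ∩ {x | 0 ≤ x 0 ∧ x 0 < 2 * π}) = region (ΩNS t) ∩ cell (π : ℂ) := by
    ext y
    simp only [region, mem_preimage, mem_inter_iff, mem_ofPred, cell, toC_symm_zero,
      Complex.ofReal_re, sub_self]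
    rw [show π + π = 2 * π by ring]
  rw [e] at h4
  have h5 : IntegrableOn (fun y => -I * (curl (v t) (toC.symm y) : ℂ))
      (region (ΩNS t) ∩ cell (π : ℂ)) := h4.ofReal.const_mul _
  exact h5.congr_fun (fun y hy => (h3 y hy.1).symm) (hm.inter (measurableSet_cell _))

/-- Only the tangential component of the velocity jumps. -/
theorem field_sub_mul_deriv (hz : IsInterface T s z ΩE ΩNS)
    (hsol : SolvesSystem ρE ρNS ν g σ T z ΩE ΩNS u v p q) (ht : t ∈ Icc 0 T) (β : ℝ) :
    (interfaceVorticity z u v t β : ℂ)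
      = (field (u t) (complexCurve z t β) - field (v t) (complexCurve z t β))
        * deriv (complexCurve z t) β := by
  have h1 := hsol.kinematic_u t ht β
  -- Replacing ∂_t z by v turns the kinematic condition for u into equality of the normal components
  -- of u and v.
  rw [sub_eq_zero.1 (hsol.kinematic_v t ht β)] at h1
  have h2 : (u t (z t β) - v t (z t β)) 0 * (deriv (z t) β) 1
      - (u t (z t β) - v t (z t β)) 1 * (deriv (z t) β) 0 = 0 := by
    rw [PiLp.inner_apply, Fin.sum_univ_two] at h1
    simp [normal, perp] at h1
    simp only [PiLp.sub_apply]
    linarith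
  have h3 : ∀ w : Plane → Plane, field w (complexCurve z t β) = conjC (w (z t β)) := fun w => by
    rw [field, complexCurve, LinearIsometryEquiv.symm_apply_apply]
  rw [h3, h3, ← map_sub, hz.deriv_complexCurve ht, conjC_mul_toC, h2, interfaceVorticity]
  simp

/-! ### The singular integrals in complex notation -/

theorem conjC_brIntegrand (ω : ℝ → ℝ) (α τ : ℝ) :
    conjC (brIntegrand (z t) ω α (α + τ))
      = -I * ((ω (α + τ) : ℂ) / chord (complexCurve z t) α τ) := by
  rw [brIntegrand, conjC_smul, conjC_kernel, map_sub, chord, complexCurve, complexCurve]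
  ring

theorem preimage_add_left_annulus (α δ R : ℝ) :
    (fun τ => α + τ) ⁻¹' {β : ℝ | δ < |β - α| ∧ |β - α| < R} = {τ | δ < |τ| ∧ |τ| < R} := by
  ext τ
  simp

theorem conjC_brTruncated (ω : ℝ → ℝ) (α : ℝ) (r : ℝ × ℝ) :
    conjC (brTruncated (z t) ω α r) = (2 * π : ℂ)⁻¹ * (-I *
      ∫ τ in {τ | r.1 < |τ| ∧ |τ| < r.2}, (ω (α + τ) : ℂ) / chord (complexCurve z t) α τ) := by
  rw [brTruncated, conjC_smul]
  congr 1
  · push_cast; rfl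
  · have h1 := conjC.toContinuousLinearEquiv.integral_comp_comm
      (μ := volume.restrict {β : ℝ | r.1 < |β - α| ∧ |β - α| < r.2}) (brIntegrand (z t) ω α)
    refine h1.symm.trans ?_
    rw [← (measurePreserving_add_left volume α).setIntegral_preimage_emb
      (measurableEmbedding_addLeft α), preimage_add_left_annulus, ← integral_const_mul]
    exact integral_congr_ae (ae_of_all _ fun τ => conjC_brIntegrand ω α τ)

theorem integrableOn_brIntegrand {ω : ℝ → ℝ} {α δ R : ℝ}
    (h : IntegrableOn (fun τ => (ω (α + τ) : ℂ) / chord (complexCurve z t) α τ)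
      {τ | δ < |τ| ∧ |τ| < R}) :
    IntegrableOn (brIntegrand (z t) ω α) {β : ℝ | δ < |β - α| ∧ |β - α| < R} := by
  rw [← (measurePreserving_add_left volume α).integrableOn_comp_preimage
    (measurableEmbedding_addLeft α), preimage_add_left_annulus, IntegrableOn,
    ← conjC.integrable_comp_iff]
  exact (h.const_mul (-I)).congr (ae_of_all _ fun τ => (conjC_brIntegrand ω α τ).symm)

theorem conjC_bulkIntegrand {Ω : ℝ → Set Plane}
    (hv : ∀ y ∈ region (Ω t), dbar (field (v t)) y = -I * (curl (v t) (toC.symm y) : ℂ))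
    (x : Plane) {y : ℂ} (hy : y ∈ region (Ω t)) :
    conjC (bulkIntegrand (bulkVorticity Ω v t) x (toC.symm y))
      = dbar (field (v t)) y / (toC x - y) := by
  have hy' : toC.symm y ∈ Ω t := hy
  rw [bulkIntegrand, bulkVorticity, indicator_of_mem hy', conjC_smul, conjC_kernel, map_sub,
    LinearIsometryEquiv.apply_symm_apply, hv y hy]
  ring

theorem region_inter_strip (A : Set Plane) (x : Plane) (R : ℝ) :
    region (A ∩ {y | |y 0 - x 0| < R}) = region A ∩ {y | |y.re - (toC x).re| < R} := by
  ext y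
  simp only [region, mem_preimage, mem_inter_iff, mem_ofPred, toC_symm_zero, toC_re]

theorem conjC_bulkTruncated {Ω : ℝ → Set Plane} (hm : IsOpen (Ω t))
    (hv : ∀ y ∈ region (Ω t), dbar (field (v t)) y = -I * (curl (v t) (toC.symm y) : ℂ))
    (x : Plane) (R : ℝ) :
    conjC (bulkTruncated (Ω t) (bulkVorticity Ω v t) x R) = (2 * π : ℂ)⁻¹ *
      ∫ y in region (Ω t) ∩ {y | |y.re - (toC x).re| < R}, dbar (field (v t)) y / (toC x - y) := by
  rw [bulkTruncated, conjC_smul]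
  congr 1
  · push_cast; rfl
  · have h1 := conjC.toContinuousLinearEquiv.integral_comp_comm
      (μ := volume.restrict (Ω t ∩ {y | |y 0 - x 0| < R}))
      (bulkIntegrand (bulkVorticity Ω v t) x)
    refine h1.symm.trans ?_
    rw [← setIntegral_region, region_inter_strip]
    have hms : MeasurableSet (region (Ω t) ∩ {y | |y.re - (toC x).re| < R}) :=
      (hm.preimage toC.symm.continuous).measurableSet.inter
        (isOpen_lt (by fun_prop) continuous_const).measurableSet
    exact setIntegral_congr_fun hms fun y hy => conjC_bulkIntegrand hv x hy.1

theorem integrableOn_bulkIntegrand {Ω : ℝ → Set Plane} (hm : IsOpen (Ω t))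
    (hv : ∀ y ∈ region (Ω t), dbar (field (v t)) y = -I * (curl (v t) (toC.symm y) : ℂ))
    {x : Plane} {R : ℝ} (h : IntegrableOn (fun y => dbar (field (v t)) y / (toC x - y))
      (region (Ω t) ∩ {y | |y.re - (toC x).re| < R})) :
    IntegrableOn (bulkIntegrand (bulkVorticity Ω v t) x) (Ω t ∩ {y | |y 0 - x 0| < R}) := by
  rw [← integrableOn_region, region_inter_strip, IntegrableOn, ← conjC.integrable_comp_iff]
  have hms : MeasurableSet (region (Ω t) ∩ {y | |y.re - (toC x).re| < R}) :=
    (hm.preimage toC.symm.continuous).measurableSet.inter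
      (isOpen_lt (by fun_prop) continuous_const).measurableSet
  exact h.congr_fun (fun y hy => (conjC_bulkIntegrand hv x hy.1).symm) hms

/-- A limit in the plane can be computed in complex notation. -/
theorem tendsto_of_conjC {ι : Type*} {l : Filter ι} {f : ι → Plane} {b : ℂ}
    (h : Tendsto (fun i => conjC (f i)) l (𝓝 b)) : Tendsto f l (𝓝 (conjC.symm b)) := by
  refine ((conjC.symm.continuous.tendsto b).comp h).congr fun i => ?_
  simp

/-! ### Assembly of the formula -/

/-- The velocity on the interface is the sum of the jump term and the two singular integrals. -/
theorem velocity_eq (hz : IsInterface T s z ΩE ΩNS) (hspace : InFunctionSpaces T ΩE ΩNS u v p q)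
    (hsol : SolvesSystem ρE ρNS ν g σ T z ΩE ΩNS u v p q) (ht : t ∈ Icc 0 T) (α : ℝ) :
    BirkhoffRottExists (z t) (interfaceVorticity z u v t) α ∧
    BulkBiotSavartExists (ΩNS t) (bulkVorticity ΩNS v t) (z t α) ∧
    u t (z t α) = (interfaceVorticity z u v t α / (2 * ‖deriv (z t) α‖ ^ 2)) • deriv (z t) α
      + birkhoffRott (z t) (interfaceVorticity z u v t) α
      + bulkBiotSavart (ΩNS t) (bulkVorticity ΩNS v t) (z t α) := by
  have hζ := hz.isPeriodicCurve ht
  obtain ⟨hfE, hol⟩ := isPeriodicField_euler hz hspace hsol ht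
  obtain ⟨hfN, hcurl⟩ := isPeriodicField_navierStokes hz hspace hsol ht
  have hjump := field_sub_mul_deriv hz hsol ht
  obtain ⟨hgc, hint, L, J, hL, hJ, hLJ⟩ :=
    (hz.isSeparated ht).tendsto_cauchy hζ hfE hfN hol α hjump
  have hbr : Tendsto (brTruncated (z t) (interfaceVorticity z u v t) α)
      (𝓝[>] (0 : ℝ) ×ˢ (atTop : Filter ℝ)) (𝓝 (conjC.symm ((2 * π : ℂ)⁻¹ * (-I * L)))) := by
    refine tendsto_of_conjC (((hL.const_mul (-I)).const_mul _).congr fun r => ?_)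
    rw [conjC_brTruncated]
  have hbulk : Tendsto (bulkTruncated (ΩNS t) (bulkVorticity ΩNS v t) (z t α)) (atTop : Filter ℝ)
      (𝓝 (conjC.symm ((2 * π : ℂ)⁻¹ * J))) := by
    refine tendsto_of_conjC ((hJ.const_mul _).congr fun R => ?_)
    rw [conjC_bulkTruncated (hz.isOpen_NS t ht) hcurl]
    rfl
  refine ⟨⟨fun δ hδ R => integrableOn_brIntegrand (hζ.integrableOn_div_chord hgc α hδ R), _, hbr⟩,
    ⟨fun R => integrableOn_bulkIntegrand (hz.isOpen_NS t ht) hcurl (hint R), _, hbulk⟩, ?_⟩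
  rw [birkhoffRott, bulkBiotSavart, hbr.limUnder_eq, hbulk.limUnder_eq]
  apply conjC.injective
  have hτ := hz.regular t ht α
  set τ := deriv (z t) α with hτdef
  have hτ0 : toC τ ≠ 0 := fun h0 => hτ ((map_eq_zero_iff toC toC.injective).1 h0)
  have h1 : (toC τ) * conjC τ = ((‖τ‖ ^ 2 : ℝ) : ℂ) := by
    rw [conjC_apply, Complex.mul_conj, Complex.normSq_eq_norm_sq, toC.norm_map]
  have h2 : (interfaceVorticity z u v t α : ℂ) = (field (u t) (complexCurve z t α)
      - field (v t) (complexCurve z t α)) * toC τ := by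
    rw [hjump α, hz.deriv_complexCurve ht]
  have h3 : conjC (u t (z t α)) = field (u t) (complexCurve z t α) := by
    rw [field, complexCurve, LinearIsometryEquiv.symm_apply_apply]
  have hnorm : ((‖τ‖ ^ 2 : ℝ) : ℂ) ≠ 0 := by
    have : 0 < ‖τ‖ := norm_pos_iff.2 hτ
    exact_mod_cast (by positivity : ‖τ‖ ^ 2 ≠ 0)
  have hpi : (π : ℂ) ≠ 0 := by exact_mod_cast Real.pi_ne_zero
  rw [map_add, map_add, conjC_smul, LinearIsometryEquiv.apply_symm_apply,
    LinearIsometryEquiv.apply_symm_apply, h3]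
  set a := field (u t) (complexCurve z t α)
  set b := field (v t) (complexCurve z t α)
  -- Since conj(τ)/|τ|² = 1/τ and ω_Γ = (a − b)τ, the tangential term is half the jump.
  have e1 : ((interfaceVorticity z u v t α / (2 * ‖τ‖ ^ 2) : ℝ) : ℂ) * conjC τ = (a - b) / 2 := by
    rw [Complex.ofReal_div, h2, Complex.ofReal_mul, ← h1]
    rw [← h1] at hnorm
    have hc0 : conjC τ ≠ 0 := right_ne_zero_of_mul hnorm
    push_cast
    field_simp
  -- The jump relation multiplied by −i: together the two singular integrals are the mean of both
  -- boundary values.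
  have e2 : (2 * π : ℂ)⁻¹ * (-I * L) + (2 * π : ℂ)⁻¹ * J = (a + b) / 2 := by
    have : -I * L + J = π * (a + b) := by
      linear_combination (-I) * hLJ + (J - π * (a + b)) * Complex.I_mul_I
    rw [← mul_add, this]
    field_simp
  rw [add_assoc, e1, e2]
  ring

end

end TwoFluid

end

theorem proposition2p1 (ρE ρNS ν g σ T s : ℝ)
    (hρE : 0 < ρE) (hρNS : 0 < ρNS) (hν : 0 < ν) (hg : 0 < g) (hσ : 0 ≤ σ) (hT : 0 < T)
    (z : ℝ → ℝ → TwoFluid.Plane) (ΩE ΩNS : ℝ → Set TwoFluid.Plane)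
    (u v : ℝ → TwoFluid.Plane → TwoFluid.Plane) (p q : ℝ → TwoFluid.Plane → ℝ)
    (hz : TwoFluid.IsInterface T s z ΩE ΩNS)
    (hspace : TwoFluid.InFunctionSpaces T ΩE ΩNS u v p q)
    (hsol : TwoFluid.SolvesSystem ρE ρNS ν g σ T z ΩE ΩNS u v p q) :
    ∀ t ∈ Icc 0 T, ∀ α : ℝ,
      TwoFluid.BirkhoffRottExists (z t) (TwoFluid.interfaceVorticity z u v t) α ∧
      TwoFluid.BulkBiotSavartExists (ΩNS t) (TwoFluid.bulkVorticity ΩNS v t) (z t α) ∧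
      u t (z t α) =
        (TwoFluid.interfaceVorticity z u v t α / (2 * ‖deriv (z t) α‖ ^ 2)) • deriv (z t) α
          + TwoFluid.birkhoffRott (z t) (TwoFluid.interfaceVorticity z u v t) α
          + TwoFluid.bulkBiotSavart (ΩNS t) (TwoFluid.bulkVorticity ΩNS v t) (z t α) :=
  fun _ ht α => TwoFluid.velocity_eq hz hspace hsol ht α
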